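/- Fix integers $n\ge 1$ and $\ell\ge 3$. Let $U(n)$ be the unitary group, let $\Gamma_\ell=\langle\gamma_1,\dots,\gamma_\ell:\gamma_1\cdots\gamma_\ell=1\rangle$, and let $\mathrm{Hom}(\Gamma_\ell,U(n))$ be the space of homomorphisms, identified with $\{(A_1,\dots,A_\ell)\in U(n)^\ell: A_1\cdots A_\ell=I\}$, on which $U(n)$ acts by conjugation. Let $\Lambda(n)$ be the manifold of Lagrangian subspaces of $\mathbb C^n$ (real subspaces equal to their own orthogonal for the imaginary part of the standard hermitian form), with its smooth structure as a submanifold of the real Grassmannian. For $L\in\Lambda(n)$ let $\sigma_L$ be the anti-linear involution of $\mathbb C^n$ with fixed point set $L$ (equal to $1$ on $L$ and $-1$ on $iL$). Define $$\tilde\varphi:\Lambda(n)^\ell\to \mathrm{Hom}(\Gamma_\ell,U(n)),\qquad \tilde\varphi(L_1,\dots,L_\ell)(\gamma_s)=\sigma_{L_s}\sigma_{L_{s+1}}\quad (L_{\ell+1}=L_1).$$ It is equivariant for the diagonal action of $U(n)$ on $\Lambda(n)^\ell$ and conjugation. Write $Z(\lambda)$ and $Z(\rho)$ for the stabilizers in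 $U(n)$ of $\lambda\in\Lambda(n)^\ell$ and of $\rho\in\mathrm{Hom}(\Gamma_\ell,U(n))$. Let $\mathrm{Hom}^{irr}$ be the set of irreducible homomorphisms, $\mathcal L\mathrm{Hom}^{irr}=\mathrm{Hom}^{irr}\cap\mathrm{Im}(\tilde\varphi)$, $\Lambda^\ell_{irr}(n)=\tilde\varphi^{-1}(\mathrm{Hom}^{irr})$, $\mathrm{Rep}^{irr}=U(n)\backslash\mathrm{Hom}^{irr}$ with its quotient smooth structure, $\mathcal L\mathrm{Rep}^{irr}\subset\mathrm{Rep}^{irr}$ the set of classes of elements of $\mathcal L\mathrm{Hom}^{irr}$, and $\varphi:U(n)\backslash\Lambda^\ell_{irr}(n)\to\mathrm{Rep}^{irr}$ the map induced by $\tilde\varphi$. Then: 1. For every $\lambda\in\Lambda(n)^\ell$ and $\rho=\tilde\varphi(\lambda)$ one has $Z(\lambda)\subset Z(\rho)$, and $g\mapsto g\lambda$ induces a diffeomorphism $Z(\rho)/Z(\lambda)\cong\tilde\varphi^{-1}(\rho)$. Moreover, $\mathcal L\mathrm{Hom}^{irr}$ is an embedded submanifold of $\mathrm{Hom}(\Gamma_\ell,U(n))$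 of dimension $$\frac{\ell}{2}n^2+\frac{\ell}{2}n-1,$$ and $\tilde\varphi:\Lambda^\ell_{irr}(n)\to\mathcal L\mathrm{Hom}^{irr}$ is a (smooth, locally trivial) circle bundle. 2. The stabilizer in $U(n)$ of every point of $\Lambda^\ell_{irr}(n)$ is exactly $\{\pm I\}$; that is, $U(n)/\{\pm I\}$, through which $U(n)$ acts, acts freely on $\Lambda^\ell_{irr}(n)$. Moreover, $\varphi: U(n)\backslash\Lambda^\ell_{irr}(n)\to\mathrm{Rep}^{irr}$ is a smooth embedding with image $\mathcal L\mathrm{Rep}^{irr}$, which is an embedded submanifold of dimension $$\frac{\ell-2}{2}n^2+\frac{\ell}{2}n.$$ -/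

import Mathlib

open scoped ContDiff Manifold Topology

noncomputable section

/-! ## Smooth structures given by their smooth functions

A smooth structure on a topological space is recorded by its germs of smooth real-valued
functions.  Subspaces and quotients of smooth manifolds carry canonical such structures, and a
space is a smooth manifold when its smooth functions are those of a smooth atlas. -/

/-- `SmoothAt f x` says that `f` is smooth on a neighbourhood of `x`. -/
class SmoothSpace (X : Type*) where
  SmoothAt : (X → ℝ) → X → Prop

namespace SmoothSpace

/-- A real normed space: functions that are `C^∞` on a neighbourhood of the point. -/
instance ofNormedSpace (E : Type*) [NormedAddCommGroup E] [NormedSpace ℝ E] : SmoothSpace E where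
  SmoothAt f x := ∀ᶠ y in 𝓝 x, ContDiffAt ℝ ∞ f y

/-- The structure induced by a map `i : X → Y`: a function is smooth if it is locally the pullback
of a smooth function. For an inclusion: if it extends locally to a smooth function. -/
@[reducible] def induced {X Y : Type*} [TopologicalSpace X] [SmoothSpace Y] (i : X → Y) :
    SmoothSpace X where
  SmoothAt f x := ∃ g : Y → ℝ, SmoothAt g (i x) ∧ f =ᶠ[𝓝 x] g ∘ i

/-- The structure coinduced by a map `p : X → Y` (meant for quotient maps): a function is smooth
if its pullback is smooth. -/
@[reducible] def coinduced {X Y : Type*} [TopologicalSpace Y] [SmoothSpace X] (p : X → Y) :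
    SmoothSpace Y where
  SmoothAt f y := ∃ U ∈ 𝓝 y, ∀ x, p x ∈ U → SmoothAt (f ∘ p) x

instance subtype {X : Type*} [TopologicalSpace X] [SmoothSpace X] (P : X → Prop) :
    SmoothSpace {x // P x} := induced Subtype.val

instance quotient {X : Type*} [TopologicalSpace X] [SmoothSpace X] (s : Setoid X) :
    SmoothSpace (Quotient s) := coinduced (Quotient.mk s)

instance cosets {G : Type*} [Group G] [TopologicalSpace G] [SmoothSpace G] (H : Subgroup G) :
    SmoothSpace (G ⧸ H) := coinduced (QuotientGroup.mk : G → G ⧸ H)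

/-- The product structure: functions that are locally smooth expressions in finitely many smooth
functions of the two factors. -/
instance prod (X Y : Type*) [TopologicalSpace X] [TopologicalSpace Y] [SmoothSpace X]
    [SmoothSpace Y] : SmoothSpace (X × Y) where
  SmoothAt f q := ∃ (k m : ℕ) (g : Fin k → X → ℝ) (h : Fin m → Y → ℝ)
    (F : (Fin k → ℝ) × (Fin m → ℝ) → ℝ),
      (∀ i, SmoothAt (g i) q.1) ∧ (∀ j, SmoothAt (h j) q.2) ∧
      SmoothAt F (fun i => g i q.1, fun j => h j q.2) ∧
      f =ᶠ[𝓝 q] fun r => F (fun i => g i r.1, fun j => h j r.2)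

/-- The unit circle as a submanifold of `ℂ`. -/
instance circle : SmoothSpace Circle := induced (fun z : Circle => (z : ℂ))

section Maps

variable {X Y : Type*} [TopologicalSpace X] [TopologicalSpace Y] [SmoothSpace X] [SmoothSpace Y]

/-- Smooth maps: continuous maps which pull smooth functions back to smooth functions. -/
def IsSmoothMap (f : X → Y) : Prop :=
  Continuous f ∧ ∀ (x : X) (g : Y → ℝ), SmoothAt g (f x) → SmoothAt (g ∘ f) x

/-- Diffeomorphisms: bijections that are smooth in both directions. -/
def IsDiffeo (f : X → Y) : Prop :=
  IsSmoothMap f ∧ ∃ g : Y → X, IsSmoothMap g ∧ Function.LeftInverse g f ∧ Function.RightInverse g f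

/-- Smooth embeddings: topological embeddings for which the smooth functions on the source are
locally the restrictions of the smooth functions on the target. -/
def IsSmoothEmbedding (f : X → Y) : Prop :=
  Topology.IsEmbedding f ∧ ∀ (x : X) (g : X → ℝ),
    SmoothAt g x ↔ ∃ h : Y → ℝ, SmoothAt h (f x) ∧ g =ᶠ[𝓝 x] h ∘ f

variable (X) in
/-- `X` is a (Hausdorff, second countable) smooth manifold of dimension `d`: it has a smooth atlas
whose smooth functions are the given ones. -/
def IsSmoothManifold (d : ℕ) : Prop :=
  T2Space X ∧ SecondCountableTopology X ∧
    ∃ _ : ChartedSpace (EuclideanSpace ℝ (Fin d)) X, IsManifold (𝓡 d) ∞ X ∧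
      ∀ (f : X → ℝ) (x : X),
        SmoothAt f x ↔ ∀ᶠ y in 𝓝 x, ContMDiffAt (𝓡 d) 𝓘(ℝ, ℝ) ∞ f y

/-- A subset is an embedded submanifold of dimension `d` if it is a smooth manifold of dimension
`d` for the topology and the smooth functions induced from the ambient space. -/
def IsEmbeddedSubmanifold (S : Set X) (d : ℕ) : Prop := IsSmoothManifold S d

/-- A smooth map `p : X → Y` is a circle bundle if over small open subsets of `Y` it is
diffeomorphic to the projection from the product with a circle. -/
def IsCircleBundle (p : X → Y) : Prop :=
  IsSmoothMap p ∧ ∀ y : Y, ∃ U : Set Y, IsOpen U ∧ y ∈ U ∧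
    ∃ Ψ : U × Circle → p ⁻¹' U, IsDiffeo Ψ ∧ ∀ q, p (Ψ q) = q.1

end Maps

end SmoothSpace

namespace LagrangianRep

/-! ## Lagrangian subspaces and their involutions -/

/-- `ℂⁿ` with its standard hermitian inner product. -/
abbrev Cn (n : ℕ) : Type := EuclideanSpace ℂ (Fin n)

/-- The unitary group `U(n)` (unitary operators of `ℂⁿ`). -/
abbrev U (n : ℕ) : Type := unitary (Cn n →L[ℂ] Cn n)

/-- Lagrangian subspaces of `ℂⁿ`: real subspaces equal to their own orthogonal for the symplectic
form `Im ⟪v, w⟫`. -/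
structure Lagrangian (n : ℕ) where
  space : Submodule ℝ (Cn n)
  isLagrangian : ∀ v, v ∈ space ↔ ∀ w ∈ space, (inner ℂ v w).im = 0

namespace Lagrangian

variable {n : ℕ}

@[ext] theorem ext {L L' : Lagrangian n} (h : L.space = L'.space) : L = L' := by
  cases L; cases L'; simp_all

/-- The real orthogonal projection onto `L`. -/
def proj (L : Lagrangian n) : Cn n →L[ℝ] Cn n := L.space.starProjection

/-- `Λ(n)` is a submanifold of the real Grassmannian of `ℂⁿ`, whose topology and smooth structure
are induced by sending a subspace to the orthogonal projection onto it. -/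
instance : TopologicalSpace (Lagrangian n) := TopologicalSpace.induced proj inferInstance

/-- The product manifold `Λ(n) × ⋯ × Λ(n)`. -/
instance (ℓ : ℕ) : SmoothSpace (Fin ℓ → Lagrangian n) :=
  SmoothSpace.induced (fun lam s => (lam s).proj)

/-- The involution `σ_L`: the identity on `L`, minus the identity on `L^⊥ = iL`. -/
def σ (L : Lagrangian n) : Cn n ≃ₗᵢ[ℝ] Cn n := L.space.reflection

theorem re_inner_eq (x y : Cn n) : inner ℝ x y = (inner ℂ x y).re := by
  simp [PiLp.inner_apply, Complex.inner]

theorem mem_orthogonal_iff (L : Lagrangian n) (x : Cn n) :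
    x ∈ L.spaceᗮ ↔ Complex.I • x ∈ L.space := by
  rw [L.isLagrangian, Submodule.mem_orthogonal']
  simp [re_inner_eq]

theorem I_smul_mem_orthogonal (L : Lagrangian n) {x : Cn n} (hx : x ∈ L.space) :
    Complex.I • x ∈ L.spaceᗮ := by
  rw [mem_orthogonal_iff, smul_smul, Complex.I_mul_I, neg_one_smul]
  exact L.space.neg_mem hx

theorem σ_add (L : Lagrangian n) {x y : Cn n} (hx : x ∈ L.space) (hy : y ∈ L.spaceᗮ) :
    L.σ (x + y) = x - y := by
  rw [map_add, σ, Submodule.reflection_mem_subspace_eq_self hx,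
    Submodule.reflection_mem_subspace_orthogonalComplement_eq_neg hy, sub_eq_add_neg]

theorem exists_decomp (L : Lagrangian n) (z : Cn n) :
    ∃ x ∈ L.space, ∃ y ∈ L.spaceᗮ, z = x + y := by
  obtain ⟨x, hx, y, hy, h⟩ := L.space.exists_add_mem_mem_orthogonal z
  exact ⟨x, hx, y, hy, h⟩

theorem σ_I_smul (L : Lagrangian n) (z : Cn n) :
    L.σ (Complex.I • z) = -(Complex.I • L.σ z) := by
  obtain ⟨x, hx, y, hy, rfl⟩ := L.exists_decomp z
  rw [L.σ_add hx hy, smul_add, add_comm,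
    L.σ_add ((L.mem_orthogonal_iff y).1 hy) (L.I_smul_mem_orthogonal hx), smul_sub]
  abel

/-- `σ_L` is anti-linear. -/
theorem σ_smul (L : Lagrangian n) (c : ℂ) (z : Cn n) :
    L.σ (c • z) = starRingEnd ℂ c • L.σ z := by
  have h1 : ∀ (r : ℝ) (w : Cn n), (r : ℂ) • w = r • w := fun r w => by
    ext i; simp
  have h : ∀ w : Cn n, c • w = c.re • w + c.im • (Complex.I • w) := fun w => by
    conv_lhs => rw [← Complex.re_add_im c]
    rw [add_smul, mul_smul, h1, h1]
  have h' : ∀ w : Cn n, starRingEnd ℂ c • w = c.re • w - c.im • (Complex.I • w) := fun w => by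
    conv_lhs => rw [← Complex.re_add_im c]
    simp only [map_add, map_mul, Complex.conj_ofReal, Complex.conj_I, mul_neg]
    rw [add_smul, neg_smul, mul_smul, h1, h1, sub_eq_add_neg]
  rw [h, h', map_add, map_smul, map_smul, σ_I_smul, smul_neg, sub_eq_add_neg]

/-- `σ_L` is an involution. -/
theorem σ_σ (L : Lagrangian n) (z : Cn n) : L.σ (L.σ z) = z :=
  L.space.reflection_reflection z

/-- The set of fixed points of `σ_L` is `L`. -/
theorem σ_eq_self_iff (L : Lagrangian n) (z : Cn n) : L.σ z = z ↔ z ∈ L.space :=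
  Submodule.reflection_eq_self_iff z

/-- The unitary operator `τ₂(L₁, L₂) = σ_{L₁} σ_{L₂}`. -/
def τ₂ (L₁ L₂ : Lagrangian n) : U n :=
  Unitary.linearIsometryEquiv.symm
    { toFun := fun z => L₁.σ (L₂.σ z)
      invFun := fun z => L₂.σ (L₁.σ z)
      map_add' := fun x y => by simp
      map_smul' := fun c x => by simp [σ_smul]
      left_inv := fun z => by simp [σ_σ]
      right_inv := fun z => by simp [σ_σ]
      norm_map' := fun z => by
        change ‖L₁.σ (L₂.σ z)‖ = ‖z‖
        simp }

theorem τ₂_apply (L₁ L₂ : Lagrangian n) (z : Cn n) :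
    (τ₂ L₁ L₂ : Cn n →L[ℂ] Cn n) z = L₁.σ (L₂.σ z) := rfl

theorem τ₂_self (L : Lagrangian n) : τ₂ L L = 1 := by
  apply Subtype.ext; ext1 z; rw [τ₂_apply, σ_σ]; rfl

theorem τ₂_mul (L₁ L₂ L₃ : Lagrangian n) : τ₂ L₁ L₂ * τ₂ L₂ L₃ = τ₂ L₁ L₃ := by
  apply Subtype.ext; ext1 z
  change L₁.σ (L₂.σ (L₂.σ (L₃.σ z))) = L₁.σ (L₃.σ z)
  rw [σ_σ]

theorem unitary_inv_apply (g : U n) (z : Cn n) :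
    (g : Cn n →L[ℂ] Cn n) (((g⁻¹ : U n) : Cn n →L[ℂ] Cn n) z) = z := by
  have h := congrArg (fun u : U n => (u : Cn n →L[ℂ] Cn n) z) (mul_inv_cancel g)
  exact h

theorem unitary_apply_inv (g : U n) (z : Cn n) :
    ((g⁻¹ : U n) : Cn n →L[ℂ] Cn n) ((g : Cn n →L[ℂ] Cn n) z) = z := by
  have h := congrArg (fun u : U n => (u : Cn n →L[ℂ] Cn n) z) (inv_mul_cancel g)
  exact h

/-- The image `g L` of a Lagrangian subspace under a unitary operator. -/
instance : SMul (U n) (Lagrangian n) where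
  smul g L :=
    { space := L.space.map ((g : Cn n →L[ℂ] Cn n).toLinearMap.restrictScalars ℝ)
      isLagrangian := fun v => by
        constructor
        · rintro ⟨x, hx, rfl⟩ w ⟨y, hy, rfl⟩
          have h := Unitary.inner_map_map g x y
          change (inner ℂ ((g : Cn n →L[ℂ] Cn n) x) ((g : Cn n →L[ℂ] Cn n) y)).im = 0
          rw [h]
          exact (L.isLagrangian x).1 hx y hy
        · intro h
          refine ⟨((g⁻¹ : U n) : Cn n →L[ℂ] Cn n) v, ?_, unitary_inv_apply g v⟩
          refine (L.isLagrangian _).2 fun w hw => ?_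
          have h2 := h _ ⟨w, hw, rfl⟩
          rw [← Unitary.inner_map_map g, unitary_inv_apply]
          exact h2 }

theorem smul_space (g : U n) (L : Lagrangian n) :
    (g • L).space = L.space.map ((g : Cn n →L[ℂ] Cn n).toLinearMap.restrictScalars ℝ) := rfl

theorem mem_smul (g : U n) (L : Lagrangian n) (v : Cn n) :
    v ∈ (g • L).space ↔ ∃ x ∈ L.space, (g : Cn n →L[ℂ] Cn n) x = v := Iff.rfl

instance : MulAction (U n) (Lagrangian n) where
  one_smul L := by
    ext v
    rw [mem_smul]
    exact ⟨fun ⟨x, hx, h⟩ => h ▸ hx, fun h => ⟨v, h, rfl⟩⟩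
  mul_smul g h L := by
    ext v
    simp only [mem_smul]
    exact ⟨fun ⟨x, hx, e⟩ => ⟨_, ⟨x, hx, rfl⟩, e⟩,
      fun ⟨_, ⟨x, hx, e⟩, e'⟩ => ⟨x, hx, by rw [← e', ← e]; rfl⟩⟩

theorem σ_unitary_smul (g : U n) (L : Lagrangian n) (z : Cn n) :
    (g • L).σ ((g : Cn n →L[ℂ] Cn n) z) = (g : Cn n →L[ℂ] Cn n) (L.σ z) := by
  obtain ⟨x, hx, y, hy, rfl⟩ := L.exists_decomp z
  rw [L.σ_add hx hy, map_add, map_sub]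
  refine (g • L).σ_add ⟨x, hx, rfl⟩ ?_
  rw [mem_orthogonal_iff, ← map_smul]
  exact ⟨_, (L.mem_orthogonal_iff y).1 hy, rfl⟩

theorem τ₂_smul (g : U n) (L₁ L₂ : Lagrangian n) :
    τ₂ (g • L₁) (g • L₂) = g * τ₂ L₁ L₂ * g⁻¹ := by
  rw [eq_mul_inv_iff_mul_eq]
  apply Subtype.ext; ext1 z
  change (g • L₁).σ ((g • L₂).σ ((g : Cn n →L[ℂ] Cn n) z)) =
    (g : Cn n →L[ℂ] Cn n) (L₁.σ (L₂.σ z))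
  rw [σ_unitary_smul, σ_unitary_smul]

end Lagrangian

/-! ## Representations -/

/-- The group `Γ_ℓ = ⟨γ₁, …, γ_ℓ : γ₁ ⋯ γ_ℓ = 1⟩`. -/
abbrev Γ (ℓ : ℕ) : Type :=
  PresentedGroup ({(List.ofFn (fun s : Fin ℓ => FreeGroup.of s)).prod} : Set (FreeGroup (Fin ℓ)))

/-- The generators of `Γ_ℓ`. -/
def γ {ℓ : ℕ} (s : Fin ℓ) : Γ ℓ := PresentedGroup.of s

/-- The representation variety `Hom(Γ_ℓ, U(n))`. -/
def HomU (ℓ n : ℕ) : Type := Γ ℓ →* U n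

namespace HomU

variable {ℓ n : ℕ}

/-- The images of the generators, as operators. -/
def coords (ρ : HomU ℓ n) (s : Fin ℓ) : Cn n →L[ℂ] Cn n :=
  ((show Γ ℓ →* U n from ρ) (γ s) : U n)

/-- `Hom(Γ_ℓ, U(n))` is identified with the tuples of unitary matrices `(A₁, …, A_ℓ)` such that
`A₁ ⋯ A_ℓ = 1`, from which it gets its topology and smooth structure. -/
instance : TopologicalSpace (HomU ℓ n) := TopologicalSpace.induced coords inferInstance

instance : SmoothSpace (HomU ℓ n) := SmoothSpace.induced coords

/-- `U(n)` acts by conjugation. -/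
instance : MulAction (U n) (HomU ℓ n) where
  smul g ρ := (MulAut.conj g).toMonoidHom.comp ρ
  one_smul ρ := by
    refine MonoidHom.ext fun x => ?_
    change (1 : U n) * (show Γ ℓ →* U n from ρ) x * 1⁻¹ = _
    simp
  mul_smul g h ρ := by
    refine MonoidHom.ext fun x => ?_
    change (g * h) * (show Γ ℓ →* U n from ρ) x * (g * h)⁻¹ =
      g * (h * (show Γ ℓ →* U n from ρ) x * h⁻¹) * g⁻¹
    group

theorem smul_apply (g : U n) (ρ : HomU ℓ n) (x : Γ ℓ) :
    (show Γ ℓ →* U n from g • ρ) x = g * (show Γ ℓ →* U n from ρ) x * g⁻¹ := rfl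

/-- The linear representation of `Γ_ℓ` on `ℂⁿ`. -/
def toRep (ρ : HomU ℓ n) : Representation ℂ (Γ ℓ) (Cn n) :=
  ((ContinuousLinearMap.toLinearMapRingHom :
      (Cn n →L[ℂ] Cn n) →+* (Cn n →ₗ[ℂ] Cn n)) : (Cn n →L[ℂ] Cn n) →* (Cn n →ₗ[ℂ] Cn n)).comp
    ((unitary (Cn n →L[ℂ] Cn n)).subtype.comp ρ)

theorem toRep_apply (ρ : HomU ℓ n) (x : Γ ℓ) (z : Cn n) :
    ρ.toRep x z = ((show Γ ℓ →* U n from ρ) x : Cn n →L[ℂ] Cn n) z := rfl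

/-- Irreducibility. -/
def Irr (ρ : HomU ℓ n) : Prop := ρ.toRep.IsIrreducible

/-- Pulling back a subrepresentation of `g • ρ` by `g`. -/
def pullback (ρ : HomU ℓ n) (g : U n) (W : Subrepresentation (g • ρ).toRep) :
    Subrepresentation ρ.toRep where
  toSubmodule := W.toSubmodule.comap (g : Cn n →L[ℂ] Cn n).toLinearMap
  apply_mem_toSubmodule x v hv := by
    have h := W.apply_mem_toSubmodule x hv
    rw [toRep_apply, smul_apply] at h
    change (g : Cn n →L[ℂ] Cn n) (((show Γ ℓ →* U n from ρ) x : Cn n →L[ℂ] Cn n)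
      (((g⁻¹ : U n) : Cn n →L[ℂ] Cn n) ((g : Cn n →L[ℂ] Cn n) v))) ∈ W.toSubmodule at h
    rw [Lagrangian.unitary_apply_inv] at h
    exact h

/-- Pushing a subrepresentation of `ρ` forward by `g`. -/
def pushforward (ρ : HomU ℓ n) (g : U n) (W : Subrepresentation ρ.toRep) :
    Subrepresentation (g • ρ).toRep where
  toSubmodule := W.toSubmodule.comap ((g⁻¹ : U n) : Cn n →L[ℂ] Cn n).toLinearMap
  apply_mem_toSubmodule x v hv := by
    have h := W.apply_mem_toSubmodule x hv
    change ((g⁻¹ : U n) : Cn n →L[ℂ] Cn n) ((g : Cn n →L[ℂ] Cn n)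
      (((show Γ ℓ →* U n from ρ) x : Cn n →L[ℂ] Cn n)
        (((g⁻¹ : U n) : Cn n →L[ℂ] Cn n) v))) ∈ W.toSubmodule
    rw [Lagrangian.unitary_apply_inv]
    exact h

theorem Irr.smul {ρ : HomU ℓ n} (h : ρ.Irr) (g : U n) : (g • ρ).Irr := by
  have e : Subrepresentation (g • ρ).toRep ≃o Subrepresentation ρ.toRep :=
    { toFun := ρ.pullback g
      invFun := ρ.pushforward g
      left_inv := fun W => by
        ext v
        change (g : Cn n →L[ℂ] Cn n) (((g⁻¹ : U n) : Cn n →L[ℂ] Cn n) v) ∈ W.toSubmodule ↔ _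
        rw [Lagrangian.unitary_inv_apply]
      right_inv := fun W => by
        ext v
        change ((g⁻¹ : U n) : Cn n →L[ℂ] Cn n) ((g : Cn n →L[ℂ] Cn n) v) ∈ W.toSubmodule ↔ _
        rw [Lagrangian.unitary_apply_inv]
      map_rel_iff' := fun {W W'} => by
        constructor
        · intro hle v hv
          have h1 : ((g⁻¹ : U n) : Cn n →L[ℂ] Cn n) v ∈ ρ.pullback g W := by
            change (g : Cn n →L[ℂ] Cn n) (((g⁻¹ : U n) : Cn n →L[ℂ] Cn n) v) ∈ W.toSubmodule
            rw [Lagrangian.unitary_inv_apply]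
            exact hv
          have h2 : (g : Cn n →L[ℂ] Cn n) (((g⁻¹ : U n) : Cn n →L[ℂ] Cn n) v) ∈ W'.toSubmodule :=
            hle h1
          rw [Lagrangian.unitary_inv_apply] at h2
          exact h2
        · intro hle v hv
          exact hle (show (g : Cn n →L[ℂ] Cn n) v ∈ W from hv) }
  have : IsSimpleOrder (Subrepresentation ρ.toRep) := h
  exact (OrderIso.isSimpleOrder_iff e).2 this

end HomU

open Lagrangian

variable {ℓ n : ℕ}

theorem prod_τ₂ (lam : Fin ℓ → Lagrangian n) :
    (List.ofFn (fun s => τ₂ (lam s) (lam (finRotate ℓ s)))).prod = 1 := by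
  have key : ∀ (h : ℕ → Lagrangian n) (k : ℕ),
      (List.ofFn (fun s : Fin k => τ₂ (h s) (h (s + 1)))).prod = τ₂ (h 0) (h k) := by
    intro h k
    induction k with
    | zero => simp [τ₂_self]
    | succ k ih =>
      rw [List.ofFn_succ', List.concat_eq_append, List.prod_append]
      simp only [Fin.val_castSucc, Fin.val_last, List.prod_singleton]
      rw [ih, τ₂_mul]
  rcases ℓ with _ | k
  · simp
  · have h := key (fun i => lam (Fin.ofNat (k + 1) i)) (k + 1)
    have e : Fin.ofNat (k + 1) (k + 1) = Fin.ofNat (k + 1) 0 := by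
      apply Fin.ext; simp
    rw [e, τ₂_self] at h
    rw [← h]
    congr 2
    funext s
    congr 2
    · apply Fin.ext; simp
    · apply Fin.ext; simp [Fin.val_add]

/-- The map `φ̃ : Λ(n)^ℓ → Hom(Γ_ℓ, U(n))`, sending `(L₁, …, L_ℓ)` to the homomorphism with
`γ_s ↦ σ_{L_s} σ_{L_{s+1}}` (where `L_{ℓ+1} = L₁`). -/
def phiTilde (lam : Fin ℓ → Lagrangian n) : HomU ℓ n :=
  PresentedGroup.toGroup (f := fun s => τ₂ (lam s) (lam (finRotate ℓ s))) (by
    rintro r rfl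
    rw [map_list_prod, List.map_ofFn, ← prod_τ₂ lam]
    congr 2)

theorem phiTilde_γ (lam : Fin ℓ → Lagrangian n) (s : Fin ℓ) :
    (show Γ ℓ →* U n from phiTilde lam) (γ s) = τ₂ (lam s) (lam (finRotate ℓ s)) :=
  PresentedGroup.toGroup.of _

theorem phiTilde_smul (g : U n) (lam : Fin ℓ → Lagrangian n) :
    phiTilde (g • lam) = g • phiTilde lam := by
  refine PresentedGroup.ext fun s => ?_
  refine (phiTilde_γ (g • lam) s).trans ?_
  refine Eq.trans ?_ (congrArg (fun u => g * u * g⁻¹) (phiTilde_γ lam s)).symm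
  exact τ₂_smul g _ _

/-- The irreducible representations, with their conjugation action of `U(n)`. -/
def HomIrr (ℓ n : ℕ) : SubMulAction (U n) (HomU ℓ n) where
  carrier := {ρ | ρ.Irr}
  smul_mem' g _ h := h.smul g

/-- The tuples of Lagrangians with irreducible representation, with the action of `U(n)`. -/
def LambdaIrr (ℓ n : ℕ) : SubMulAction (U n) (Fin ℓ → Lagrangian n) where
  carrier := {lam | (phiTilde lam).Irr}
  smul_mem' g lam h := by
    change (phiTilde (g • lam)).Irr
    rw [phiTilde_smul]
    exact HomU.Irr.smul h g

instance : MulAction (U n) (HomIrr ℓ n) := SubMulAction.mulAction (HomIrr ℓ n)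

instance : MulAction (U n) (LambdaIrr ℓ n) := SubMulAction.mulAction (LambdaIrr ℓ n)

/-- The set of Lagrangian representations. -/
def LHom (ℓ n : ℕ) : Set (HomU ℓ n) := Set.range phiTilde

/-- The set of irreducible Lagrangian representations. -/
def LHomIrr (ℓ n : ℕ) : Set (HomU ℓ n) := {ρ | ρ ∈ LHom ℓ n ∧ ρ.Irr}

/-- The restriction of `φ̃` to the irreducible part. -/
def phiTildeIrr (lam : LambdaIrr ℓ n) : LHomIrr ℓ n :=
  ⟨phiTilde lam.1, ⟨lam.1, rfl⟩, lam.2⟩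

/-- The moduli space of irreducible representations, `U(n) \ Hom^irr`. -/
abbrev RepIrr (ℓ n : ℕ) : Type := Quotient (MulAction.orbitRel (U n) (HomIrr ℓ n))

/-- The classes of irreducible Lagrangian representations. -/
def LRepIrr (ℓ n : ℕ) : Set (RepIrr ℓ n) :=
  {x | ∃ ρ : HomIrr ℓ n, (ρ : HomU ℓ n) ∈ LHom ℓ n ∧ Quotient.mk _ ρ = x}

/-- The orbit space `U(n) \ Λ^ℓ_irr`. -/
abbrev LambdaIrrQuot (ℓ n : ℕ) : Type := Quotient (MulAction.orbitRel (U n) (LambdaIrr ℓ n))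

/-- The map `φ : U(n) \ Λ^ℓ_irr → Rep^irr` induced by `φ̃`. -/
def phiIrr : LambdaIrrQuot ℓ n → RepIrr ℓ n :=
  Quotient.map (fun lam : LambdaIrr ℓ n => (⟨phiTilde lam.1, lam.2⟩ : HomIrr ℓ n)) (by
    rintro a b ⟨g, rfl⟩
    exact ⟨g, Subtype.ext (phiTilde_smul g b.1).symm⟩)

end LagrangianRep

end

/-! A Lagrangian L is encoded by its reflection R, a real-linear operator. The reflections are
exactly the self-adjoint anti-linear involutions, and they induce the topology and smooth structure
of Λ(n). In these terms `phiTilde` sends γ_s to R_s R_{s+1}, and g in U(n) acts by R ↦ gRg*.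

Fibres. If two tuples have the same image, then u = R'_s R_s does not depend on s, so R'_s = u R_s
with R_s u = u* R_s. A unitary square root g of u that is a polynomial in u satisfies the same
relation, whence gR_s g* = g²R_s = R'_s (`exists_smul_eq_of_phiTilde_eq`). So each fibre is one
orbit of Z(ρ). The root can be taken no farther from 1 than u is, and near 1 it is an analytic
function of u, which gives smooth local sections of the orbit map (`exists_fibre_section`).

Irreducible part. By Schur's lemma g is then a scalar, so the fibre is an orbit of the circle acting
freely by R_s ↦ zR_s (`exists_circle_smul_eq`). Given A = ρ(γ), the tuples of anti-linear X_s with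
X_s A_s = X_{s+1} and A_s X_{s+1} = X_s form a complex line, and one further complex linear
condition selects a point on it. The resulting linear system is injective, an open condition, so its
solution depends analytically on A; rescaling it to a reflection gives a local section of `phiTilde`
(`exists_section`). This yields the circle bundle, the openness of `phiTilde` onto its image, and
the identification of smooth functions on the image with circle-invariant ones.

Manifolds. Cayley transforms of skew operators anti-commuting with R_s give charts of dimension
ℓn(n+1)/2 on the irreducible tuples. A slice theorem for compact groups (`exists_slice`), based on
the inverse function theorem, produces charts on quotients. Dividing by the circle lowers the
dimension by 1; dividing by U(n), whose stabilizers are {±1}, lowers it by n².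

Embedding. A scalar w in U(n) acts on reflections by w², so circle orbits lie inside U(n)-orbits and
`phiIrr` is injective; openness of `phiTilde` onto its image makes it a topological embedding. An
invariant function on tuples is extended to Rep^irr by moving a matrix tuple into a slice for
conjugation, applying the local section, and evaluating (`exists_smoothAt_repMk`). Hom^irr and
Rep^irr themselves are never given charts; only their smooth functions enter. -/

noncomputable section

set_option autoImplicit false

namespace SmoothSpace

open Filter Topology

/-! ### Germs of smooth maps between normed spaces -/

section NearSmooth

variable {E F G : Type*} [NormedAddCommGroup E] [NormedSpace ℝ E] [NormedAddCommGroup F]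
  [NormedSpace ℝ F] [NormedAddCommGroup G] [NormedSpace ℝ G]

/-- `f` is smooth on a neighbourhood of `x`. -/
def NearSmooth (f : E → F) (x : E) : Prop := ∀ᶠ y in 𝓝 x, ContDiffAt ℝ ∞ f y

theorem NearSmooth.contDiffAt {f : E → F} {x : E} (h : NearSmooth f x) : ContDiffAt ℝ ∞ f x :=
  h.self_of_nhds

theorem NearSmooth.continuousAt {f : E → F} {x : E} (h : NearSmooth f x) : ContinuousAt f x :=
  h.contDiffAt.continuousAt

theorem NearSmooth.eventually {f : E → F} {x : E} (h : NearSmooth f x) :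
    ∀ᶠ y in 𝓝 x, NearSmooth f y :=
  eventually_eventually_nhds.2 h

/-- Analyticity at a point spreads to a neighbourhood, whereas being C^∞ at a single point does not.
For this reason regularity is carried at level ω wherever possible and weakened only here. -/
theorem _root_.ContDiffAt.nearSmooth {f : E → F} {x : E} (h : ContDiffAt ℝ ω f x) :
    NearSmooth f x :=
  (h.eventually (by simp)).mono fun _ hy => hy.of_le le_top

theorem _root_.ContDiff.nearSmooth {f : E → F} (h : ContDiff ℝ ω f) (x : E) : NearSmooth f x :=
  h.contDiffAt.nearSmooth

theorem NearSmooth.comp {g : F → G} {f : E → F} (x : E) (hg : NearSmooth g (f x))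
    (hf : NearSmooth f x) : NearSmooth (g ∘ f) x := by
  filter_upwards [hf, hf.continuousAt.eventually hg] with y h1 h2
  exact h2.comp y h1

theorem NearSmooth.congr {f g : E → F} {x : E} (h : NearSmooth f x) (e : g =ᶠ[𝓝 x] f) :
    NearSmooth g x := by
  filter_upwards [h, e.eventuallyEq_nhds] with y h1 h2
  exact h1.congr_of_eventuallyEq h2

theorem NearSmooth.prodMk {f : E → F} {g : E → G} {x : E} (hf : NearSmooth f x)
    (hg : NearSmooth g x) : NearSmooth (fun y => (f y, g y)) x := by
  filter_upwards [hf, hg] with y h1 h2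
  exact h1.prodMk h2

theorem nearSmooth_pi {ι : Type*} [Fintype ι] {f : ι → E → F} {x : E}
    (hf : ∀ i, NearSmooth (f i) x) : NearSmooth (fun y i => f i y) x := by
  filter_upwards [eventually_all.2 hf] with y h
  exact contDiffAt_pi.2 h

end NearSmooth

/-! ### Smooth spaces whose structure is induced from a normed space -/

section Models

variable {X Y V V' : Type*} [TopologicalSpace X] [TopologicalSpace Y] [SmoothSpace X]
  [SmoothSpace Y] [NormedAddCommGroup V] [NormedSpace ℝ V] [NormedAddCommGroup V']
  [NormedSpace ℝ V']

/-- The topology and the smooth structure of `X` are induced by the map `i` to a normed space. -/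
structure IsModel (i : X → V) : Prop where
  isInducing : IsInducing i
  smoothAt_iff (f : X → ℝ) (x : X) :
    SmoothAt f x ↔ ∃ g : V → ℝ, NearSmooth g (i x) ∧ f =ᶠ[𝓝 x] g ∘ i

theorem isModel_id : IsModel (id : V → V) where
  isInducing := IsInducing.id
  smoothAt_iff f x := by
    constructor
    · intro h
      exact ⟨f, h, .rfl⟩
    · rintro ⟨g, hg, e⟩
      exact NearSmooth.congr hg e

variable {i : X → V} {j : Y → V'}

theorem IsModel.continuous (hi : IsModel i) : Continuous i := hi.isInducing.continuous

theorem IsModel.eventually (hi : IsModel i) {f : X → ℝ} {x : X} (h : SmoothAt f x) :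
    ∀ᶠ y in 𝓝 x, SmoothAt f y := by
  obtain ⟨g, hg, e⟩ := (hi.smoothAt_iff f x).1 h
  filter_upwards [hi.continuous.continuousAt.eventually hg.eventually, e.eventuallyEq_nhds]
    with y h1 h2
  exact (hi.smoothAt_iff f y).2 ⟨g, h1, h2⟩

theorem IsModel.congr (hi : IsModel i) {f f' : X → ℝ} {x : X} (h : SmoothAt f x)
    (e : f' =ᶠ[𝓝 x] f) : SmoothAt f' x := by
  obtain ⟨g, hg, e'⟩ := (hi.smoothAt_iff f x).1 h
  exact (hi.smoothAt_iff f' x).2 ⟨g, hg, e.trans e'⟩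

theorem IsModel.subtype (hi : IsModel i) (P : X → Prop) :
    IsModel (fun x : {x // P x} => i x) where
  isInducing := hi.isInducing.comp IsInducing.subtypeVal
  smoothAt_iff f x := by
    constructor
    · rintro ⟨g, hg, e⟩
      obtain ⟨h, hh, e'⟩ := (hi.smoothAt_iff g x).1 hg
      refine ⟨h, hh, e.trans ?_⟩
      exact continuousAt_subtype_val.eventually e'
    · rintro ⟨g, hg, e⟩
      exact ⟨g ∘ i, (hi.smoothAt_iff _ _).2 ⟨g, hg, .rfl⟩, e⟩

/-- The product structure allows smooth expressions in finitely many smooth functions of the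
factors. In finite dimension the linear coordinates of V and V' already suffice to express any
smooth function of the pair. -/
theorem IsModel.prod [FiniteDimensional ℝ V] [FiniteDimensional ℝ V'] (hi : IsModel i)
    (hj : IsModel j) : IsModel (fun q : X × Y => (i q.1, j q.2)) where
  isInducing := hi.isInducing.prodMap hj.isInducing
  smoothAt_iff f q := by
    constructor
    · rintro ⟨k, m, g, h, F, hg, hh, hF, e⟩
      choose g' hg' eg using fun a => (hi.smoothAt_iff _ _).1 (hg a)
      choose h' hh' eh using fun a => (hj.smoothAt_iff _ _).1 (hh a)
      refine ⟨fun v => F (fun a => g' a v.1, fun b => h' b v.2), ?_, ?_⟩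
      · have h1 : NearSmooth (fun v : V × V' => ((fun a => g' a v.1), (fun b => h' b v.2)))
            (i q.1, j q.2) :=
          (nearSmooth_pi fun a => (hg' a).comp (f := Prod.fst) (i q.1, j q.2)
            (contDiff_fst.nearSmooth _)).prodMk
          (nearSmooth_pi fun a => (hh' a).comp (f := Prod.snd) (i q.1, j q.2)
            (contDiff_snd.nearSmooth _))
        refine NearSmooth.comp (g := F) (i q.1, j q.2) ?_ h1
        have : (fun a => g' a (i q.1)) = fun a => g a q.1 :=
          funext fun a => ((eg a).self_of_nhds).symm
        have h3 : (fun a => h' a (j q.2)) = fun a => h a q.2 :=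
          funext fun a => ((eh a).self_of_nhds).symm
        simp only [this, h3]
        exact hF
      · filter_upwards [e, continuousAt_fst.eventually (eventually_all.2 eg),
          continuousAt_snd.eventually (eventually_all.2 eh)] with r h1 h2 h3
        rw [h1]
        simp only [Function.comp_apply]
        congr 2
        · exact funext h2
        · exact funext h3
    · rintro ⟨g, hg, e⟩
      let b := (Module.finBasis ℝ V).equivFunL
      let b' := (Module.finBasis ℝ V').equivFunL
      refine ⟨_, _, fun a x => b (i x) a, fun a y => b' (j y) a,
        fun w => g (b.symm w.1, b'.symm w.2), fun a => ?_, fun a => ?_, ?_, ?_⟩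
      · refine (hi.smoothAt_iff _ _).2 ⟨fun v => b v a, ContDiff.nearSmooth ?_ _, .rfl⟩
        exact contDiff_pi.1 b.contDiff a
      · refine (hj.smoothAt_iff _ _).2 ⟨fun v => b' v a, ContDiff.nearSmooth ?_ _, .rfl⟩
        exact contDiff_pi.1 b'.contDiff a
      · have hB : ContDiff ℝ ω (fun w : (Fin (Module.finrank ℝ V) → ℝ) ×
            (Fin (Module.finrank ℝ V') → ℝ) => (b.symm w.1, b'.symm w.2)) :=
          (b.symm.contDiff.comp contDiff_fst).prodMk (b'.symm.contDiff.comp contDiff_snd)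
        have h0 : (fun w : (Fin (Module.finrank ℝ V) → ℝ) ×
            (Fin (Module.finrank ℝ V') → ℝ) => (b.symm w.1, b'.symm w.2))
            (b (i q.1), b' (j q.2)) = (i q.1, j q.2) :=
          Prod.ext (b.symm_apply_apply _) (b'.symm_apply_apply _)
        refine NearSmooth.comp (g := g) (b (i q.1), b' (j q.2)) ?_ (hB.nearSmooth _)
        exact Eq.subst (motive := NearSmooth g) h0.symm hg
      · filter_upwards [e] with r hr
        simpa using hr

/-- A local extension to the ambient spaces controls everything: continuity follows because `j` is
inducing, and pulled-back functions are composed with the extension. -/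
theorem IsModel.smoothAt_comp (hi : IsModel i) (hj : IsModel j) {f : X → Y} {x : X}
    (hf : ∃ F : V → V', NearSmooth F (i x) ∧ j ∘ f =ᶠ[𝓝 x] F ∘ i) :
    ContinuousAt f x ∧ ∀ g : Y → ℝ, SmoothAt g (f x) → SmoothAt (g ∘ f) x := by
  obtain ⟨F, hF, e⟩ := hf
  have hc : ContinuousAt f x := by
    rw [hj.isInducing.continuousAt_iff]
    refine ContinuousAt.congr ?_ e.symm
    exact ContinuousAt.comp (g := F) hF.continuousAt hi.continuous.continuousAt
  refine ⟨hc, fun g hg => ?_⟩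
  obtain ⟨h, hh, e'⟩ := (hj.smoothAt_iff _ _).1 hg
  refine (hi.smoothAt_iff _ _).2 ⟨h ∘ F, NearSmooth.comp _ ?_ hF, ?_⟩
  · rwa [← show j (f x) = F (i x) from e.self_of_nhds]
  · filter_upwards [hc.eventually e', e] with y h1 h2
    rw [Function.comp_apply, h1]
    simp only [Function.comp_apply] at h2 ⊢
    rw [h2]

theorem IsModel.isSmoothMap (hi : IsModel i) (hj : IsModel j) {f : X → Y}
    (hf : ∀ x, ∃ F : V → V', NearSmooth F (i x) ∧ j ∘ f =ᶠ[𝓝 x] F ∘ i) : IsSmoothMap f :=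
  ⟨continuous_iff_continuousAt.2 fun x => (hi.smoothAt_comp hj (hf x)).1,
    fun x => (hi.smoothAt_comp hj (hf x)).2⟩

end Models

/-! ### Charts and atlases detected by smooth functions -/

section Charts

variable {X E : Type*} [TopologicalSpace X] [SmoothSpace X] [NormedAddCommGroup E]
  [NormedSpace ℝ E]

/-- A chart of `X` that identifies the smooth functions of `X` with those of the model space. -/
def IsSmoothChart (e : OpenPartialHomeomorph X E) : Prop :=
  ∀ (f : X → ℝ), ∀ x ∈ e.source, SmoothAt f x ↔ NearSmooth (f ∘ e.symm) (e x)

theorem IsSmoothChart.transContinuousLinearEquiv {F : Type*} [NormedAddCommGroup F]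
    [NormedSpace ℝ F] {e : OpenPartialHomeomorph X E} (he : IsSmoothChart e) (T : E ≃L[ℝ] F) :
    IsSmoothChart (e.transHomeomorph T.toHomeomorph) := by
  intro f x hx
  rw [he f x hx]
  constructor
  · intro h
    refine NearSmooth.comp (g := f ∘ e.symm) (f := T.symm) (T (e x)) ?_ (T.symm.contDiff.nearSmooth _)
    simpa using h
  · intro h
    have h2 := NearSmooth.comp (g := f ∘ e.symm ∘ T.symm) (f := T) (e x) h (T.contDiff.nearSmooth _)
    refine h2.congr (.of_forall fun y => ?_)
    simp

/-- Functions are transported in one direction along `i ∘ e.symm` and in the other along `κ`, an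
extension of the chart to the ambient space. -/
theorem IsModel.isSmoothChart {V : Type*} [NormedAddCommGroup V] [NormedSpace ℝ V] {i : X → V}
    (hi : IsModel i) (e : OpenPartialHomeomorph X E) (κ : V → E)
    (hκ : ∀ x ∈ e.source, NearSmooth κ (i x)) (hκe : ∀ x ∈ e.source, κ (i x) = e x)
    (hψ : ∀ t ∈ e.target, NearSmooth (i ∘ e.symm) t) : IsSmoothChart e := by
  intro f x hx
  constructor
  · intro h
    obtain ⟨g, hg, e'⟩ := (hi.smoothAt_iff _ _).1 h
    refine (NearSmooth.comp (g := g) (f := i ∘ e.symm) (e x) ?_ (hψ _ (e.map_source hx))).congr ?_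
    · simpa [e.left_inv hx] using hg
    · have h1 := e.continuousAt_symm (e.map_source hx)
      rw [ContinuousAt, e.left_inv hx] at h1
      exact h1.eventually e'
  · intro h
    refine (hi.smoothAt_iff _ _).2 ⟨(f ∘ e.symm) ∘ κ, NearSmooth.comp _ ?_ (hκ x hx), ?_⟩
    · rwa [hκe x hx]
    · filter_upwards [e.open_source.mem_nhds hx] with y hy
      simp [hκe y hy, e.left_inv hy]

/-- No compatibility of charts has to be assumed. The coordinates of one smooth chart are smooth
functions on X, so they are smooth when read in any other; all smooth charts together form the
atlas. -/
theorem isSmoothManifold_of_charts {d : ℕ} [T2Space X] [SecondCountableTopology X]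
    (h : ∀ x : X, ∃ e : OpenPartialHomeomorph X (EuclideanSpace ℝ (Fin d)),
      x ∈ e.source ∧ IsSmoothChart e) : IsSmoothManifold X d := by
  refine ⟨inferInstance, inferInstance, ?_⟩
  choose ch hmem hch using h
  let C : ChartedSpace (EuclideanSpace ℝ (Fin d)) X :=
    { atlas := {e | IsSmoothChart e}
      chartAt := ch
      mem_chart_source := hmem
      chart_mem_atlas := hch }
  have hM : IsManifold (𝓡 d) ∞ X := by
    refine isManifold_of_contDiffOn (𝓡 d) ∞ X fun e e' he he' => ?_
    intro t ht
    simp only [modelWithCornersSelf_coe_symm, modelWithCornersSelf_coe, Set.preimage_id,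
      Set.range_id, Set.inter_univ, OpenPartialHomeomorph.trans_source,
      OpenPartialHomeomorph.symm_source, Set.mem_inter_iff, Set.mem_preimage] at ht
    obtain ⟨ht1, ht2⟩ := ht
    refine ContDiffAt.contDiffWithinAt ?_
    change ContDiffAt ℝ ∞ (fun s => e' (e.symm s)) t
    rw [contDiffAt_euclidean]
    intro k
    have h1 : SmoothAt (fun y => e' y k) (e.symm t) := by
      refine (he' _ _ ht2).2 ?_
      refine (ContDiff.nearSmooth (f := fun s : EuclideanSpace ℝ (Fin d) => s k)
        (contDiff_euclidean.1 contDiff_id k) _).congr ?_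
      filter_upwards [e'.open_target.mem_nhds (e'.map_source ht2)] with s hs
      simp [e'.right_inv hs]
    have h2 := ((he _ _ (e.map_target ht1)).1 h1).contDiffAt
    rwa [e.right_inv ht1] at h2
  refine ⟨C, hM, fun f x => ?_⟩
  have hs := hmem x
  rw [hch x f x hs, NearSmooth, (ch x).eventually_nhds _ hs]
  refine eventually_congr ?_
  filter_upwards [(ch x).open_source.mem_nhds hs] with y hy
  have h1 := contMDiffAt_iff_source_of_mem_source (I := 𝓡 d) (I' := 𝓘(ℝ, ℝ)) (n := ∞)
    (f := f) (x := x) (x' := y) hy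
  rw [h1]
  simp only [modelWithCornersSelf_coe, Set.range_id]
  rw [contMDiffWithinAt_univ, contMDiffAt_iff_contDiffAt]
  rfl

end Charts

end SmoothSpace

namespace SmoothSpace

open Filter Topology

/-! ### Slices for actions of compact groups -/

section Slices

/-- A tube argument over the compact group: near a stabilizing g membership in `O` is automatic, and
near any other g the relation g • q.1 = q.2 fails because X is Hausdorff. -/
theorem eventually_mem_of_smul_eq {K X : Type*} [Group K] [TopologicalSpace K] [CompactSpace K]
    [TopologicalSpace X] [T2Space X] [MulAction K X] [ContinuousSMul K X] (x₀ : X) (O : Set K)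
    (hO : ∀ g : K, g • x₀ = x₀ → O ∈ 𝓝 g) :
    ∀ᶠ q in 𝓝 (x₀, x₀), ∀ g : K, g • q.1 = q.2 → g ∈ O := by
  have := isCompact_univ.eventually_forall_of_forall_eventually (x₀ := (x₀, x₀))
    (P := fun q (g : K) => g • q.1 = q.2 → g ∈ O) (K := Set.univ) (fun g _ => ?_)
  · simpa using this
  · by_cases hg : g • x₀ = x₀
    · filter_upwards [continuousAt_snd.eventually (hO g hg)] with z hz _ using hz
    · have hc : ContinuousAt (fun z : (X × X) × K => (z.2 • z.1.1, z.1.2)) ((x₀, x₀), g) :=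
        Continuous.continuousAt (by fun_prop)
      have ho : {q : X × X | q.1 ≠ q.2} ∈ 𝓝 (g • x₀, x₀) :=
        (isOpen_ne_fun continuous_fst continuous_snd).mem_nhds hg
      filter_upwards [hc.eventually ho] with z hz h using absurd h hz

/-- Local slices for the action of a compact group, in a chart. The stabilizer of the point is
supposed to act trivially, and `c` parametrizes the group modulo this stabilizer. -/
theorem exists_slice {K X E W V : Type*} [Group K] [TopologicalSpace K] [CompactSpace K]
    [TopologicalSpace X] [T2Space X] [MulAction K X] [ContinuousSMul K X]
    [NormedAddCommGroup E] [NormedSpace ℝ E] [FiniteDimensional ℝ E]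
    [NormedAddCommGroup W] [NormedSpace ℝ W] [FiniteDimensional ℝ W]
    [NormedAddCommGroup V] [NormedSpace ℝ V]
    (e : OpenPartialHomeomorph X E) {x₀ : X} (hx₀ : x₀ ∈ e.source)
    (c : W → K) (hc0 : c 0 = 1) (hc : ContinuousAt c 0)
    (hstab : ∀ g : K, g • x₀ = x₀ → ∀ S ∈ 𝓝 (0 : W), ∀ᶠ h in 𝓝 g, ∃ w ∈ S, ∀ x : X,
      h • x = c w • x)
    (hΘ : ContDiffAt ℝ ω (fun q : W × E => e (c q.1 • e.symm q.2)) (0, e x₀))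
    (i : X → V) (hi : DifferentiableAt ℝ (i ∘ e.symm) (e x₀))
    (B : W →L[ℝ] V) (hB : HasFDerivAt (fun w => i (c w • x₀)) B 0)
    (hinj : Function.Injective B) :
    ∃ (Z : Submodule ℝ E) (r : E → Z),
      Module.finrank ℝ Z + Module.finrank ℝ W = Module.finrank ℝ E ∧
      ContDiffAt ℝ ω r (e x₀) ∧ r (e x₀) = 0 ∧ (∀ᶠ z : Z in 𝓝 0, r (e x₀ + z) = z) ∧
      (∀ᶠ x in 𝓝 x₀, ∃ g : K, g • x = e.symm (e x₀ + r (e x))) ∧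
      ∀ᶠ q in 𝓝 (x₀, x₀), (∃ g : K, g • q.1 = q.2) → r (e q.1) = r (e q.2) := by
  set a := e x₀ with ha
  set Θ : W × E → E := fun q => e (c q.1 • e.symm q.2) with hΘdef
  have hea : e.symm a = x₀ := e.left_inv hx₀
  have haT : a ∈ e.target := e.map_source hx₀
  have hD := (hΘ.differentiableAt (by simp)).hasFDerivAt
  set D := fderiv ℝ Θ (0, a)
  have hact : ContinuousAt (fun q : W × E => c q.1 • e.symm q.2) (0, a) := by
    have h1 : ContinuousAt (fun q : W × E => c q.1) (0, a) :=
      ContinuousAt.comp (g := c) (f := Prod.fst) hc continuousAt_fst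
    have h2 : ContinuousAt (fun q : W × E => e.symm q.2) (0, a) :=
      ContinuousAt.comp (g := e.symm) (f := Prod.snd) (e.continuousAt_symm haT) continuousAt_snd
    exact h1.smul h2
  have hact0 : c 0 • e.symm a = x₀ := by rw [hc0, one_smul, hea]
  have hsource : ∀ᶠ q : W × E in 𝓝 (0, a), c q.1 • e.symm q.2 ∈ e.source :=
    hact.eventually (by dsimp only; rw [hact0]; exact e.open_source.mem_nhds hx₀)
  -- the partial derivatives
  let T : W →L[ℝ] E := D.comp (ContinuousLinearMap.inl ℝ W E)
  have hT : HasFDerivAt (fun w => Θ (w, a)) T 0 :=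
    HasFDerivAt.comp (g := Θ) (0 : W) hD (hasFDerivAt_prodMk_left (0 : W) a)
  have hΘ0 : ∀ t ∈ e.target, Θ (0, t) = t := fun t ht => by
    simp [hΘdef, hc0, e.right_inv ht]
  have hsnd : D.comp (ContinuousLinearMap.inr ℝ W E) = ContinuousLinearMap.id ℝ E := by
    have h1 : HasFDerivAt (fun t => Θ (0, t)) (D.comp (ContinuousLinearMap.inr ℝ W E)) a :=
      HasFDerivAt.comp (g := Θ) a hD (hasFDerivAt_prodMk_right (0 : W) a)
    refine h1.unique ((hasFDerivAt_id a).congr_of_eventuallyEq ?_)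
    filter_upwards [e.open_target.mem_nhds haT] with t ht using hΘ0 t ht
  -- By the chain rule the ambient derivative B of the orbit map factors through T.
  have hTinj : Function.Injective T := by
    have h1 : HasFDerivAt (fun w => i (c w • x₀)) ((fderiv ℝ (i ∘ e.symm) a).comp T) 0 := by
      have h2 : DifferentiableAt ℝ (i ∘ e.symm) (Θ (0, a)) := by rwa [hΘ0 a haT]
      have h3 := HasFDerivAt.comp (g := i ∘ e.symm) (0 : W) h2.hasFDerivAt hT
      rw [hΘ0 a haT] at h3
      refine h3.congr_of_eventuallyEq ?_
      have h4 : ContinuousAt (fun w : W => (w, a)) 0 := by fun_prop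
      filter_upwards [h4.eventually hsource] with w hw
      simp only [hea] at hw
      simp [hΘdef, hea, e.left_inv hw]
    have h2 := hB.unique h1
    intro v w hvw
    apply hinj
    rw [h2]
    simp [hvw]
  -- The slice is an affine complement of the tangent space of the orbit. The map (w, z) ↦ c(w)·(a +
  -- z) has derivative T ⊕ inclusion, which is bijective, so it is locally invertible; `r` will be
  -- the Z-component of its inverse.
  obtain ⟨Z, hZ⟩ := Submodule.exists_isCompl (LinearMap.range T.toLinearMap)
  let F : W × Z → E := fun q => Θ (q.1, a + q.2)
  let F' : W × Z →L[ℝ] E := T.coprod Z.subtypeL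
  have hinner : ContDiff ℝ ω (fun q : W × Z => (q.1, a + (q.2 : E))) :=
    contDiff_fst.prodMk (contDiff_const.add (Z.subtypeL.contDiff.comp contDiff_snd))
  have hF : ContDiffAt ℝ ω F (0, 0) := by
    refine ContDiffAt.comp (g := Θ) (0, 0) ?_ hinner.contDiffAt
    simpa using hΘ
  have hF' : HasFDerivAt F F' (0, 0) := by
    have h1 : HasFDerivAt (fun q : W × Z => (q.1, a + (q.2 : E)))
        ((ContinuousLinearMap.fst ℝ W Z).prod (Z.subtypeL.comp (ContinuousLinearMap.snd ℝ W Z)))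
        (0, 0) :=
      hasFDerivAt_fst.prodMk ((Z.subtypeL.hasFDerivAt.comp _ hasFDerivAt_snd).const_add a)
    have h2 : HasFDerivAt Θ D ((fun q : W × Z => (q.1, a + (q.2 : E))) (0, 0)) := by
      simpa using hD
    have h3 := HasFDerivAt.comp (g := Θ) (f := fun q : W × Z => (q.1, a + (q.2 : E))) (0, 0) h2 h1
    have h6 : F' = D.comp ((ContinuousLinearMap.fst ℝ W Z).prod
        (Z.subtypeL.comp (ContinuousLinearMap.snd ℝ W Z))) := by
      refine ContinuousLinearMap.ext fun q => ?_
      have h4 : D (0, (q.2 : E)) = q.2 := DFunLike.congr_fun hsnd (q.2 : E)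
      have h5 : D (q.1, (q.2 : E)) = D (q.1, 0) + D (0, q.2) := by
        rw [← map_add, Prod.mk_add_mk, add_zero, zero_add]
      change D (q.1, 0) + (q.2 : E) = D (q.1, (q.2 : E))
      rw [h5, h4]
    rw [h6]
    exact h3
  have hbij : Function.Bijective F' := by
    constructor
    · rw [injective_iff_map_eq_zero]
      rintro ⟨w, z⟩ h
      have h1 : T w = -(z : E) := by
        simpa [F', add_eq_zero_iff_eq_neg] using h
      have h2 : T w ∈ LinearMap.range T.toLinearMap ⊓ Z :=
        ⟨⟨w, rfl⟩, h1 ▸ Z.neg_mem z.2⟩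
      rw [hZ.inf_eq_bot, Submodule.mem_bot] at h2
      have h3 : w = 0 := hTinj (by rw [h2, map_zero])
      have h4 : z = 0 := by
        rw [h2] at h1
        exact Subtype.ext (neg_eq_zero.1 h1.symm)
      rw [h3, h4]; rfl
    · intro v
      have : v ∈ LinearMap.range T.toLinearMap ⊔ Z := by rw [hZ.sup_eq_top]; trivial
      obtain ⟨_, ⟨w, rfl⟩, z, hz, rfl⟩ := Submodule.mem_sup.1 this
      exact ⟨(w, ⟨z, hz⟩), by simp [F']⟩
  let Q : (W × Z) ≃L[ℝ] E := (LinearEquiv.ofBijective F'.toLinearMap hbij).toContinuousLinearEquiv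
  have hQ : HasFDerivAt F (Q : W × Z →L[ℝ] E) (0, 0) := by
    have : (Q : W × Z →L[ℝ] E) = F' := by ext <;> rfl
    rwa [this]
  let φ := hF.toOpenPartialHomeomorph F hQ (by simp)
  have hφ : ∀ q, φ q = F q := fun _ => rfl
  have hmem : ((0 : W), (0 : Z)) ∈ φ.source := hF.mem_toOpenPartialHomeomorph_source hQ (by simp)
  have hF0 : F (0, 0) = a := by simp [F, hΘ0 a haT]
  have haφ : a ∈ φ.target := by
    have := φ.map_source hmem
    rwa [hφ, hF0] at this
  have hinv : φ.symm a = (0, 0) := by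
    have := φ.left_inv hmem
    rwa [hφ, hF0] at this
  have hsymm : ContDiffAt ℝ ω φ.symm a := by
    have := hF.to_localInverse hQ (by simp)
    rwa [hF0] at this
  have hsc : Tendsto φ.symm (𝓝 a) (𝓝 (0, 0)) := by
    have := hsymm.continuousAt
    rwa [ContinuousAt, hinv] at this
  have hec : Tendsto e (𝓝 x₀) (𝓝 a) := e.continuousAt hx₀
  have hFT : ∀ᶠ z : Z in 𝓝 0, F (0, z) = a + z := by
    have h1 : ContinuousAt (fun z : Z => a + (z : E)) 0 := by fun_prop
    have h2 : e.target ∈ 𝓝 (a + ((0 : Z) : E)) := by simpa using e.open_target.mem_nhds haT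
    filter_upwards [h1.eventually h2] with z hz using hΘ0 _ hz
  have hφs : ∀ᶠ q : W × Z in 𝓝 (0, 0), q ∈ φ.source := φ.open_source.mem_nhds hmem
  have hback : ∀ᶠ x in 𝓝 x₀, c (φ.symm (e x)).1 • e.symm (a + (φ.symm (e x)).2) = x := by
    have h1 : Tendsto (fun q : W × Z => (q.1, a + (q.2 : E))) (𝓝 (0, 0)) (𝓝 (0, a)) := by
      have := hinner.continuous.tendsto (0, 0)
      simpa using this
    filter_upwards [(hsc.comp hec).eventually (h1.eventually hsource),
      hec.eventually (φ.open_target.mem_nhds haφ), e.open_source.mem_nhds hx₀] with x h2 h3 h4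
    apply e.injOn h2 h4
    have h5 := φ.right_inv h3
    exact h5
  refine ⟨Z, fun t => (φ.symm t).2, ?_, ?_, ?_, ?_, ?_, ?_⟩
  · rw [← Q.toLinearEquiv.finrank_eq, Module.finrank_prod, add_comm]
  · exact contDiff_snd.contDiffAt.comp a hsymm
  · simp [hinv]
  · have h1 : ContinuousAt (fun z : Z => ((0 : W), z)) 0 := by fun_prop
    filter_upwards [hFT, h1.eventually hφs] with z hz hzs
    have := φ.left_inv hzs
    rw [hφ, hz] at this
    simp [this]
  · filter_upwards [hback] with x hx
    exact ⟨(c (φ.symm (e x)).1)⁻¹, by rw [inv_smul_eq_iff, hx]⟩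
  -- If two nearby points share an orbit, so do their representatives in the slice. By compactness
  -- the connecting group element acts like c(w) with w small, so local injectivity at (w, z) and
  -- (0, z') forces z = z'.
  · obtain ⟨S, hS, P, hP, hSP⟩ := mem_nhds_prod_iff.1 hφs
    let O : Set K := {h | ∃ w ∈ S, ∀ x : X, h • x = c w • x}
    have hO := eventually_mem_of_smul_eq x₀ O fun g hg => hstab g hg S hS
    have hr : Tendsto (fun x => (φ.symm (e x)).2) (𝓝 x₀) (𝓝 0) :=
      ((continuous_snd.tendsto _).comp hsc).comp hec
    have hψ : Tendsto (fun x => e.symm (a + ((φ.symm (e x)).2 : E))) (𝓝 x₀) (𝓝 x₀) := by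
      have h1 := e.continuousAt_symm haT
      rw [ContinuousAt, hea] at h1
      refine h1.comp ?_
      have h2 : Tendsto (fun z : Z => a + (z : E)) (𝓝 0) (𝓝 a) := by
        have : Continuous (fun z : Z => a + (z : E)) := by fun_prop
        simpa using this.tendsto 0
      exact h2.comp hr
    have hgood : ∀ᶠ x in 𝓝 x₀, (φ.symm (e x)).2 ∈ P ∧
        F (0, (φ.symm (e x)).2) = a + (φ.symm (e x)).2 ∧
        a + ((φ.symm (e x)).2 : E) ∈ e.target ∧
        c (φ.symm (e x)).1 • e.symm (a + (φ.symm (e x)).2) = x := by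
      have h2 : Tendsto (fun z : Z => a + (z : E)) (𝓝 0) (𝓝 a) := by
        have : Continuous (fun z : Z => a + (z : E)) := by fun_prop
        simpa using this.tendsto 0
      filter_upwards [hr.eventually hP, hr.eventually hFT,
        (h2.comp hr).eventually (e.open_target.mem_nhds haT), hback] with x h1 h2 h3 h4
      exact ⟨h1, h2, h3, h4⟩
    rw [nhds_prod_eq] at hO ⊢
    filter_upwards [((hψ.prodMap hψ)).eventually hO, hgood.prod_mk hgood] with q h1 h2 ⟨g, hg⟩
    obtain ⟨⟨hP1, hF1, hT1, hb1⟩, hP2, hF2, hT2, hb2⟩ := h2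
    set z := (φ.symm (e q.1)).2
    set z' := (φ.symm (e q.2)).2
    have hrel : ((c (φ.symm (e q.2)).1)⁻¹ * g * c (φ.symm (e q.1)).1) • e.symm (a + (z : E)) =
        e.symm (a + (z' : E)) := by
      rw [mul_smul, mul_smul, hb1, hg, inv_smul_eq_iff, hb2]
    obtain ⟨w, hw, hwx⟩ := h1 _ hrel
    rw [hwx] at hrel
    have h3 : F (w, z) = F (0, z') := by
      rw [hF2]
      change e (c w • e.symm (a + (z : E))) = _
      rw [hrel, e.right_inv hT2]
    have h4 := φ.injOn (hSP (Set.mk_mem_prod hw hP1))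
      (hSP (Set.mk_mem_prod (mem_of_mem_nhds hS) hP2)) h3
    exact (Prod.ext_iff.1 h4).2

end Slices

/-! ### Charts and smooth functions on quotients -/

section Quotients

variable {X Y E Z : Type*} [TopologicalSpace X] [TopologicalSpace Y] [SmoothSpace X]
  [SmoothSpace Y] [NormedAddCommGroup E] [NormedSpace ℝ E] [NormedAddCommGroup Z]
  [NormedSpace ℝ Z]

/-- The chart of a quotient which is given by a slice. -/
theorem exists_isSmoothChart_of_slice {p : X → Y} (hpo : IsOpenMap p) (hpc : Continuous p)
    (hp : ∀ (f : Y → ℝ) (x : X), SmoothAt f (p x) ↔ SmoothAt (f ∘ p) x)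
    {e : OpenPartialHomeomorph X E} (he : IsSmoothChart e) {x₀ : X} (hx₀ : x₀ ∈ e.source)
    (T : Z →L[ℝ] E) (r : E → Z) (hr : NearSmooth r (e x₀)) (hr0 : r (e x₀) = 0)
    (hrz : ∀ᶠ z in 𝓝 0, r (e x₀ + T z) = z)
    (hpr : ∀ᶠ x in 𝓝 x₀, p x = p (e.symm (e x₀ + T (r (e x)))))
    (hrp : ∀ᶠ q in 𝓝 (x₀, x₀), p q.1 = p q.2 → r (e q.1) = r (e q.2)) :
    ∃ e' : OpenPartialHomeomorph Y Z, p x₀ ∈ e'.source ∧ IsSmoothChart e' := by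
  set a := e x₀ with ha
  have hea : e.symm a = x₀ := e.left_inv hx₀
  have haT : a ∈ e.target := e.map_source hx₀
  rw [nhds_prod_eq] at hrp
  obtain ⟨N₁, hN₁, hrp⟩ := (eventually_prod_self_iff (r := fun x x' =>
    p x = p x' → r (e x) = r (e x'))).1 hrp
  have hec : Tendsto e (𝓝 x₀) (𝓝 a) := e.continuousAt hx₀
  have hN : ∀ᶠ x in 𝓝 x₀, x ∈ N₁ ∧ x ∈ e.source ∧ NearSmooth r (e x) ∧
      p x = p (e.symm (a + T (r (e x)))) := by
    filter_upwards [hN₁, e.open_source.mem_nhds hx₀, hec.eventually hr.eventually, hpr]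
      with x h1 h2 h3 h4 using ⟨h1, h2, h3, h4⟩
  obtain ⟨N, hNp, hNo, hx₀N⟩ := eventually_nhds_iff.1 hN
  let S : Z → X := fun z => e.symm (a + T z)
  have hS0 : S 0 = x₀ := by simp [S, hea]
  have hTc : Tendsto (fun z => a + T z) (𝓝 0) (𝓝 a) := by
    have : Continuous (fun z => a + T z) := by fun_prop
    simpa using this.tendsto 0
  have hSc : Tendsto S (𝓝 0) (𝓝 x₀) := by
    have h1 := e.continuousAt_symm haT
    rw [ContinuousAt, hea] at h1
    exact h1.comp hTc
  have hO : ∀ᶠ z in 𝓝 (0 : Z), S z ∈ N ∧ a + T z ∈ e.target ∧ r (a + T z) = z := by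
    filter_upwards [hSc.eventually (hNo.mem_nhds hx₀N), hTc.eventually (e.open_target.mem_nhds haT),
      hrz] with z h1 h2 h3 using ⟨h1, h2, h3⟩
  obtain ⟨O, hOp, hOo, h0O⟩ := eventually_nhds_iff.1 hO
  have hrc : ContinuousOn (fun x => r (e x)) N := fun x hx =>
    ((hNp x hx).2.2.1.continuousAt.comp (e.continuousAt (hNp x hx).2.1)).continuousWithinAt
  let N' : Set X := N ∩ (fun x => r (e x)) ⁻¹' O
  have hN'o : IsOpen N' := hrc.isOpen_inter_preimage hNo hOo
  have hSN' : ∀ z ∈ O, S z ∈ N' ∧ r (e (S z)) = z := fun z hz => by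
    obtain ⟨h1, h2, h3⟩ := hOp z hz
    have h4 : r (e (S z)) = z := by rw [e.right_inv h2, h3]
    exact ⟨⟨h1, by rwa [Set.mem_preimage, h4]⟩, h4⟩
  classical
  -- By `hrp` the value does not depend on the representative chosen in N'. The default 0 is taken
  -- only off the chart domain p '' N'.
  let fwd : Y → Z := fun y => if h : ∃ x ∈ N', p x = y then r (e h.choose) else 0
  have hfwd : ∀ x ∈ N', fwd (p x) = r (e x) := fun x hx => by
    have h : ∃ x' ∈ N', p x' = p x := ⟨x, hx, rfl⟩
    simp only [fwd, dif_pos h]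
    exact hrp _ (hNp _ h.choose_spec.1.1).1 _ (hNp _ hx.1).1 h.choose_spec.2
  have hpS : ∀ x ∈ N', p (S (r (e x))) = p x := fun x hx => ((hNp x hx.1).2.2.2).symm
  have hScO : ContinuousOn S O := fun z hz => by
    refine ContinuousAt.continuousWithinAt ?_
    exact ContinuousAt.comp (g := e.symm) (f := fun z => a + T z)
      (e.continuousAt_symm (hOp z hz).2.1) (by fun_prop)
  let e' : OpenPartialHomeomorph Y Z :=
    { toFun := fwd
      invFun := p ∘ S
      source := p '' N'
      target := O
      map_source' := by
        rintro _ ⟨x, hx, rfl⟩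
        rw [hfwd x hx]
        exact hx.2
      map_target' := fun z hz => ⟨S z, (hSN' z hz).1, rfl⟩
      left_inv' := by
        rintro _ ⟨x, hx, rfl⟩
        rw [hfwd x hx]
        exact hpS x hx
      right_inv' := fun z hz => by
        change fwd (p (S z)) = z
        rw [hfwd _ (hSN' z hz).1, (hSN' z hz).2]
      open_source := hpo _ hN'o
      open_target := hOo
      continuousOn_toFun := by
        rw [continuousOn_open_iff (hpo _ hN'o)]
        intro Q hQ
        have : p '' N' ∩ fwd ⁻¹' Q = p '' (N' ∩ (fun x => r (e x)) ⁻¹' Q) := by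
          ext y
          constructor
          · rintro ⟨⟨x, hx, rfl⟩, hy⟩
            rw [Set.mem_preimage, hfwd x hx] at hy
            exact ⟨x, ⟨hx, hy⟩, rfl⟩
          · rintro ⟨x, ⟨hx, hy⟩, rfl⟩
            refine ⟨⟨x, hx, rfl⟩, ?_⟩
            rw [Set.mem_preimage, hfwd x hx]
            exact hy
        rw [this]
        exact hpo _ ((hrc.mono Set.inter_subset_left).isOpen_inter_preimage hN'o hQ)
      continuousOn_invFun := hpc.comp_continuousOn hScO }
  refine ⟨e', ⟨x₀, ⟨hx₀N, ?_⟩, rfl⟩, ?_⟩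
  · change r (e x₀) ∈ O
    rwa [← ha, hr0]
  · rintro f _ ⟨x, hx, rfl⟩
    change SmoothAt f (p x) ↔ NearSmooth (f ∘ p ∘ S) (fwd (p x))
    rw [hfwd x hx, ← hpS x hx]
    have hz : r (e x) ∈ O := hx.2
    generalize r (e x) = z at hz
    obtain ⟨h1, h2, h3⟩ := hOp z hz
    have hes : e (S z) = a + T z := e.right_inv h2
    rw [hp, he _ _ (hNp _ h1).2.1, hes]
    have hTz : NearSmooth (fun z => a + T z) z :=
      ContDiff.nearSmooth (contDiff_const.add T.contDiff) z
    constructor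
    · intro h
      exact NearSmooth.comp (g := (f ∘ p) ∘ e.symm) (f := fun z => a + T z) z h hTz
    · intro h
      have hrs : NearSmooth r (a + T z) := by
        have := (hNp _ h1).2.2.1
        rwa [hes] at this
      refine (NearSmooth.comp (g := f ∘ p ∘ S) (f := r) (a + T z) (by rwa [h3]) hrs).congr ?_
      have h5 : ContinuousAt e.symm (a + T z) := e.continuousAt_symm h2
      filter_upwards [e.open_target.mem_nhds h2, h5.eventually (hN'o.mem_nhds (hSN' z hz).1)]
        with t ht htN
      have := hpS _ htN
      rw [e.right_inv ht] at this
      simp [this]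

/-- Smooth functions on the quotient by a smooth group action. -/
theorem smoothAt_quotient_iff {K : Type*} [Group K] [MulAction K X]
    {p : X → Y} (hpo : IsOpenMap p)
    (hfib : ∀ x x', p x = p x' → ∃ g : K, g • x = x') (hinv : ∀ (g : K) x, p (g • x) = p x)
    (hcoind : ∀ (f : Y → ℝ) y, SmoothAt f y ↔ ∃ U ∈ 𝓝 y, ∀ x, p x ∈ U → SmoothAt (f ∘ p) x)
    (hgerm : ∀ (f : X → ℝ) x, SmoothAt f x → ∀ᶠ x' in 𝓝 x, SmoothAt f x')
    (hact : ∀ g : K, IsSmoothMap (fun x : X => g • x)) (f : Y → ℝ) (x : X) :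
    SmoothAt f (p x) ↔ SmoothAt (f ∘ p) x := by
  rw [hcoind]
  constructor
  · rintro ⟨U, hU, h⟩
    exact h x (mem_of_mem_nhds hU)
  · intro h
    -- The set of smooth points is open by `hgerm`; translation by the group carries smoothness to
    -- the remaining points over its image.
    refine ⟨p '' {x' | SmoothAt (f ∘ p) x'}, hpo.image_mem_nhds (hgerm _ _ h), ?_⟩
    rintro x' ⟨x'', hx'', e⟩
    obtain ⟨g, rfl⟩ := hfib _ _ e.symm
    have := (hact g).2 x' (f ∘ p) hx''
    have h2 : (f ∘ p) ∘ (fun x : X => g • x) = f ∘ p := by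
      ext y
      simp [hinv]
    rwa [h2] at this

end Quotients

end SmoothSpace

namespace LagrangianRep

open Filter Topology SmoothSpace Lagrangian

/-- Complex linear operators. -/
abbrev CxOp (n : ℕ) : Type := Cn n →L[ℂ] Cn n

/-- Real linear operators. -/
abbrev RealOp (n : ℕ) : Type := Cn n →L[ℝ] Cn n

/-! ### Algebra of real and complex operators on ℂⁿ -/

section Instances

variable {n : ℕ}

theorem continuousStar_operators {H : Type*} [NormedAddCommGroup H] [InnerProductSpace ℂ H]
    [CompleteSpace H] : ContinuousStar (H →L[ℂ] H) := inferInstance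

instance : ContinuousStar (CxOp n) := continuousStar_operators

instance : IsScalarTower ℝ (RealOp n) (RealOp n) := ⟨fun _ _ _ => rfl⟩

instance : SMulCommClass ℝ (RealOp n) (RealOp n) :=
  ⟨fun r a b => by
    ext1 v
    exact (a.map_smul r (b v)).symm⟩

theorem RealOp.mul_neg (a b : RealOp n) : a * -b = -(a * b) := _root_.mul_neg a b

theorem RealOp.neg_mul (a b : RealOp n) : -a * b = -(a * b) := _root_.neg_mul a b

theorem RealOp.mul_sub (a b c : RealOp n) : a * (b - c) = a * b - a * c := _root_.mul_sub a b c

theorem RealOp.sub_mul (a b c : RealOp n) : (a - b) * c = a * c - b * c := _root_.sub_mul a b c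

theorem CxOp.mul_neg (a b : CxOp n) : a * -b = -(a * b) := _root_.mul_neg a b

theorem CxOp.star_add (a b : CxOp n) : star (a + b) = star a + star b := StarAddMonoid.star_add a b

theorem CxOp.star_zero : star (0 : CxOp n) = 0 := _root_.star_zero (CxOp n)

theorem CxOp.star_neg (a : CxOp n) : star (-a) = -star a := _root_.star_neg a

theorem CxOp.sub_mul (a b c : CxOp n) : (a - b) * c = a * c - b * c := _root_.sub_mul a b c

end Instances

/-! ### Lagrangian subspaces as anti-linear self-adjoint involutions -/

section RealOperators

variable {n : ℕ}

/-- A complex linear operator as a real linear one. -/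
def toReal : CxOp n →L[ℝ] RealOp n := ContinuousLinearMap.restrictScalarsL ℂ (Cn n) (Cn n) ℝ ℝ

@[simp] theorem toReal_apply (a : CxOp n) (v : Cn n) : toReal a v = a v := rfl

@[simp] theorem toReal_mul (a b : CxOp n) : toReal (a * b) = toReal a * toReal b := rfl

@[simp] theorem toReal_one : toReal (1 : CxOp n) = 1 := rfl

theorem toReal_injective : Function.Injective (toReal : CxOp n → RealOp n) := fun a b h => by
  ext1 v
  exact DFunLike.congr_fun h v

theorem toReal_star (a : CxOp n) : toReal (star a) = star (toReal a) := by
  rw [ContinuousLinearMap.star_eq_adjoint, ContinuousLinearMap.star_eq_adjoint,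
    ContinuousLinearMap.eq_adjoint_iff]
  intro x y
  rw [re_inner_eq, re_inner_eq, toReal_apply, toReal_apply, ContinuousLinearMap.adjoint_inner_left]

/-- Multiplication by a complex number, as a real operator. -/
def scalarOp (z : ℂ) : RealOp n := toReal (z • (1 : CxOp n))

@[simp] theorem scalarOp_apply (z : ℂ) (v : Cn n) : (scalarOp z : RealOp n) v = z • v := rfl

theorem scalarOp_mul (z w : ℂ) : (scalarOp (z * w) : RealOp n) = scalarOp z * scalarOp w := by
  ext1 v
  exact mul_smul z w v

@[simp] theorem scalarOp_one : (scalarOp 1 : RealOp n) = 1 := by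
  ext1 v
  exact one_smul ℂ v

theorem scalarOp_ofReal (r : ℝ) : (scalarOp (r : ℂ) : RealOp n) = r • 1 := by
  ext v i
  simp

theorem scalarOp_mul_toReal (z : ℂ) (a : CxOp n) :
    scalarOp z * toReal a = toReal a * scalarOp z := by
  ext1 v
  exact (map_smul a z v).symm

theorem toReal_smul (z : ℂ) (a : CxOp n) : toReal (z • a) = scalarOp z * toReal a := rfl

theorem star_scalarOp (z : ℂ) : star (scalarOp z : RealOp n) = scalarOp (starRingEnd ℂ z) := by
  rw [scalarOp, ← toReal_star, star_smul, star_one]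
  rfl

theorem continuous_scalarOp : Continuous (scalarOp : ℂ → RealOp n) :=
  toReal.continuous.comp (continuous_id.smul continuous_const)

theorem exists_toReal_eq {x : RealOp n} (h : x * scalarOp Complex.I = scalarOp Complex.I * x) :
    ∃ a : CxOp n, toReal a = x := by
  have hI : ∀ v, x (Complex.I • v) = Complex.I • x v := fun v => DFunLike.congr_fun h v
  have h1 : ∀ (r : ℝ) (w : Cn n), (r : ℂ) • w = r • w := fun r w => by
    ext i; simp
  refine ⟨{ toFun := x, map_add' := map_add x, cont := x.continuous, map_smul' := fun c v => ?_ },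
    rfl⟩
  conv_lhs => rw [← Complex.re_add_im c]
  conv_rhs => rw [← Complex.re_add_im c]
  simp only [RingHom.id_apply, add_smul, mul_smul, h1, map_add, map_smul, hI]

/-- A left inverse of the inclusion of the complex operators into the real ones. -/
def toCx : RealOp n →L[ℝ] CxOp n :=
  (LinearMap.exists_leftInverse_of_injective (toReal (n := n)).toLinearMap
    (LinearMap.ker_eq_bot.2 toReal_injective)).choose.toContinuousLinearMap

@[simp] theorem toCx_toReal (a : CxOp n) : toCx (toReal a) = a :=
  DFunLike.congr_fun (LinearMap.exists_leftInverse_of_injective (toReal (n := n)).toLinearMap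
    (LinearMap.ker_eq_bot.2 toReal_injective)).choose_spec a

/-- Self-adjoint anti-linear involutions. -/
structure IsReflection (s : RealOp n) : Prop where
  mul_self : s * s = 1
  anti : s * scalarOp Complex.I = -(scalarOp Complex.I * s)
  selfAdjoint : star s = s

theorem IsReflection.mul_scalarOp {s : RealOp n} (hs : IsReflection s) (z : ℂ) :
    s * scalarOp z = scalarOp (starRingEnd ℂ z) * s := by
  have hI : ∀ v, s (Complex.I • v) = -(Complex.I • s v) := fun v => DFunLike.congr_fun hs.anti v
  have h1 : ∀ (r : ℝ) (w : Cn n), (r : ℂ) • w = r • w := fun r w => by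
    ext i; simp
  ext1 v
  change s (z • v) = starRingEnd ℂ z • s v
  conv_lhs => rw [← Complex.re_add_im z]
  conv_rhs => rw [← Complex.re_add_im z]
  simp only [add_smul, mul_smul, h1, map_add, map_smul, hI, map_mul, Complex.conj_ofReal,
    Complex.conj_I, mul_neg, neg_smul, smul_neg]

theorem IsReflection.scalarOp_mul {s : RealOp n} (hs : IsReflection s) {z : ℂ}
    (hz : starRingEnd ℂ z * z = 1) : IsReflection (scalarOp z * s) where
  mul_self := by
    rw [mul_assoc, ← mul_assoc s, hs.mul_scalarOp, mul_assoc, hs.mul_self, mul_one,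
      ← LagrangianRep.scalarOp_mul, mul_comm, hz, scalarOp_one]
  anti := by
    rw [mul_assoc, hs.anti, RealOp.mul_neg, ← mul_assoc, ← mul_assoc, ← LagrangianRep.scalarOp_mul,
      ← LagrangianRep.scalarOp_mul, mul_comm]
  selfAdjoint := by
    rw [star_mul, hs.selfAdjoint, star_scalarOp, hs.mul_scalarOp, Complex.conj_conj]

/-- The involution of a Lagrangian subspace, as a real operator. -/
def reflOp (L : Lagrangian n) : RealOp n := (2 : ℝ) • L.proj - 1

theorem reflOp_apply (L : Lagrangian n) (v : Cn n) : reflOp L v = L.σ v := by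
  rw [σ, Submodule.reflection_apply]
  simp [reflOp, proj, two_smul]

theorem isReflection_reflOp (L : Lagrangian n) : IsReflection (reflOp L) where
  mul_self := by
    ext1 v
    change reflOp L (reflOp L v) = v
    rw [reflOp_apply, reflOp_apply, σ_σ]
  anti := by
    ext1 v
    change reflOp L (Complex.I • v) = -(Complex.I • reflOp L v)
    rw [reflOp_apply, reflOp_apply, σ_I_smul]
  selfAdjoint := by
    rw [ContinuousLinearMap.star_eq_adjoint, eq_comm, ContinuousLinearMap.eq_adjoint_iff]
    intro x y
    rw [reflOp_apply, reflOp_apply, ← L.σ.inner_map_map, σ_σ]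

theorem mem_space_iff (L : Lagrangian n) (v : Cn n) : v ∈ L.space ↔ reflOp L v = v := by
  rw [reflOp_apply, σ_eq_self_iff]

theorem reflOp_injective : Function.Injective (reflOp : Lagrangian n → RealOp n) := by
  intro L L' h
  ext v
  rw [mem_space_iff, mem_space_iff, h]

/-- The subspace is the fixed space of s. Since s anti-commutes with i, multiplication by i
exchanges the eigenspaces ±1, and self-adjointness makes these orthogonal. Conversely, a vector v
pairing trivially with every x + s x satisfies i(v − s v) = 0, so it is fixed. -/
theorem exists_reflOp_eq {s : RealOp n} (hs : IsReflection s) : ∃ L : Lagrangian n, reflOp L = s := by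
  have hss : ∀ v, s (s v) = v := fun v => DFunLike.congr_fun hs.mul_self v
  have hsI : ∀ v, s (Complex.I • v) = -(Complex.I • s v) := fun v => DFunLike.congr_fun hs.anti v
  have hsa : ∀ v w, inner ℝ (s v) w = inner ℝ v (s w) := fun v w => by
    have h := hs.selfAdjoint
    rw [ContinuousLinearMap.star_eq_adjoint] at h
    conv_lhs => rw [← h]
    rw [ContinuousLinearMap.adjoint_inner_left]
  have him : ∀ v w : Cn n, (inner ℂ v w).im = inner ℝ (Complex.I • v) w := fun v w => by
    rw [re_inner_eq, inner_smul_left]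
    simp
  let L : Lagrangian n :=
    { space := LinearMap.ker (s - 1).toLinearMap
      isLagrangian := fun v => by
        have hm : ∀ w, w ∈ LinearMap.ker (s - 1).toLinearMap ↔ s w = w := fun w => by
          simp [sub_eq_zero]
        constructor
        · intro hv w hw
          rw [hm] at hv hw
          rw [him]
          have h1 : inner ℝ (Complex.I • v) w = -inner ℝ (Complex.I • v) w := by
            conv_lhs => rw [← hw, ← hsa, hsI, hv, inner_neg_left]
          linarith
        · intro h
          rw [hm]
          have h1 : ∀ x, inner ℝ (Complex.I • v) (x + s x) = 0 := fun x => by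
            rw [← him]
            apply h
            rw [hm, map_add, hss, add_comm]
          have h2 : ∀ x, inner ℝ (Complex.I • (v - s v)) x = 0 := fun x => by
            have := h1 x
            rw [inner_add_right, ← hsa, hsI, inner_neg_left] at this
            rw [smul_sub, inner_sub_left]
            linarith
          have h3 : Complex.I • (v - s v) = 0 := by
            have := h2 (Complex.I • (v - s v))
            rwa [inner_self_eq_zero] at this
          have h4 := (smul_eq_zero.1 h3).resolve_left Complex.I_ne_zero
          exact (sub_eq_zero.1 h4).symm }
  have hL : ∀ w, w ∈ L.space ↔ s w = w := fun w => by
    change w ∈ LinearMap.ker (s - 1).toLinearMap ↔ _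
    simp [sub_eq_zero]
  refine ⟨L, ?_⟩
  ext1 v
  rw [reflOp_apply]
  have hv : v = (2⁻¹ : ℝ) • (v + s v) + (2⁻¹ : ℝ) • (v - s v) := by
    rw [← smul_add]
    have : v + s v + (v - s v) = (2 : ℝ) • v := by rw [two_smul]; abel
    rw [this, smul_smul]; norm_num
  have h1 : (2⁻¹ : ℝ) • (v + s v) ∈ L.space := by
    rw [hL, map_smul, map_add, hss, add_comm]
  have h2 : (2⁻¹ : ℝ) • (v - s v) ∈ L.spaceᗮ := by
    rw [mem_orthogonal_iff, hL, hsI, map_smul, map_sub, hss, ← smul_neg, ← smul_neg, neg_sub]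
  conv_lhs => rw [hv]
  rw [L.σ_add h1 h2, ← smul_sub]
  have : v + s v - (v - s v) = (2 : ℝ) • s v := by rw [two_smul]; abel
  rw [this, smul_smul]; norm_num

/-- The Lagrangian subspace with a given involution. -/
def ofReflection {s : RealOp n} (hs : IsReflection s) : Lagrangian n := (exists_reflOp_eq hs).choose

@[simp] theorem reflOp_ofReflection {s : RealOp n} (hs : IsReflection s) :
    reflOp (ofReflection hs) = s := (exists_reflOp_eq hs).choose_spec

theorem toReal_unitary_mul_star (g : U n) :
    toReal (g : CxOp n) * toReal (star (g : CxOp n)) = 1 := by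
  rw [← toReal_mul, (Unitary.mem_iff.1 g.2).2, toReal_one]

theorem toReal_star_mul_unitary (g : U n) :
    toReal (star (g : CxOp n)) * toReal (g : CxOp n) = 1 := by
  rw [← toReal_mul, (Unitary.mem_iff.1 g.2).1, toReal_one]

theorem reflOp_smul (g : U n) (L : Lagrangian n) :
    reflOp (g • L) = toReal (g : CxOp n) * reflOp L * toReal (star (g : CxOp n)) := by
  have h : reflOp (g • L) * toReal (g : CxOp n) = toReal (g : CxOp n) * reflOp L := by
    ext1 v
    change reflOp (g • L) ((g : CxOp n) v) = (g : CxOp n) (reflOp L v)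
    rw [reflOp_apply, reflOp_apply, σ_unitary_smul]
  rw [← h, mul_assoc, toReal_unitary_mul_star, mul_one]

theorem toReal_τ₂ (L₁ L₂ : Lagrangian n) :
    toReal (τ₂ L₁ L₂ : CxOp n) = reflOp L₁ * reflOp L₂ := by
  ext1 v
  change _ = reflOp L₁ (reflOp L₂ v)
  rw [reflOp_apply, reflOp_apply]
  rfl

end RealOperators

/-! ### The circle action on Lagrangian subspaces -/

section Circle

variable {n : ℕ}

theorem circle_conj_mul (z : Circle) : starRingEnd ℂ (z : ℂ) * z = 1 := by
  rw [mul_comm, Complex.mul_conj, Circle.normSq_coe, Complex.ofReal_one]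

/-- The circle acts on the Lagrangian subspaces by multiplication of the involutions. -/
instance : SMul Circle (Lagrangian n) where
  smul z L := ofReflection ((isReflection_reflOp L).scalarOp_mul (circle_conj_mul z))

theorem reflOp_circle_smul (z : Circle) (L : Lagrangian n) :
    reflOp (z • L) = scalarOp (z : ℂ) * reflOp L := reflOp_ofReflection _

instance : MulAction Circle (Lagrangian n) where
  one_smul L := reflOp_injective <| by rw [reflOp_circle_smul]; simp
  mul_smul z w L := reflOp_injective <| by
    rw [reflOp_circle_smul, reflOp_circle_smul, reflOp_circle_smul, Circle.coe_mul, scalarOp_mul,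
      mul_assoc]

/-- Moving the second z across the anti-linear first reflection conjugates it, and the two factors
cancel. -/
theorem τ₂_circle_smul (z : Circle) (L₁ L₂ : Lagrangian n) : τ₂ (z • L₁) (z • L₂) = τ₂ L₁ L₂ := by
  apply Subtype.ext
  apply toReal_injective
  rw [toReal_τ₂, toReal_τ₂, reflOp_circle_smul, reflOp_circle_smul, mul_assoc,
    ← mul_assoc (reflOp L₁), (isReflection_reflOp L₁).mul_scalarOp, mul_assoc, ← mul_assoc,
    ← scalarOp_mul, mul_comm (z : ℂ), circle_conj_mul, scalarOp_one, one_mul]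

/-- The scalar unitary operators. -/
def scalarUnitary (z : Circle) : U n :=
  ⟨(z : ℂ) • 1, by
    have h : star (z : ℂ) * (z : ℂ) = 1 := circle_conj_mul z
    rw [Unitary.mem_iff, star_smul, star_one, smul_mul_smul_comm, smul_mul_smul_comm, mul_one,
      mul_comm (z : ℂ), h, one_smul]
    exact ⟨rfl, rfl⟩⟩

/-- Conjugating an anti-linear R by a scalar doubles the phase: z R z̄ = z² R. This places circle
orbits inside U(n)-orbits. -/
theorem scalarUnitary_smul (z : Circle) (L : Lagrangian n) :
    (scalarUnitary z : U n) • L = (z * z) • L := by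
  apply reflOp_injective
  rw [reflOp_smul, reflOp_circle_smul, Circle.coe_mul, scalarOp_mul]
  have h1 : toReal ((scalarUnitary z : U n) : CxOp n) = scalarOp (z : ℂ) := rfl
  rw [toReal_star, h1, star_scalarOp, mul_assoc, (isReflection_reflOp L).mul_scalarOp,
    Complex.conj_conj, mul_assoc]

theorem exists_mul_self_circle (z : Circle) : ∃ w : Circle, w * w = z := by
  refine ⟨Circle.exp (Complex.arg z / 2), ?_⟩
  rw [← Circle.exp_add, add_halves, Circle.exp_arg]

end Circle

/-! ### Topology and smooth structure of tuples, representations and U(n) -/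

section Models

variable {ℓ n : ℕ}

/-- The involutions of a tuple of Lagrangian subspaces. -/
def reflOps (lam : Fin ℓ → Lagrangian n) (s : Fin ℓ) : RealOp n := reflOp (lam s)

theorem reflOps_injective : Function.Injective (reflOps : (Fin ℓ → Lagrangian n) → _) :=
  fun _ _ h => funext fun s => reflOp_injective (congrFun h s)

theorem isModel_proj :
    IsModel (fun (lam : Fin ℓ → Lagrangian n) s => (lam s).proj) where
  isInducing := IsInducing.piMap (f := fun _ : Fin ℓ => (Lagrangian.proj : Lagrangian n → _))
    fun _ => ⟨rfl⟩
  smoothAt_iff _ _ := Iff.rfl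

/-- A smooth left inverse of T is enough, since functions of `i` are recovered through it. This
serves to replace the projections P by the reflections 2P − 1. -/
theorem _root_.SmoothSpace.IsModel.comp_diffeo {X V V' : Type*} [TopologicalSpace X] [SmoothSpace X]
    [NormedAddCommGroup V] [NormedSpace ℝ V] [NormedAddCommGroup V'] [NormedSpace ℝ V']
    {i : X → V} (hi : IsModel i) (T : V → V') (T' : V' → V) (hT : ContDiff ℝ ω T)
    (hT' : ContDiff ℝ ω T') (h : ∀ v, T' (T v) = v) : IsModel (T ∘ i) where
  isInducing := by
    refine IsInducing.comp ?_ hi.isInducing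
    exact (Topology.IsEmbedding.of_leftInverse h hT'.continuous hT.continuous).isInducing
  smoothAt_iff f x := by
    rw [hi.smoothAt_iff]
    constructor
    · rintro ⟨g, hg, e⟩
      refine ⟨g ∘ T', NearSmooth.comp (g := g) _ ?_ (hT'.nearSmooth _), e.trans (.of_forall ?_)⟩
      · simpa [h] using hg
      · intro y; simp [h]
    · rintro ⟨g, hg, e⟩
      exact ⟨g ∘ T, NearSmooth.comp _ hg (hT.nearSmooth _), e⟩

theorem isModel_reflOps : IsModel (reflOps : (Fin ℓ → Lagrangian n) → (Fin ℓ → RealOp n)) := by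
  refine isModel_proj.comp_diffeo (fun x s => (2 : ℝ) • x s - 1)
    (fun x s => (2⁻¹ : ℝ) • (x s + 1)) ?_ ?_ ?_
  · fun_prop
  · fun_prop
  · intro v
    ext s
    simp

theorem continuous_reflOp : Continuous (reflOp : Lagrangian n → RealOp n) := by
  have : Continuous (Lagrangian.proj : Lagrangian n → _) := continuous_induced_dom
  exact (this.const_smul (2 : ℝ)).sub continuous_const

theorem isInducing_reflOp : IsInducing (reflOp : Lagrangian n → RealOp n) := by
  have h : IsInducing (Lagrangian.proj : Lagrangian n → RealOp n) := ⟨rfl⟩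
  have h2 : IsInducing (fun x : RealOp n => (2 : ℝ) • x - 1) :=
    (Topology.IsEmbedding.of_leftInverse (f := fun x : RealOp n => (2⁻¹ : ℝ) • (x + 1))
      (fun v => by simp) (by fun_prop) (by fun_prop)).isInducing
  exact h2.comp h

theorem isModel_coords : IsModel (HomU.coords : HomU ℓ n → (Fin ℓ → CxOp n)) where
  isInducing := ⟨rfl⟩
  smoothAt_iff _ _ := Iff.rfl

theorem coords_injective : Function.Injective (HomU.coords : HomU ℓ n → _) := fun _ _ h =>
  PresentedGroup.ext fun s => Subtype.ext (congrFun h s)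

theorem coords_smul (g : U n) (ρ : HomU ℓ n) (s : Fin ℓ) :
    (g • ρ).coords s = (g : CxOp n) * ρ.coords s * star (g : CxOp n) := rfl

theorem isModel_unitary : IsModel (fun g : U n => (g : CxOp n)) := isModel_id.subtype _

theorem isModel_circle : IsModel (fun z : Circle => (z : ℂ)) where
  isInducing := ⟨rfl⟩
  smoothAt_iff _ _ := Iff.rfl

instance : T2Space (Fin ℓ → Lagrangian n) :=
  ⟨fun x y h => by
    have := t2_separation (reflOps_injective.ne h)
    obtain ⟨u, v, hu, hv, hx, hy, hd⟩ := this
    exact ⟨_, _, hu.preimage isModel_reflOps.continuous, hv.preimage isModel_reflOps.continuous,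
      hx, hy, hd.preimage _⟩⟩

instance : T2Space (HomU ℓ n) :=
  ⟨fun x y h => by
    have := t2_separation (coords_injective.ne h)
    obtain ⟨u, v, hu, hv, hx, hy, hd⟩ := this
    exact ⟨_, _, hu.preimage isModel_coords.continuous, hv.preimage isModel_coords.continuous,
      hx, hy, hd.preimage _⟩⟩

instance : SecondCountableTopology (HomU ℓ n) :=
  isModel_coords.isInducing.secondCountableTopology

theorem continuous_unitary_coe : Continuous (fun g : U n => (g : CxOp n)) := continuous_subtype_val

instance : ContinuousSMul (U n) (Lagrangian n) where
  continuous_smul := by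
    rw [isInducing_reflOp.continuous_iff]
    have h : (reflOp ∘ fun p : U n × Lagrangian n => p.1 • p.2) = fun p =>
        toReal (p.1 : CxOp n) * reflOp p.2 * toReal (star (p.1 : CxOp n)) :=
      funext fun p => reflOp_smul _ _
    rw [h]
    have h1 : Continuous fun p : U n × Lagrangian n => (p.1 : CxOp n) :=
      continuous_unitary_coe.comp continuous_fst
    exact ((toReal.continuous.comp h1).mul (continuous_reflOp.comp continuous_snd)).mul
      (toReal.continuous.comp h1.star)

instance : ContinuousSMul Circle (Lagrangian n) where
  continuous_smul := by
    rw [isInducing_reflOp.continuous_iff]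
    have h : (reflOp ∘ fun p : Circle × Lagrangian n => p.1 • p.2) = fun p =>
        scalarOp (p.1 : ℂ) * reflOp p.2 := funext fun p => reflOp_circle_smul _ _
    rw [h]
    exact (continuous_scalarOp.comp (continuous_subtype_val.comp continuous_fst)).mul
      (continuous_reflOp.comp continuous_snd)

instance : ContinuousSMul (U n) (HomU ℓ n) where
  continuous_smul := by
    rw [isModel_coords.isInducing.continuous_iff]
    have h : (HomU.coords ∘ fun p : U n × HomU ℓ n => p.1 • p.2) = fun p s =>
        (p.1 : CxOp n) * p.2.coords s * star (p.1 : CxOp n) := rfl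
    rw [h]
    have h1 : Continuous fun p : U n × HomU ℓ n => (p.1 : CxOp n) :=
      continuous_unitary_coe.comp continuous_fst
    have h2 : Continuous fun p : U n × HomU ℓ n => p.2.coords :=
      isModel_coords.continuous.comp continuous_snd
    exact continuous_pi fun s => (h1.mul ((continuous_apply s).comp h2)).mul h1.star

instance : CompactSpace (U n) := by
  refine isCompact_iff_compactSpace (s := (unitary (CxOp n) : Set (CxOp n))).1 ?_
  refine Metric.isCompact_of_isClosed_isBounded ?_ ?_
  · have : (unitary (CxOp n) : Set (CxOp n)) =
        {a | star a * a = 1} ∩ {a | a * star a = 1} := by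
      ext a; exact Unitary.mem_iff
    rw [this]
    exact (isClosed_eq (by fun_prop) continuous_const).inter
      (isClosed_eq (by fun_prop) continuous_const)
  · refine (Metric.isBounded_iff_subset_closedBall 0).2 ⟨1, fun a ha => ?_⟩
    rw [mem_closedBall_zero_iff]
    refine ContinuousLinearMap.opNorm_le_bound _ zero_le_one fun v => ?_
    rw [one_mul]
    exact le_of_eq (Unitary.norm_map ⟨a, ha⟩ v)

end Models

end LagrangianRep

namespace LagrangianRep

open Filter Topology SmoothSpace Lagrangian

/-! ### Square roots of unitary elements -/

section SquareRoots

/-- The root with non-negative real part has |ν + 1| ≥ 1, and μ − 1 = (ν − 1)(ν + 1). -/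
theorem exists_complex_sqrt (μ : ℂ) : ∃ ν : ℂ, ν * ν = μ ∧ ‖ν - 1‖ ≤ ‖μ - 1‖ := by
  obtain ⟨ν, hν, hre⟩ : ∃ ν : ℂ, ν * ν = μ ∧ 0 ≤ ν.re := by
    obtain ⟨ν, hν⟩ := IsAlgClosed.exists_pow_nat_eq μ (n := 2) (by norm_num)
    rw [sq] at hν
    rcases le_total 0 ν.re with h | h
    · exact ⟨ν, hν, h⟩
    · exact ⟨-ν, by rw [neg_mul_neg, hν], by simpa using h⟩
  refine ⟨ν, hν, ?_⟩
  have h1 : 1 ≤ ‖ν + 1‖ := by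
    refine le_trans ?_ (Complex.abs_re_le_norm _)
    rw [Complex.add_re, Complex.one_re, abs_of_nonneg (by linarith)]
    linarith
  have h2 : μ - 1 = (ν - 1) * (ν + 1) := by rw [← hν]; ring
  rw [h2, norm_mul]
  exact le_mul_of_one_le_right (norm_nonneg _) h1

/-- Spectral values are roots of the minimal polynomial. -/
theorem finite_spectrum_of_finiteDimensional {A : Type*} [Ring A] [Algebra ℂ A]
    [FiniteDimensional ℂ A] (a : A) : (spectrum ℂ a).Finite := by
  rcases subsingleton_or_nontrivial A with h | h
  · rw [spectrum.of_subsingleton]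
    exact Set.finite_empty
  · have hi : IsIntegral ℂ a := Algebra.IsIntegral.isIntegral a
    refine (Polynomial.finite_setOfPred_isRoot (minpoly.ne_zero hi)).subset fun x hx => ?_
    have h1 := spectrum.subset_polynomial_aeval a (minpoly ℂ a) ⟨x, hx, rfl⟩
    rw [minpoly.aeval, spectrum.zero_eq] at h1
    exact h1

/-- Unitary elements have square roots that are polynomials in them, unitary, and closer to `1`. -/
theorem exists_unitary_sqrt {A : Type*} [CStarAlgebra A] [FiniteDimensional ℂ A] {u : A}
    (hu : u ∈ unitary A) :
    ∃ p : Polynomial ℂ, Polynomial.aeval u p ∈ unitary A ∧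
      Polynomial.aeval u p * Polynomial.aeval u p = u ∧
      ‖Polynomial.aeval u p - 1‖ ≤ ‖u - 1‖ := by
  have hn : IsStarNormal u := ⟨by
    rw [commute_iff_eq, (Unitary.mem_iff.1 hu).1, (Unitary.mem_iff.1 hu).2]⟩
  choose f hf hf1 using exists_complex_sqrt
  have hfin := finite_spectrum_of_finiteDimensional u
  let S := hfin.toFinset
  -- Interpolating the root function on the finite spectrum realises the functional calculus by a
  -- polynomial, with no continuity of the root required.
  let p := Lagrange.interpolate S id f
  have hp : ∀ x ∈ spectrum ℂ u, p.eval x = f x := fun x hx =>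
    Lagrange.eval_interpolate_at_node f (Set.injOn_id _) (i := x) (hfin.mem_toFinset.2 hx)
  have hcp : cfc (fun x => p.eval x) u = Polynomial.aeval u p := cfc_polynomial p u
  have hc : ContinuousOn (fun x => p.eval x) (spectrum ℂ u) := p.continuous.continuousOn
  have hspec : ∀ x ∈ spectrum ℂ u, star x * x = 1 := by
    have h1 : cfc (fun x : ℂ => x) u ∈ unitary A := by
      rw [cfc_id' ℂ u]
      exact hu
    exact (cfc_unitary_iff (fun x : ℂ => x) u).1 h1
  refine ⟨p, ?_, ?_, ?_⟩
  · rw [← hcp, cfc_unitary_iff _ u]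
    intro x hx
    rw [hp x hx]
    have h1 := hspec x hx
    rw [← hf x] at h1
    have h2 : ‖f x‖ ^ 4 = 1 := by
      have := congrArg norm h1
      rw [norm_mul, norm_star, norm_mul, norm_one] at this
      rw [← this]; ring
    have h3 : ‖f x‖ = 1 := by
      exact (pow_eq_one_iff_of_nonneg (norm_nonneg _) (by norm_num)).1 h2
    have h4 : star (f x) * f x = ((‖f x‖ ^ 2 : ℝ) : ℂ) := by
      have := Complex.conj_mul' (f x)
      push_cast
      exact this
    rw [h4, h3]; norm_num
  · rw [← hcp, ← cfc_mul _ _ u]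
    conv_rhs => rw [← cfc_id' ℂ u]
    refine cfc_congr fun x hx => ?_
    simp only [hp x hx, hf]
  · have h1 : Polynomial.aeval u p - 1 = cfc (fun x => p.eval x - 1) u := by
      rw [cfc_sub _ _ u, hcp, cfc_const_one ℂ u]
    rw [h1]
    refine norm_cfc_le (norm_nonneg _) fun x hx => ?_
    rw [hp x hx]
    -- The scalar estimate passes to operators: every |x − 1| with x in the spectrum is at most ‖u −
    -- 1‖.
    refine (hf1 x).trans ?_
    have h2 : u - 1 = cfc (fun x : ℂ => x - 1) u := by
      rw [cfc_sub _ _ u, cfc_id' ℂ u, cfc_const_one ℂ u]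
    rw [h2]
    exact norm_apply_le_norm_cfc (fun x : ℂ => x - 1) u hx

end SquareRoots

/-! ### Fibres of φ̃ as orbits -/

section Fibres

variable {ℓ n : ℕ}

/-- Relations between cyclically consecutive entries propagate from entry 0 to all others; closing
up the cycle is not needed. -/
theorem finRotate_induction [NeZero ℓ] {P : Fin ℓ → Prop} (h0 : P 0)
    (h : ∀ s, P s → P (finRotate ℓ s)) (s : Fin ℓ) : P s := by
  obtain ⟨k, rfl⟩ := Nat.exists_eq_succ_of_ne_zero (NeZero.ne ℓ)
  induction s using Fin.induction with
  | zero => exact h0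
  | succ i ih =>
    have := h _ ih
    rwa [finRotate_apply, Fin.coeSucc_eq_succ] at this

theorem coords_phiTilde (lam : Fin ℓ → Lagrangian n) (s : Fin ℓ) :
    (phiTilde lam).coords s = (τ₂ (lam s) (lam (finRotate ℓ s)) : CxOp n) :=
  congrArg Subtype.val (phiTilde_γ lam s)

theorem toReal_coords_phiTilde (lam : Fin ℓ → Lagrangian n) (s : Fin ℓ) :
    toReal ((phiTilde lam).coords s) = reflOp (lam s) * reflOp (lam (finRotate ℓ s)) := by
  rw [coords_phiTilde, toReal_τ₂]

theorem phiTilde_circle_smul (z : Circle) (lam : Fin ℓ → Lagrangian n) :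
    phiTilde (z • lam) = phiTilde lam := by
  apply coords_injective
  funext s
  rw [coords_phiTilde, coords_phiTilde]
  exact congrArg Subtype.val (τ₂_circle_smul z _ _)

theorem reflOp_mul_reflOp (L : Lagrangian n) : reflOp L * reflOp L = 1 :=
  (isReflection_reflOp L).mul_self

/-- From R_s R_{s+1} = R'_s R'_{s+1} one gets R'_s R_s = R'_{s+1} R_{s+1}, so the operator comparing
the two tuples is the same for all entries. -/
theorem reflOp_eq_of_phiTilde_eq [NeZero ℓ] {lam lam' : Fin ℓ → Lagrangian n}
    (h : phiTilde lam = phiTilde lam') (s : Fin ℓ) :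
    reflOp (lam' s) = toReal (τ₂ (lam' 0) (lam 0) : CxOp n) * reflOp (lam s) := by
  have hA : ∀ s, reflOp (lam s) * reflOp (lam (finRotate ℓ s)) =
      reflOp (lam' s) * reflOp (lam' (finRotate ℓ s)) := fun s => by
    rw [← toReal_coords_phiTilde, ← toReal_coords_phiTilde, h]
  induction s using finRotate_induction with
  | h0 => rw [toReal_τ₂, mul_assoc, reflOp_mul_reflOp, mul_one]
  | h s ih =>
    calc reflOp (lam' (finRotate ℓ s))
        = reflOp (lam' s) * (reflOp (lam' s) * reflOp (lam' (finRotate ℓ s))) := by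
          rw [← mul_assoc, reflOp_mul_reflOp, one_mul]
      _ = (reflOp (lam' s) * reflOp (lam s)) * reflOp (lam (finRotate ℓ s)) := by
          rw [← hA, mul_assoc]
      _ = _ := by rw [ih, mul_assoc (toReal _), reflOp_mul_reflOp, mul_one]

/-- The relation is stable under powers and sums. It is also stable under complex coefficients,
because both the adjoint and passage across the anti-linear reflection conjugate them. -/
theorem reflOp_mul_toReal_aeval {L : Lagrangian n} {u : CxOp n}
    (h : reflOp L * toReal u = toReal (star u) * reflOp L) (p : Polynomial ℂ) :
    reflOp L * toReal (Polynomial.aeval u p) =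
      toReal (star (Polynomial.aeval u p)) * reflOp L := by
  have hpow : ∀ m : ℕ, reflOp L * toReal (u ^ m) = toReal (star (u ^ m)) * reflOp L := fun m => by
    induction m with
    | zero => simp
    | succ m ih =>
      rw [pow_succ', toReal_mul, ← mul_assoc, h, mul_assoc, ih, ← mul_assoc, ← toReal_mul,
        ← star_mul, ← pow_succ, ← pow_succ']
  induction p using Polynomial.induction_on' with
  | add p q hp hq => rw [map_add, map_add, mul_add, hp, hq, CxOp.star_add, map_add, add_mul]
  | monomial m a =>
    rw [Polynomial.aeval_monomial, Algebra.algebraMap_eq_smul_one, smul_mul_assoc, one_mul,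
      toReal_smul, ← mul_assoc, (isReflection_reflOp L).mul_scalarOp, mul_assoc, hpow, star_smul,
      toReal_smul, mul_assoc]
    rfl

/-- The fibres of `φ̃` are orbits of unitary operators, given by square roots. -/
theorem exists_smul_eq_of_phiTilde_eq [NeZero ℓ] {lam lam' : Fin ℓ → Lagrangian n}
    (h : phiTilde lam = phiTilde lam') :
    ∃ g : U n, g • lam = lam' ∧ (g : CxOp n) * g = (τ₂ (lam' 0) (lam 0) : CxOp n) ∧
      ‖(g : CxOp n) - 1‖ ≤ ‖(τ₂ (lam' 0) (lam 0) : CxOp n) - 1‖ := by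
  set u := τ₂ (lam' 0) (lam 0) with hu
  obtain ⟨p, hp1, hp2, hp3⟩ := exists_unitary_sqrt (A := CxOp n) u.2
  refine ⟨⟨_, hp1⟩, ?_, hp2, hp3⟩
  funext s
  have hs := reflOp_eq_of_phiTilde_eq h s
  rw [← hu] at hs
  -- This expresses that u R_s = R'_s is again an involution.
  have h1 : reflOp (lam s) * toReal (u : CxOp n) = toReal (star (u : CxOp n)) * reflOp (lam s) := by
    have h2 : toReal (u : CxOp n) * reflOp (lam s) * (toReal (u : CxOp n) * reflOp (lam s)) = 1 := by
      rw [← hs, reflOp_mul_reflOp]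
    calc reflOp (lam s) * toReal (u : CxOp n)
        = toReal (star (u : CxOp n)) * (toReal (u : CxOp n) * reflOp (lam s) *
          (toReal (u : CxOp n) * reflOp (lam s))) * reflOp (lam s) := by
          simp only [mul_assoc, reflOp_mul_reflOp, mul_one]
          rw [← mul_assoc, toReal_star_mul_unitary, one_mul]
      _ = _ := by rw [h2, mul_one]
  have h3 := reflOp_mul_toReal_aeval h1 p
  apply reflOp_injective
  rw [Pi.smul_apply, reflOp_smul, hs]
  set g := Polynomial.aeval (u : CxOp n) p
  -- Therefore g R g* = g² R = u R, which is the reflection of the second tuple.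
  have h4 : reflOp (lam s) * toReal (star g) = toReal g * reflOp (lam s) := by
    calc reflOp (lam s) * toReal (star g)
        = reflOp (lam s) * (toReal (star g) * reflOp (lam s)) * reflOp (lam s) := by
          simp only [mul_assoc, reflOp_mul_reflOp, mul_one]
      _ = _ := by rw [← h3, ← mul_assoc, reflOp_mul_reflOp, one_mul]
  rw [mul_assoc, h4, ← mul_assoc, ← toReal_mul, hp2]

end Fibres

/-! ### Schur's lemma and stabilizers of irreducible tuples -/

section Irreducible

variable {ℓ n : ℕ}

/-- Only the scalars commute with the operators `A s`. -/
def TrivialCommutant (A : Fin ℓ → CxOp n) : Prop :=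
  ∀ a : CxOp n, (∀ s, a * A s = A s * a) → ∃ z : ℂ, a = z • 1

theorem commute_of_commute_generators (f : Γ ℓ →* U n) {a : CxOp n}
    (h : ∀ s, a * (f (γ s) : CxOp n) = (f (γ s) : CxOp n) * a) (x : Γ ℓ) :
    a * (f x : CxOp n) = (f x : CxOp n) * a := by
  have hx : x ∈ Subgroup.closure (Set.range (γ : Fin ℓ → Γ ℓ)) := by
    have := PresentedGroup.closure_range_of
      ({(List.ofFn (fun s : Fin ℓ => FreeGroup.of s)).prod} : Set (FreeGroup (Fin ℓ)))
    change x ∈ Subgroup.closure (Set.range (PresentedGroup.of))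
    rw [this]
    trivial
  induction hx using Subgroup.closure_induction with
  | mem x hx =>
    obtain ⟨s, rfl⟩ := hx
    exact h s
  | one =>
    rw [f.map_one]
    exact (mul_one a).trans (one_mul a).symm
  | mul x y _ _ hx hy =>
    rw [f.map_mul]
    change a * ((f x : CxOp n) * (f y : CxOp n)) = ((f x : CxOp n) * (f y : CxOp n)) * a
    rw [← mul_assoc, hx, mul_assoc, hy, mul_assoc]
  | inv x _ hx =>
    rw [f.map_inv]
    set g := f x
    have h1 : ((g⁻¹ : U n) : CxOp n) * (g : CxOp n) = 1 := (Unitary.mem_iff.1 g.2).1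
    have h2 : (g : CxOp n) * ((g⁻¹ : U n) : CxOp n) = 1 := (Unitary.mem_iff.1 g.2).2
    calc a * ((g⁻¹ : U n) : CxOp n)
        = ((g⁻¹ : U n) : CxOp n) * ((g : CxOp n) * a) * ((g⁻¹ : U n) : CxOp n) := by
          rw [← mul_assoc, h1, one_mul]
      _ = _ := by rw [← hx, mul_assoc, mul_assoc, h2, mul_one]

theorem commute_of_commute_coords {ρ : HomU ℓ n} {a : CxOp n}
    (h : ∀ s, a * ρ.coords s = ρ.coords s * a) (x : Γ ℓ) :
    a * ((show Γ ℓ →* U n from ρ) x : CxOp n) = ((show Γ ℓ →* U n from ρ) x : CxOp n) * a :=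
  commute_of_commute_generators ρ h x

/-- Schur's lemma: an eigenspace of a commuting operator is a non-zero subrepresentation, hence
everything. -/
theorem HomU.Irr.trivialCommutant {ρ : HomU ℓ n} (hρ : ρ.Irr) : TrivialCommutant ρ.coords := by
  intro a ha
  have hs : IsSimpleOrder (Subrepresentation ρ.toRep) := hρ
  -- An eigenvalue exists only on a non-zero space. The zero space has a single subrepresentation,
  -- so it is not irreducible.
  have hnt : Nontrivial (Cn n) := by
    by_contra hcon
    rw [not_nontrivial_iff_subsingleton] at hcon
    obtain ⟨W, W', hW⟩ := hs.toNontrivial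
    apply hW
    ext v
    rw [Subsingleton.elim v 0]
    exact ⟨fun _ => W'.toSubmodule.zero_mem, fun _ => W.toSubmodule.zero_mem⟩
  obtain ⟨z, hz⟩ := Module.End.exists_eigenvalue (a : Cn n →ₗ[ℂ] Cn n)
  let W : Subrepresentation ρ.toRep :=
    { toSubmodule := Module.End.eigenspace (a : Cn n →ₗ[ℂ] Cn n) z
      apply_mem_toSubmodule := fun x v hv => by
        rw [Module.End.mem_eigenspace_iff] at hv ⊢
        rw [HomU.toRep_apply]
        have h1 := DFunLike.congr_fun (commute_of_commute_coords ha x) v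
        refine h1.trans ?_
        change ((show Γ ℓ →* U n from ρ) x : CxOp n) (a v) = _
        have h2 : a v = z • v := hv
        rw [h2, map_smul] }
  have hW : W ≠ ⊥ := by
    intro h
    obtain ⟨v, hv, hv0⟩ := hz.exists_hasEigenvector
    have h1 : v ∈ W := hv
    rw [h] at h1
    exact hv0 h1
  have hW2 := (IsSimpleOrder.eq_bot_or_eq_top W).resolve_left hW
  refine ⟨z, ?_⟩
  ext1 v
  have h1 : v ∈ W := by
    rw [hW2]
    trivial
  have h2 := Module.End.mem_eigenspace_iff.1 h1
  exact h2

/-- Unitarity makes the orthogonal complement of a subrepresentation invariant too, so the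
orthogonal projection commutes with the generators. A scalar projection is onto 0 or onto the whole
space. -/
theorem irr_of_trivialCommutant [NeZero n] {ρ : HomU ℓ n} (h : TrivialCommutant ρ.coords) :
    ρ.Irr := by
  have hcom : ∀ (W : Subrepresentation ρ.toRep) (s : Fin ℓ),
      W.toSubmodule.starProjection * ρ.coords s = ρ.coords s * W.toSubmodule.starProjection := by
    intro W s
    ext1 v
    change W.toSubmodule.starProjection (ρ.coords s v) =
      ρ.coords s (W.toSubmodule.starProjection v)
    set g := (show Γ ℓ →* U n from ρ) (γ s) with hg
    have hgc : ρ.coords s = (g : CxOp n) := rfl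
    have hginv : ((show Γ ℓ →* U n from ρ) (γ s)⁻¹ : U n) = g⁻¹ := map_inv _ _
    refine Submodule.eq_starProjection_of_mem_orthogonal' (u := ρ.coords s v)
      (z := ρ.coords s (v - W.toSubmodule.starProjection v))
      (W.apply_mem_toSubmodule (γ s) (Submodule.starProjection_apply_mem _ _)) ?_ ?_
    · rw [Submodule.mem_orthogonal]
      intro w hw
      have h1 : inner ℂ (((g⁻¹ : U n) : CxOp n) w) (v - W.toSubmodule.starProjection v) = 0 := by
        refine Submodule.sub_starProjection_mem_orthogonal (K := W.toSubmodule) v _ ?_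
        have := W.apply_mem_toSubmodule (γ s)⁻¹ hw
        rwa [HomU.toRep_apply, hginv] at this
      rw [← Unitary.inner_map_map g, unitary_inv_apply] at h1
      exact h1
    · rw [← map_add, add_sub_cancel]
  change IsSimpleOrder (Subrepresentation ρ.toRep)
  have hv : ∃ v : Cn n, v ≠ 0 := exists_ne 0
  obtain ⟨v₀, hv₀⟩ := hv
  refine { exists_pair_ne := ⟨⊥, ⊤, fun hbt => hv₀ ?_⟩, eq_bot_or_eq_top := fun W => ?_ }
  · have h1 : v₀ ∈ (⊤ : Subrepresentation ρ.toRep) := trivial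
    rw [← hbt] at h1
    exact h1
  · obtain ⟨z, hz⟩ := h _ (hcom W)
    have happ : ∀ v, W.toSubmodule.starProjection v = z • v := fun v => DFunLike.congr_fun hz v
    by_cases hz0 : z = 0
    · left
      ext v
      constructor
      · intro hv
        have h1 := (Submodule.starProjection_eq_self_iff (K := W.toSubmodule)).2 hv
        rw [happ, hz0, zero_smul] at h1
        rw [← h1]
        exact Submodule.zero_mem _
      · intro hv
        have h1 : v = 0 := hv
        rw [h1]
        exact W.toSubmodule.zero_mem
    · right
      ext v
      refine ⟨fun _ => trivial, fun _ => ?_⟩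
      have h1 : z • v ∈ W.toSubmodule := by
        rw [← happ]
        exact Submodule.starProjection_apply_mem _ _
      exact (Submodule.smul_mem_iff _ hz0).1 h1

/-- A unit vector. -/
def unitVec (n : ℕ) [NeZero n] : Cn n := EuclideanSpace.single 0 1

theorem inner_unitVec [NeZero n] (z : ℂ) : inner ℂ (unitVec n) (z • unitVec n) = z := by
  rw [inner_smul_right, unitVec, EuclideanSpace.inner_single_left]
  simp

/-- The operator whose injectivity expresses that the commutant of `A` is trivial. -/
def commutantOp [NeZero n] (A : Fin ℓ → CxOp n) : CxOp n →L[ℝ] (Fin ℓ → CxOp n) × ℂ :=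
  LinearMap.toContinuousLinearMap
    { toFun := fun a => (fun s => a * A s - A s * a, inner ℂ (unitVec n) (a (unitVec n)))
      map_add' := fun a b => by
        refine Prod.ext ?_ ?_
        · funext s
          change (a + b) * A s - A s * (a + b) = (a * A s - A s * a) + (b * A s - A s * b)
          rw [add_mul, mul_add]
          abel
        · exact inner_add_right _ _ _
      map_smul' := fun r a => by
        refine Prod.ext ?_ ?_
        · funext s
          ext1 v
          change r • a (A s v) - A s (r • a v) = r • (a (A s v) - A s (a v))
          rw [ContinuousLinearMap.map_smul_of_tower, smul_sub]
        · exact inner_smul_right_eq_smul (unitVec n) (a (unitVec n)) r }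

theorem commutantOp_apply [NeZero n] (A : Fin ℓ → CxOp n) (a : CxOp n) :
    commutantOp A a = (fun s => a * A s - A s * a, inner ℂ (unitVec n) (a (unitVec n))) := rfl

/-- The matrix entry ⟨e, a e⟩ recovers z from the scalar z. Adjoining it to the commutators removes
exactly the scalars from the kernel. -/
theorem trivialCommutant_iff [NeZero n] (A : Fin ℓ → CxOp n) :
    TrivialCommutant A ↔ Function.Injective (commutantOp A) := by
  constructor
  · intro h
    rw [injective_iff_map_eq_zero]
    intro a ha
    rw [commutantOp_apply, Prod.mk_eq_zero] at ha
    obtain ⟨z, rfl⟩ := h a fun s => sub_eq_zero.1 (congrFun ha.1 s)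
    have h1 := inner_unitVec (n := n) z
    have h2 : inner ℂ (unitVec n) (z • unitVec n) = 0 := ha.2
    rw [← h1, h2]
    exact zero_smul ℂ (1 : CxOp n)
  · intro h a ha
    refine ⟨inner ℂ (unitVec n) (a (unitVec n)), h ?_⟩
    set z : ℂ := inner ℂ (unitVec n) (a (unitVec n)) with hz
    refine Prod.ext ?_ ?_
    · funext s
      change a * A s - A s * a = (z • 1) * A s - A s * (z • 1)
      rw [ha, sub_self, smul_mul_assoc, one_mul, mul_smul_comm, mul_one, sub_self]
    · change z = inner ℂ (unitVec n) (z • unitVec n)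
      rw [inner_unitVec]

/-- Injectivity is an open condition on linear maps from a finite-dimensional space, and the
commutator operator varies continuously with the tuple. -/
theorem isOpen_trivialCommutant [NeZero n] :
    IsOpen {A : Fin ℓ → CxOp n | TrivialCommutant A} := by
  have hc : Continuous (commutantOp : (Fin ℓ → CxOp n) → _) := by
    rw [continuous_clm_apply]
    intro a
    refine Continuous.prodMk (continuous_pi fun s => ?_) continuous_const
    exact (continuous_const.mul (continuous_apply s)).sub ((continuous_apply s).mul continuous_const)
  have := ContinuousLinearMap.isOpen_injective.preimage hc
  convert this using 1
  ext A
  exact trivialCommutant_iff A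

theorem irr_iff_trivialCommutant [NeZero n] {ρ : HomU ℓ n} : ρ.Irr ↔ TrivialCommutant ρ.coords :=
  ⟨HomU.Irr.trivialCommutant, irr_of_trivialCommutant⟩

theorem continuous_phiTilde : Continuous (phiTilde : (Fin ℓ → Lagrangian n) → HomU ℓ n) := by
  rw [isModel_coords.isInducing.continuous_iff]
  have h : (HomU.coords ∘ phiTilde : (Fin ℓ → Lagrangian n) → _) = fun lam s =>
      toCx (reflOp (lam s) * reflOp (lam (finRotate ℓ s))) := by
    funext lam s
    rw [← toReal_coords_phiTilde, toCx_toReal]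
    rfl
  rw [h]
  refine continuous_pi fun s => toCx.continuous.comp ?_
  exact (continuous_reflOp.comp (continuous_apply s)).mul
    (continuous_reflOp.comp (continuous_apply (finRotate ℓ s)))

theorem isOpen_lambdaIrr [NeZero n] : IsOpen (LambdaIrr ℓ n : Set (Fin ℓ → Lagrangian n)) := by
  have := isOpen_trivialCommutant.preimage
    (isModel_coords.continuous.comp (continuous_phiTilde (ℓ := ℓ) (n := n)))
  convert this using 1
  ext lam
  exact irr_iff_trivialCommutant

theorem exists_scalar_of_commute {lam : Fin ℓ → Lagrangian n} (hlam : lam ∈ LambdaIrr ℓ n)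
    {a : CxOp n} (h : ∀ s, toReal a * reflOp (lam s) = reflOp (lam s) * toReal a) :
    ∃ z : ℂ, a = z • 1 := by
  refine HomU.Irr.trivialCommutant hlam a fun s => toReal_injective ?_
  rw [toReal_mul, toReal_mul, toReal_coords_phiTilde, ← mul_assoc, h, mul_assoc, h, mul_assoc]

theorem scalarOp_injective [NeZero n] : Function.Injective (scalarOp : ℂ → RealOp n) := by
  intro z w h
  have := DFunLike.congr_fun h (unitVec n)
  rw [scalarOp_apply, scalarOp_apply] at this
  rw [← inner_unitVec (n := n) z, this, inner_unitVec]

theorem neg_one_smul_eq (lam : Fin ℓ → Lagrangian n) : (-1 : U n) • lam = lam := by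
  funext s
  apply reflOp_injective
  rw [Pi.smul_apply, reflOp_smul]
  ext1 v
  change -(reflOp (lam s) ((star (-1 : CxOp n)) v)) = _
  rw [CxOp.star_neg, star_one]
  change -(reflOp (lam s) (-v)) = _
  rw [map_neg, neg_neg]

/-- A stabilizing g commutes with all reflections, so it is a scalar z by Schur. Commuting with one
anti-linear reflection makes z real, and unitarity leaves z = ±1. -/
theorem smul_eq_self_iff [NeZero ℓ] [NeZero n] {lam : Fin ℓ → Lagrangian n}
    (hlam : lam ∈ LambdaIrr ℓ n) (g : U n) : g • lam = lam ↔ g = 1 ∨ g = -1 := by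
  constructor
  · intro h
    have h1 : ∀ s, toReal (g : CxOp n) * reflOp (lam s) = reflOp (lam s) * toReal (g : CxOp n) := by
      intro s
      have h2 := congrArg reflOp (congrFun h s)
      rw [Pi.smul_apply, reflOp_smul] at h2
      conv_rhs => rw [← h2]
      rw [mul_assoc, toReal_star_mul_unitary, mul_one]
    obtain ⟨z, hz⟩ := exists_scalar_of_commute hlam h1
    have h3 : starRingEnd ℂ z = z := by
      have h2 := h1 0
      rw [hz] at h2
      have h4 := (isReflection_reflOp (lam 0)).mul_scalarOp z
      have h5 : scalarOp z * reflOp (lam 0) = reflOp (lam 0) * scalarOp z := h2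
      rw [← h5] at h4
      have h6 := congrArg (fun x => x * reflOp (lam 0)) h4
      simp only [mul_assoc, reflOp_mul_reflOp, mul_one] at h6
      exact (scalarOp_injective h6).symm
    have h4 : z * z = 1 := by
      have h5 := toReal_star_mul_unitary g
      rw [hz] at h5
      have h6 : scalarOp (starRingEnd ℂ z) * scalarOp z = (1 : RealOp n) := by
        rw [← star_scalarOp, scalarOp, ← toReal_star]
        exact h5
      rw [h3, ← scalarOp_mul, ← scalarOp_one] at h6
      exact scalarOp_injective h6
    rcases mul_self_eq_one_iff.1 h4 with h5 | h5
    · left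
      apply Subtype.ext
      rw [hz, h5, one_smul]
      rfl
    · right
      apply Subtype.ext
      rw [hz, h5]
      exact neg_one_smul ℂ (1 : CxOp n)
  · rintro (rfl | rfl)
    · exact one_smul _ _
    · exact neg_one_smul_eq lam

/-- The unitary operator connecting two points of a fibre centralizes the representation, so it is a
scalar w, and it acts on the reflections as w². -/
theorem exists_circle_smul_eq [NeZero ℓ] [NeZero n] {lam lam' : Fin ℓ → Lagrangian n}
    (hlam : lam ∈ LambdaIrr ℓ n) (h : phiTilde lam = phiTilde lam') :
    ∃ z : Circle, z • lam = lam' := by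
  obtain ⟨g, rfl, -, -⟩ := exists_smul_eq_of_phiTilde_eq h
  rw [phiTilde_smul] at h
  have h1 : ∀ s, (g : CxOp n) * (phiTilde lam).coords s = (phiTilde lam).coords s * g := by
    intro s
    have h2 := congrFun (congrArg HomU.coords h) s
    rw [coords_smul] at h2
    conv_rhs => rw [h2]
    rw [mul_assoc, (Unitary.mem_iff.1 g.2).1, mul_one]
  obtain ⟨z, hz⟩ := HomU.Irr.trivialCommutant hlam _ h1
  have hz1 : ‖z‖ = 1 := by
    have h2 := Unitary.norm_map g (unitVec n)
    rw [hz] at h2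
    have h3 : ‖z • unitVec n‖ = ‖unitVec n‖ := h2
    have h4 : ‖unitVec n‖ = 1 := by simp [unitVec]
    rwa [norm_smul, h4, mul_one] at h3
  let w : Circle := ⟨z, mem_sphere_zero_iff_norm.2 hz1⟩
  have hg : g = scalarUnitary w := Subtype.ext hz
  refine ⟨w * w, funext fun s => ?_⟩
  rw [hg, Pi.smul_apply, Pi.smul_apply, scalarUnitary_smul]

end Irreducible

end LagrangianRep

namespace LagrangianRep

open Filter Topology SmoothSpace Lagrangian

/-! ### The Cayley transform -/

section Cayley

variable {A : Type*} [NormedRing A]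

/-- The Cayley transform `(1 + w) (1 - w)⁻¹`. -/
def cayley (w : A) : A := (1 + w) * Ring.inverse (1 - w)

/-- The inverse `(u - 1) (u + 1)⁻¹` of the Cayley transform. -/
def cayleyInv (u : A) : A := (u - 1) * Ring.inverse (u + 1)

theorem cayley_mul {w : A} (h : IsUnit (1 - w)) : cayley w * (1 - w) = 1 + w := by
  rw [cayley, mul_assoc, Ring.inverse_mul_cancel _ h, mul_one]

theorem cayleyInv_mul {u : A} (h : IsUnit (u + 1)) : cayleyInv u * (u + 1) = u - 1 := by
  rw [cayleyInv, mul_assoc, Ring.inverse_mul_cancel _ h, mul_one]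

@[simp] theorem cayley_zero : cayley (0 : A) = 1 := by simp [cayley]

@[simp] theorem cayleyInv_one : cayleyInv (1 : A) = 0 := by simp [cayleyInv]

section Star

variable [StarRing A]

/-- Taking adjoints exchanges 1 + w and 1 − w. These commute, so the adjoint of (1 + w)(1 − w)⁻¹ is
its inverse. -/
theorem cayley_mem_unitary {w : A} (hw : star w = -w) (h : IsUnit (1 - w)) :
    cayley w ∈ unitary A := by
  have h' : IsUnit (1 + w) := by
    have := h.star
    rwa [star_sub, star_one, hw, sub_neg_eq_add] at this
  have hcm := cayley_mul h
  have hst : (1 + w) * star (cayley w) = 1 - w := by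
    have := congrArg star hcm
    rw [star_mul, star_sub, star_add, star_one, hw, sub_neg_eq_add, ← sub_eq_add_neg] at this
    exact this
  have hcomm : (1 - w) * (1 + w) = (1 + w) * (1 - w) := by noncomm_ring
  rw [Unitary.mem_iff]
  constructor
  · apply h.mul_right_cancel
    apply h'.mul_left_cancel
    calc (1 + w) * (star (cayley w) * cayley w * (1 - w))
        = (1 + w) * star (cayley w) * (cayley w * (1 - w)) := by noncomm_ring
      _ = (1 + w) * (1 * (1 - w)) := by rw [hst, hcm, hcomm, one_mul]
  · have h1 : cayley w * (1 + w) = (1 + w) * cayley w := by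
      apply h.mul_right_cancel
      rw [mul_assoc, ← hcomm, ← mul_assoc, hcm, mul_assoc, hcm]
    apply h'.mul_left_cancel
    rw [← mul_assoc, ← h1, mul_assoc, hst, hcm, mul_one]

theorem star_cayleyInv {u : A} (hu : u ∈ unitary A) (h : IsUnit (u + 1)) :
    star (cayleyInv u) = -cayleyInv u := by
  obtain ⟨hu1, hu2⟩ := Unitary.mem_iff.1 hu
  have hm := cayleyInv_mul h
  have h1 : (star u + 1) * star (cayleyInv u) = star u - 1 := by
    have := congrArg star hm
    rwa [star_mul, star_sub, star_add, star_one] at this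
  have h2 : (u + 1) * star (cayleyInv u) = 1 - u := by
    have := congrArg (fun x => u * x) h1
    rw [← mul_assoc, mul_add, mul_sub, hu2, mul_one, add_comm] at this
    exact this
  have h3 : (u + 1) * cayleyInv u = u - 1 := by
    apply h.mul_right_cancel
    rw [mul_assoc, hm]
    noncomm_ring
  apply h.mul_left_cancel
  rw [h2, mul_neg, h3, neg_sub]

end Star

variable [NormedAlgebra ℝ A]

theorem isUnit_two_smul_inverse {x : A} (h : IsUnit x) : IsUnit ((2 : ℝ) • Ring.inverse x) :=
  (isUnit_ringInverse.2 h).smul (Units.mk0 (2 : ℝ) two_ne_zero)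

/-- The right side is invertible, which puts the image of `cayley` into the domain where `cayleyInv`
inverts it. -/
theorem cayley_add_one {w : A} (h : IsUnit (1 - w)) :
    cayley w + 1 = (2 : ℝ) • Ring.inverse (1 - w) := by
  apply h.mul_right_cancel
  rw [add_mul, one_mul, cayley_mul h, smul_mul_assoc, Ring.inverse_mul_cancel _ h, two_smul]
  abel

theorem isUnit_cayley_add_one {w : A} (h : IsUnit (1 - w)) : IsUnit (cayley w + 1) := by
  rw [cayley_add_one h]
  exact isUnit_two_smul_inverse h

theorem one_sub_cayleyInv {u : A} (h : IsUnit (u + 1)) :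
    1 - cayleyInv u = (2 : ℝ) • Ring.inverse (u + 1) := by
  apply h.mul_right_cancel
  rw [sub_mul, one_mul, cayleyInv_mul h, smul_mul_assoc, Ring.inverse_mul_cancel _ h, two_smul]
  abel

theorem isUnit_one_sub_cayleyInv {u : A} (h : IsUnit (u + 1)) : IsUnit (1 - cayleyInv u) := by
  rw [one_sub_cayleyInv h]
  exact isUnit_two_smul_inverse h

theorem cayleyInv_cayley {w : A} (h : IsUnit (1 - w)) : cayleyInv (cayley w) = w := by
  have h1 := isUnit_cayley_add_one h
  apply h1.mul_right_cancel
  rw [cayleyInv_mul h1]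
  apply h.mul_right_cancel
  have h2 := cayley_mul h
  have h3 : (cayley w - 1) * (1 - w) = 1 + w - (1 - w) := by rw [sub_mul, h2, one_mul]
  have h4 : w * (cayley w + 1) * (1 - w) = w * (1 + w + (1 - w)) := by
    rw [mul_assoc, add_mul, h2, one_mul]
  rw [h3, h4]
  noncomm_ring

theorem cayley_cayleyInv {u : A} (h : IsUnit (u + 1)) : cayley (cayleyInv u) = u := by
  have h1 := isUnit_one_sub_cayleyInv h
  apply h1.mul_right_cancel
  rw [cayley_mul h1]
  apply h.mul_right_cancel
  have h2 := cayleyInv_mul h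
  have h3 : (1 + cayleyInv u) * (u + 1) = u + 1 + (u - 1) := by rw [add_mul, h2, one_mul]
  have h4 : u * (1 - cayleyInv u) * (u + 1) = u * (u + 1 - (u - 1)) := by
    rw [mul_assoc, sub_mul, h2, one_mul]
  rw [h3, h4]
  noncomm_ring

theorem contDiffAt_inverse [CompleteSpace A] {x : A} (h : IsUnit x) :
    ContDiffAt ℝ ω Ring.inverse x := by
  obtain ⟨v, rfl⟩ := h
  exact contDiffAt_ringInverse ℝ v

theorem contDiffAt_cayley [CompleteSpace A] {w : A} (h : IsUnit (1 - w)) :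
    ContDiffAt ℝ ω cayley w := by
  refine ContDiffAt.mul (contDiffAt_const.add contDiffAt_id) ?_
  exact ContDiffAt.comp (g := Ring.inverse) (f := fun w => 1 - w) w (contDiffAt_inverse h)
    (contDiffAt_const.sub contDiffAt_id)

theorem contDiffAt_cayleyInv [CompleteSpace A] {u : A} (h : IsUnit (u + 1)) :
    ContDiffAt ℝ ω cayleyInv u := by
  refine ContDiffAt.mul (contDiffAt_id.sub contDiffAt_const) ?_
  exact ContDiffAt.comp (g := Ring.inverse) (f := fun u => u + 1) u (contDiffAt_inverse h)
    (contDiffAt_id.add contDiffAt_const)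

/-- Near 0 the transform equals 2(1 − w)⁻¹ − 1, and inversion has derivative −1 at the identity. -/
theorem hasFDerivAt_cayley_zero [CompleteSpace A] :
    HasFDerivAt (cayley : A → A) ((2 : ℝ) • ContinuousLinearMap.id ℝ A) 0 := by
  have hev : ∀ᶠ w : A in 𝓝 0, cayley w = (2 : ℝ) • Ring.inverse (1 - w) - 1 := by
    have h1 : ContinuousAt (fun w : A => 1 - w) 0 := by fun_prop
    have h2 : {x : A | IsUnit x} ∈ 𝓝 (1 - (0 : A)) := by
      rw [sub_zero]
      exact Units.isOpen.mem_nhds isUnit_one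
    filter_upwards [h1.eventually h2] with w hw
    rw [← cayley_add_one hw, add_sub_cancel_right]
  have hi : HasFDerivAt (Ring.inverse : A → A)
      (-ContinuousLinearMap.mulLeftRight ℝ A 1 1) ((fun w : A => 1 - w) 0) := by
    have := hasFDerivAt_ringInverse (𝕜 := ℝ) (1 : Aˣ)
    simpa using this
  have h3 : HasFDerivAt (fun w : A => 1 - w) (-ContinuousLinearMap.id ℝ A) 0 :=
    (hasFDerivAt_id (0 : A)).const_sub 1
  have h4 := ((HasFDerivAt.comp (0 : A) hi h3).const_smul (2 : ℝ)).sub_const 1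
  refine (h4.congr_of_eventuallyEq hev).congr_fderiv ?_
  ext w
  simp

end Cayley

/-! ### Skew-adjoint operators -/

section Skew

variable {n : ℕ}

/-- The skew-adjoint operators. -/
def skewOp (n : ℕ) : Submodule ℝ (CxOp n) where
  carrier := {w | star w = -w}
  add_mem' {a b} ha hb := by
    change star (a + b) = -(a + b)
    rw [CxOp.star_add, neg_add]
    exact congrArg₂ (· + ·) ha hb
  zero_mem' := by
    change star (0 : CxOp n) = -0
    rw [CxOp.star_zero, neg_zero]
  smul_mem' r a ha := by
    change star (((r : ℂ)) • a) = -(((r : ℂ)) • a)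
    have ha' : star a = -a := ha
    rw [star_smul, ha', smul_neg]
    congr 2
    exact Complex.conj_ofReal r

theorem mem_skewOp {w : CxOp n} : w ∈ skewOp n ↔ star w = -w := Iff.rfl

theorem re_inner_skew {w : CxOp n} (hw : star w = -w) (v : Cn n) : (inner ℂ v (w v)).re = 0 := by
  have h1 : inner ℂ (w v) v = inner ℂ v ((star w) v) := by
    rw [ContinuousLinearMap.star_eq_adjoint, ContinuousLinearMap.adjoint_inner_right]
  rw [hw] at h1
  have h2 : inner ℂ v ((-w) v) = -inner ℂ v (w v) := inner_neg_right _ _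
  rw [h2] at h1
  have h3 := congrArg Complex.re h1
  rw [Complex.neg_re, ← inner_conj_symm, Complex.conj_re] at h3
  linarith

theorem isUnit_of_injective {a : CxOp n} (h : Function.Injective a) : IsUnit a := by
  rw [ContinuousLinearMap.isUnit_iff_bijective]
  exact ⟨h, (LinearMap.injective_iff_surjective (f := (a : Cn n →ₗ[ℂ] Cn n))).1 h⟩

/-- If v = w v, then ‖v‖² = Re ⟨v, w v⟩ = 0. Hence the Cayley transform is defined on all
skew-adjoint operators. -/
theorem isUnit_one_sub_skew {w : CxOp n} (hw : star w = -w) : IsUnit (1 - w) := by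
  apply isUnit_of_injective
  rw [injective_iff_map_eq_zero]
  intro v hv
  have h1 : v = w v := sub_eq_zero.1 hv
  have h2 := re_inner_skew hw v
  rw [← h1] at h2
  have h3 : inner ℝ v v = (0 : ℝ) := by rw [re_inner_eq, h2]
  exact inner_self_eq_zero.1 h3

theorem finrank_cxOp : Module.finrank ℝ (CxOp n) = 2 * n ^ 2 := by
  have h1 : Module.finrank ℂ (CxOp n) = n ^ 2 := by
    rw [← (LinearMap.toContinuousLinearMap (𝕜 := ℂ) (E := Cn n) (F' := Cn n)).finrank_eq,
      Module.finrank_linearMap, finrank_euclideanSpace, Fintype.card_fin, sq]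
  rw [← h1]
  exact finrank_real_of_complex (CxOp n)

instance : Module.Free ℝ (skewOp n) := Module.Free.of_divisionRing ℝ (skewOp n)

/-- Every operator is uniquely a + i b with a and b skew-adjoint, so the skew-adjoint ones have half
the real dimension 2n². -/
theorem finrank_skewOp : Module.finrank ℝ (skewOp n) = n ^ 2 := by
  let T : (skewOp n × skewOp n) →ₗ[ℝ] CxOp n :=
    { toFun := fun q => (q.1 : CxOp n) + Complex.I • (q.2 : CxOp n)
      map_add' := fun p q => by
        change ((p.1 : CxOp n) + q.1) + Complex.I • ((p.2 : CxOp n) + q.2) = _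
        rw [smul_add]
        abel
      map_smul' := fun r q => by
        change (r • (q.1 : CxOp n)) + Complex.I • (r • (q.2 : CxOp n)) =
          r • ((q.1 : CxOp n) + Complex.I • (q.2 : CxOp n))
        rw [smul_add, smul_comm] }
  have hTs : ∀ q, star (T q) = -(q.1 : CxOp n) + Complex.I • (q.2 : CxOp n) := fun q => by
    have h1 : star (q.1 : CxOp n) = -(q.1 : CxOp n) := q.1.2
    have h2 : star (q.2 : CxOp n) = -(q.2 : CxOp n) := q.2.2
    change star ((q.1 : CxOp n) + Complex.I • (q.2 : CxOp n)) = _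
    rw [CxOp.star_add, star_smul, h1, h2, smul_neg]
    congr 1
    rw [← neg_smul]
    congr 1
    simp
  have hinj : Function.Injective T := by
    rw [injective_iff_map_eq_zero]
    intro q hq
    have h1 := hTs q
    rw [hq, CxOp.star_zero] at h1
    have h2 : (q.1 : CxOp n) + Complex.I • (q.2 : CxOp n) = 0 := hq
    have h3 : (2 : ℝ) • (q.1 : CxOp n) = 0 := by
      calc (2 : ℝ) • (q.1 : CxOp n) = ((q.1 : CxOp n) + Complex.I • (q.2 : CxOp n)) -
            (-(q.1 : CxOp n) + Complex.I • (q.2 : CxOp n)) := by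
              rw [show (2 : ℝ) • (q.1 : CxOp n) = q.1 + q.1 from two_smul ℝ (q.1 : CxOp n)]
              abel
        _ = 0 := by rw [h2, ← h1, sub_zero]
    have h4 : (q.1 : CxOp n) = 0 := (smul_eq_zero.1 h3).resolve_left two_ne_zero
    rw [h4, zero_add] at h2
    have h5 : (q.2 : CxOp n) = 0 := (smul_eq_zero.1 h2).resolve_left Complex.I_ne_zero
    exact Prod.ext (Subtype.ext h4) (Subtype.ext h5)
  have hsurj : Function.Surjective T := by
    intro a
    have hss : star (star a) = a := star_star a
    have ha : (2⁻¹ : ℝ) • (a - star a) ∈ skewOp n := by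
      refine (skewOp n).smul_mem _ ?_
      rw [mem_skewOp, sub_eq_add_neg, CxOp.star_add, CxOp.star_neg, hss]
      abel
    have hb : (2⁻¹ : ℝ) • (-(Complex.I • (a + star a))) ∈ skewOp n := by
      refine (skewOp n).smul_mem _ ((skewOp n).neg_mem ?_)
      rw [mem_skewOp, star_smul, CxOp.star_add, hss, add_comm]
      refine Eq.trans ?_ (neg_smul Complex.I (a + star a))
      congr 1
      simp
    refine ⟨(⟨_, ha⟩, ⟨_, hb⟩), ?_⟩
    change (2⁻¹ : ℝ) • (a - star a) + Complex.I • ((2⁻¹ : ℝ) • (-(Complex.I • (a + star a)))) = a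
    have h1 : Complex.I • ((2⁻¹ : ℝ) • (-(Complex.I • (a + star a)))) =
        (2⁻¹ : ℝ) • (a + star a) := by
      rw [smul_comm Complex.I, smul_neg, smul_smul, Complex.I_mul_I]
      congr 1
      exact (congrArg Neg.neg (neg_one_smul ℂ (a + star a))).trans (neg_neg _)
    have h2 : a - star a + (a + star a) = (2 : ℝ) • a := by
      rw [show (2 : ℝ) • a = a + a from two_smul ℝ a]
      abel
    calc _ = (2⁻¹ : ℝ) • (a - star a) + (2⁻¹ : ℝ) • (a + star a) := by rw [h1]
      _ = (2⁻¹ : ℝ) • (a - star a + (a + star a)) := (smul_add (2⁻¹ : ℝ) _ _).symm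
      _ = a := by rw [h2, smul_smul, inv_mul_cancel₀ two_ne_zero, one_smul]
  have h1 := (LinearEquiv.ofBijective T ⟨hinj, hsurj⟩).finrank_eq
  rw [Module.finrank_prod, finrank_cxOp] at h1
  omega

end Skew

/-! ### The tangent space of Λ(n) and its dimension -/

section Tangent

variable {n : ℕ}

/-- The skew-adjoint operators that anti-commute with the involution of `L`, a model of the
tangent space of `Λ(n)` at `L`. -/
def lagTangent (L : Lagrangian n) : Submodule ℝ (CxOp n) where
  carrier := {w | star w = -w ∧ toReal w * reflOp L = -(reflOp L * toReal w)}
  add_mem' {a b} ha hb := by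
    refine ⟨(skewOp n).add_mem ha.1 hb.1, ?_⟩
    rw [map_add, add_mul, mul_add, ha.2, hb.2, neg_add]
  zero_mem' := by
    refine ⟨(skewOp n).zero_mem, ?_⟩
    rw [map_zero, zero_mul, mul_zero, neg_zero]
  smul_mem' r a ha := by
    refine ⟨(skewOp n).smul_mem r ha.1, ?_⟩
    rw [map_smul, smul_mul_assoc, ha.2, mul_smul_comm, smul_neg]

/-- A real orthonormal basis of L is orthonormal over ℂ because imaginary parts of inner products
vanish on L, and it spans because L^⊥ = iL. -/
theorem exists_basis (L : Lagrangian n) :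
    ∃ b : OrthonormalBasis (Fin n) ℂ (Cn n), ∀ i, b i ∈ L.space := by
  let c := stdOrthonormalBasis ℝ L.space
  have hon : Orthonormal ℂ (fun i => (c i : Cn n)) := by
    rw [orthonormal_iff_ite]
    intro i j
    have h1 := orthonormal_iff_ite.1 c.orthonormal i j
    rw [Submodule.coe_inner, re_inner_eq] at h1
    apply Complex.ext
    · rw [h1]; split_ifs <;> simp
    · rw [(L.isLagrangian _).1 (c i).2 _ (c j).2]; split_ifs <;> simp
  have hL : ∀ x ∈ L.space, x ∈ Submodule.span ℂ (Set.range fun i => (c i : Cn n)) := by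
    intro x hx
    have h1 := c.sum_repr ⟨x, hx⟩
    have h2 := congrArg (Subtype.val) h1
    rw [← show _ = x from h2]
    simp only [Submodule.coe_sum, Submodule.coe_smul]
    refine Submodule.sum_mem _ fun i _ => ?_
    exact Submodule.smul_of_tower_mem _ _ (Submodule.subset_span ⟨i, rfl⟩)
  have hsp : ⊤ ≤ Submodule.span ℂ (Set.range fun i => (c i : Cn n)) := by
    intro x _
    obtain ⟨y, hy, z, hz, rfl⟩ := L.exists_decomp x
    refine Submodule.add_mem _ (hL y hy) ?_
    have h1 := hL _ ((L.mem_orthogonal_iff z).1 hz)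
    exact (Submodule.smul_mem_iff _ Complex.I_ne_zero).1 h1
  let b := OrthonormalBasis.mk hon hsp
  have hcard : Module.finrank ℝ L.space = n := by
    have h1 := Module.finrank_eq_card_basis b.toBasis
    rwa [finrank_euclideanSpace, Fintype.card_fin, Fintype.card_fin, eq_comm] at h1
  refine ⟨b.reindex (finCongr hcard), fun i => ?_⟩
  rw [OrthonormalBasis.reindex_apply, OrthonormalBasis.coe_mk]
  exact (c _).2

/-- The operator `i S`, where `S` has the matrix `f` in the basis `b`. -/
def symmOp (b : OrthonormalBasis (Fin n) ℂ (Cn n)) (f : Sym2 (Fin n) → ℝ) : CxOp n :=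
  LinearMap.toContinuousLinearMap
    (b.toBasis.constr ℂ fun j => ∑ i, (Complex.I * (f s(i, j) : ℂ)) • b i)

theorem symmOp_apply (b : OrthonormalBasis (Fin n) ℂ (Cn n)) (f : Sym2 (Fin n) → ℝ) (j : Fin n) :
    symmOp b f (b j) = ∑ i, (Complex.I * (f s(i, j) : ℂ)) • b i := by
  change (b.toBasis.constr ℂ fun j => ∑ i, (Complex.I * (f s(i, j) : ℂ)) • b i) (b j) = _
  have h := b.toBasis.constr_basis ℂ (fun j => ∑ i, (Complex.I * (f s(i, j) : ℂ)) • b i) j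
  rwa [b.coe_toBasis] at h

theorem cxOp_ext (b : OrthonormalBasis (Fin n) ℂ (Cn n)) {a a' : CxOp n}
    (h : ∀ j, a (b j) = a' (b j)) : a = a' := by
  have h1 : (a : Cn n →ₗ[ℂ] Cn n) = a' := b.toBasis.ext fun j => by
    rw [b.coe_toBasis]
    exact h j
  ext1 v
  exact DFunLike.congr_fun h1 v

theorem inner_symmOp (b : OrthonormalBasis (Fin n) ℂ (Cn n)) (f : Sym2 (Fin n) → ℝ)
    (i j : Fin n) : inner ℂ (b i) (symmOp b f (b j)) = Complex.I * (f s(i, j) : ℂ) := by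
  rw [symmOp_apply, b.orthonormal.inner_right_fintype]

theorem cxOp_ext_inner (b : OrthonormalBasis (Fin n) ℂ (Cn n)) {a a' : CxOp n}
    (h : ∀ i j, inner ℂ (b i) (a (b j)) = inner ℂ (b i) (a' (b j))) : a = a' := by
  refine cxOp_ext b fun j => ?_
  rw [← b.sum_repr' (a (b j)), ← b.sum_repr' (a' (b j))]
  exact Finset.sum_congr rfl fun i _ => by rw [h]

/-- For a real symmetric S the operator iS is skew-adjoint. The reflection fixes the basis vectors
and conjugates coefficients, so it carries iS to −iS. -/
theorem symmOp_mem_lagTangent {L : Lagrangian n} {b : OrthonormalBasis (Fin n) ℂ (Cn n)}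
    (hb : ∀ i, b i ∈ L.space) (f : Sym2 (Fin n) → ℝ) : symmOp b f ∈ lagTangent L := by
  have hbL : ∀ i, reflOp L (b i) = b i := fun i => (mem_space_iff L _).1 (hb i)
  constructor
  · refine cxOp_ext_inner b fun i j => ?_
    rw [ContinuousLinearMap.star_eq_adjoint, ContinuousLinearMap.adjoint_inner_right,
      ← inner_conj_symm, inner_symmOp]
    have h1 : inner ℂ (b i) ((-symmOp b f) (b j)) = -inner ℂ (b i) (symmOp b f (b j)) :=
      inner_neg_right _ _
    rw [h1, inner_symmOp, Sym2.eq_swap]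
    simp
  · have hr := isReflection_reflOp L
    have hlin : (reflOp L * toReal (symmOp b f) * reflOp L) * scalarOp Complex.I =
        scalarOp Complex.I * (reflOp L * toReal (symmOp b f) * reflOp L) := by
      rw [mul_assoc, hr.mul_scalarOp, mul_assoc, ← mul_assoc (toReal _), ← scalarOp_mul_toReal,
        mul_assoc, ← mul_assoc, hr.mul_scalarOp, Complex.conj_conj, mul_assoc, mul_assoc]
    obtain ⟨a, ha⟩ := exists_toReal_eq hlin
    have h1 : a = -symmOp b f := by
      refine cxOp_ext b fun j => ?_
      have h2 : a (b j) = reflOp L (symmOp b f (reflOp L (b j))) := DFunLike.congr_fun ha (b j)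
      rw [h2, hbL, symmOp_apply, map_sum]
      change _ = -(symmOp b f (b j))
      rw [symmOp_apply, ← Finset.sum_neg_distrib]
      refine Finset.sum_congr rfl fun i _ => ?_
      have h3 := DFunLike.congr_fun (hr.mul_scalarOp (Complex.I * (f s(i, j) : ℂ))) (b i)
      refine h3.trans ?_
      change (starRingEnd ℂ (Complex.I * (f s(i, j) : ℂ))) • reflOp L (b i) = _
      rw [hbL, ← neg_smul]
      congr 1
      simp
    rw [h1, map_neg] at ha
    calc toReal (symmOp b f) * reflOp L
        = reflOp L * (reflOp L * toReal (symmOp b f) * reflOp L) := by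
          rw [mul_assoc (reflOp L), ← mul_assoc (reflOp L) (reflOp L), reflOp_mul_reflOp, one_mul]
      _ = _ := by rw [← ha, RealOp.mul_neg]

/-- Anti-commuting with the reflection makes the matrix entries purely imaginary in a basis of L;
skew-adjointness then makes their imaginary parts symmetric. -/
theorem exists_symmOp_eq {L : Lagrangian n} {b : OrthonormalBasis (Fin n) ℂ (Cn n)}
    (hb : ∀ i, b i ∈ L.space) {w : CxOp n} (hw : w ∈ lagTangent L) : ∃ f, symmOp b f = w := by
  have hbL : ∀ i, reflOp L (b i) = b i := fun i => (mem_space_iff L _).1 (hb i)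
  have hre : ∀ i j, (inner ℂ (b i) (w (b j))).re = 0 := fun i j => by
    have h1 : Complex.I • w (b j) ∈ L.space := by
      rw [mem_space_iff]
      have h2 : w (reflOp L (b j)) = -(reflOp L (w (b j))) := DFunLike.congr_fun hw.2 (b j)
      rw [reflOp_apply, σ_I_smul, ← reflOp_apply, ← smul_neg, ← h2, hbL]
    have h3 := (L.isLagrangian (b i)).1 (hb i) _ h1
    rw [inner_smul_right] at h3
    simpa using h3
  have hsymm : ∀ i j, (inner ℂ (b i) (w (b j))).im = (inner ℂ (b j) (w (b i))).im := fun i j => by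
    have h1 : inner ℂ (w (b i)) (b j) = inner ℂ (b i) ((star w) (b j)) := by
      rw [ContinuousLinearMap.star_eq_adjoint, ContinuousLinearMap.adjoint_inner_right]
    rw [hw.1] at h1
    have h2 : inner ℂ (b i) ((-w) (b j)) = -inner ℂ (b i) (w (b j)) := inner_neg_right _ _
    rw [h2, ← inner_conj_symm] at h1
    have h3 := congrArg Complex.im h1
    rw [Complex.conj_im, Complex.neg_im] at h3
    linarith
  refine ⟨Sym2.lift ⟨fun i j => (inner ℂ (b i) (w (b j))).im, hsymm⟩, ?_⟩
  refine cxOp_ext_inner b fun i j => ?_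
  rw [inner_symmOp, Sym2.lift_mk]
  apply Complex.ext
  · simp [hre]
  · simp

/-- Real symmetric matrices are functions on unordered pairs of indices, which are counted by the
binomial coefficient. -/
theorem finrank_lagTangent (L : Lagrangian n) :
    Module.finrank ℝ (lagTangent L) = (n + 1).choose 2 := by
  obtain ⟨b, hb⟩ := exists_basis L
  let T : (Sym2 (Fin n) → ℝ) →ₗ[ℝ] lagTangent L :=
    { toFun := fun f => ⟨symmOp b f, symmOp_mem_lagTangent hb f⟩
      map_add' := fun f g => Subtype.ext <| cxOp_ext_inner b fun i j => by
        change inner ℂ (b i) (symmOp b (f + g) (b j)) =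
          inner ℂ (b i) (symmOp b f (b j) + symmOp b g (b j))
        rw [inner_add_right, inner_symmOp, inner_symmOp, inner_symmOp, Pi.add_apply]
        push_cast
        ring
      map_smul' := fun r f => Subtype.ext <| cxOp_ext_inner b fun i j => by
        change inner ℂ (b i) (symmOp b (r • f) (b j)) = inner ℂ (b i) ((r : ℂ) • symmOp b f (b j))
        rw [inner_smul_right, inner_symmOp, inner_symmOp, Pi.smul_apply, smul_eq_mul]
        push_cast
        ring }
  have hbij : Function.Bijective T := by
    constructor
    · intro f g hfg
      funext x
      induction x using Sym2.ind with
      | _ i j =>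
        have h1 : symmOp b f = symmOp b g := congrArg Subtype.val hfg
        have h2 := inner_symmOp b f i j
        rw [h1, inner_symmOp] at h2
        have h3 := mul_left_cancel₀ Complex.I_ne_zero h2
        exact_mod_cast h3.symm
    · intro w
      obtain ⟨f, hf⟩ := exists_symmOp_eq hb w.2
      exact ⟨f, Subtype.ext hf⟩
  rw [← (LinearEquiv.ofBijective T hbij).finrank_eq, Module.finrank_fintype_fun_eq_card, Sym2.card,
    Fintype.card_fin]

end Tangent

/-! ### Linear coordinates on spaces of operators -/

section Parameters

variable {n : ℕ}

/-- Linear coordinates on a real subspace of operators. -/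
theorem exists_param {k : ℕ} (S : Submodule ℝ (CxOp n)) (hS : Module.finrank ℝ S = k) :
    ∃ (ι : (Fin k → ℝ) →L[ℝ] CxOp n) (π : CxOp n →L[ℝ] (Fin k → ℝ)),
      (∀ w, π (ι w) = w) ∧ ∀ a, a ∈ S ↔ ∃ w, ι w = a := by
  have : Module.Free ℝ S := Module.Free.of_divisionRing ℝ S
  have : Module.Finite ℝ S := FiniteDimensional.finiteDimensional_submodule S
  let E : (Fin k → ℝ) ≃ₗ[ℝ] S := LinearEquiv.ofFinrankEq _ _ (by
    rw [Module.finrank_fintype_fun_eq_card, Fintype.card_fin, hS])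
  let f : (Fin k → ℝ) →ₗ[ℝ] CxOp n := S.subtype ∘ₗ E.toLinearMap
  have hf : Function.Injective f := S.injective_subtype.comp E.injective
  obtain ⟨g, hg⟩ := LinearMap.exists_leftInverse_of_injective f (LinearMap.ker_eq_bot.2 hf)
  refine ⟨LinearMap.toContinuousLinearMap f, LinearMap.toContinuousLinearMap g,
    fun w => DFunLike.congr_fun hg w, fun a => ⟨fun ha => ?_, ?_⟩⟩
  · refine ⟨E.symm ⟨a, ha⟩, ?_⟩
    change ((E (E.symm ⟨a, ha⟩) : S) : CxOp n) = a
    rw [E.apply_symm_apply]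
  · rintro ⟨w, rfl⟩
    exact (E w).2

variable (n) in
/-- Coordinates on the skew-adjoint operators. -/
def skewParam : (Fin (n ^ 2) → ℝ) →L[ℝ] CxOp n := (exists_param (skewOp n) finrank_skewOp).choose

variable (n) in
/-- A left inverse of `skewParam`. -/
def skewProj : CxOp n →L[ℝ] (Fin (n ^ 2) → ℝ) :=
  (exists_param (skewOp n) finrank_skewOp).choose_spec.choose

theorem skewProj_skewParam (w : Fin (n ^ 2) → ℝ) : skewProj n (skewParam n w) = w :=
  (exists_param (skewOp n) finrank_skewOp).choose_spec.choose_spec.1 w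

theorem star_eq_neg_iff {a : CxOp n} : star a = -a ↔ ∃ w, skewParam n w = a :=
  (exists_param (skewOp n) finrank_skewOp).choose_spec.choose_spec.2 a

theorem star_skewParam (w : Fin (n ^ 2) → ℝ) : star (skewParam n w) = -skewParam n w :=
  star_eq_neg_iff.2 ⟨w, rfl⟩

theorem skewParam_skewProj {a : CxOp n} (ha : star a = -a) : skewParam n (skewProj n a) = a := by
  obtain ⟨w, rfl⟩ := star_eq_neg_iff.1 ha
  rw [skewProj_skewParam]

/-- The Cayley transform as a map to the unitary group. -/
def cayleyU (w : Fin (n ^ 2) → ℝ) : U n :=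
  ⟨cayley (skewParam n w),
    cayley_mem_unitary (star_skewParam w) (isUnit_one_sub_skew (star_skewParam w))⟩

theorem coe_cayleyU (w : Fin (n ^ 2) → ℝ) : (cayleyU w : CxOp n) = cayley (skewParam n w) := rfl

/-- Coordinates on the tangent space of `Λ(n)` at `L`. -/
def tangentParam (L : Lagrangian n) : (Fin ((n + 1).choose 2) → ℝ) →L[ℝ] CxOp n :=
  (exists_param (lagTangent L) (finrank_lagTangent L)).choose

/-- A left inverse of `tangentParam`. -/
def tangentProj (L : Lagrangian n) : CxOp n →L[ℝ] (Fin ((n + 1).choose 2) → ℝ) :=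
  (exists_param (lagTangent L) (finrank_lagTangent L)).choose_spec.choose

theorem tangentProj_tangentParam (L : Lagrangian n) (w : Fin ((n + 1).choose 2) → ℝ) :
    tangentProj L (tangentParam L w) = w :=
  (exists_param (lagTangent L) (finrank_lagTangent L)).choose_spec.choose_spec.1 w

theorem mem_lagTangent_iff {L : Lagrangian n} {a : CxOp n} :
    a ∈ lagTangent L ↔ ∃ w, tangentParam L w = a :=
  (exists_param (lagTangent L) (finrank_lagTangent L)).choose_spec.choose_spec.2 a

theorem tangentParam_mem (L : Lagrangian n) (w : Fin ((n + 1).choose 2) → ℝ) :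
    tangentParam L w ∈ lagTangent L :=
  mem_lagTangent_iff.2 ⟨w, rfl⟩

theorem tangentParam_tangentProj {L : Lagrangian n} {a : CxOp n} (ha : a ∈ lagTangent L) :
    tangentParam L (tangentProj L a) = a := by
  obtain ⟨w, rfl⟩ := mem_lagTangent_iff.1 ha
  rw [tangentProj_tangentParam]

end Parameters

end LagrangianRep

/-! ### Charts on quotients by compact group actions -/

namespace SmoothSpace

open Filter Topology

/-- Charts of the quotient of a manifold by a compact group, in which a subgroup acts trivially and
whose other elements act freely. -/
theorem exists_quotient_chart {K X Y E W V : Type*} [Group K] [TopologicalSpace K] [CompactSpace K]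
    [TopologicalSpace X] [T2Space X] [SmoothSpace X] [MulAction K X] [ContinuousSMul K X]
    [TopologicalSpace Y] [SmoothSpace Y]
    [NormedAddCommGroup E] [NormedSpace ℝ E] [FiniteDimensional ℝ E]
    [NormedAddCommGroup W] [NormedSpace ℝ W] [FiniteDimensional ℝ W]
    [NormedAddCommGroup V] [NormedSpace ℝ V]
    {e : OpenPartialHomeomorph X E} (he : IsSmoothChart e) {x₀ : X} (hx₀ : x₀ ∈ e.source)
    (i : X → V) (κ : V → E) (hκ : ContDiffAt ℝ ω κ (i x₀)) (hκe : ∀ x ∈ e.source, κ (i x) = e x)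
    (hψ : ContDiffAt ℝ ω (i ∘ e.symm) (e x₀))
    (c : W → K) (hc0 : c 0 = 1) (hc : ContinuousAt c 0)
    (hstab : ∀ g : K, g • x₀ = x₀ → ∀ S ∈ 𝓝 (0 : W), ∀ᶠ h in 𝓝 g, ∃ w ∈ S, ∀ x : X,
      h • x = c w • x)
    (a : W × V → V) (ha : ContDiffAt ℝ ω a (0, i x₀)) (hac : ∀ w x, i (c w • x) = a (w, i x))
    (B : W →L[ℝ] V) (hB : HasFDerivAt (fun w => a (w, i x₀)) B 0)
    (hinj : Function.Injective B)
    {p : X → Y} (hpo : IsOpenMap p) (hpc : Continuous p)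
    (hp : ∀ (f : Y → ℝ) (x : X), SmoothAt f (p x) ↔ SmoothAt (f ∘ p) x)
    (hfib : ∀ x x', p x = p x' ↔ ∃ g : K, g • x = x') {d : ℕ}
    (hd : d + Module.finrank ℝ W = Module.finrank ℝ E) :
    ∃ e' : OpenPartialHomeomorph Y (EuclideanSpace ℝ (Fin d)),
      p x₀ ∈ e'.source ∧ IsSmoothChart e' := by
  have hea : e.symm (e x₀) = x₀ := e.left_inv hx₀
  have haT : e x₀ ∈ e.target := e.map_source hx₀
  -- Read in the chart, the action is `κ` composed with its analytic extension `a` to the ambient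
  -- space.
  have hΘ : ContDiffAt ℝ ω (fun q : W × E => e (c q.1 • e.symm q.2)) (0, e x₀) := by
    have h1 : ContDiffAt ℝ ω (fun q : W × E => a (q.1, i (e.symm q.2))) (0, e x₀) := by
      refine ContDiffAt.comp (g := a) (f := fun q : W × E => (q.1, i (e.symm q.2))) (0, e x₀) ?_ ?_
      · simpa [hea] using ha
      · exact contDiffAt_fst.prodMk
          (ContDiffAt.comp (g := i ∘ e.symm) (f := Prod.snd) (0, e x₀) hψ contDiffAt_snd)
    have h2 : ContDiffAt ℝ ω (fun q : W × E => κ (a (q.1, i (e.symm q.2)))) (0, e x₀) := by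
      refine ContDiffAt.comp (g := κ) (f := fun q : W × E => a (q.1, i (e.symm q.2))) (0, e x₀) ?_ h1
      have h3 : a (0, i x₀) = i x₀ := by rw [← hac, hc0, one_smul]
      simpa [hea, h3] using hκ
    refine h2.congr_of_eventuallyEq ?_
    have h4 : ContinuousAt (fun q : W × E => c q.1 • e.symm q.2) (0, e x₀) :=
      (ContinuousAt.comp (g := c) (f := Prod.fst) hc continuousAt_fst).smul
        (ContinuousAt.comp (g := e.symm) (f := Prod.snd) (e.continuousAt_symm haT) continuousAt_snd)
    have h5 : e.source ∈ 𝓝 (c (0 : W) • e.symm (e x₀)) := by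
      rw [hc0, one_smul, hea]
      exact e.open_source.mem_nhds hx₀
    filter_upwards [h4.eventually h5] with q hq
    rw [← hκe _ hq, hac]
  have hB' : HasFDerivAt (fun w => i (c w • x₀)) B 0 := by
    simpa only [hac] using hB
  obtain ⟨Z, r, hZ, hr, hr0, hrz, hrx, hrq⟩ := exists_slice e hx₀ c hc0 hc hstab hΘ i
    (hψ.differentiableAt (by simp)) B hB' hinj
  obtain ⟨e', he', hes⟩ := exists_isSmoothChart_of_slice hpo hpc hp he hx₀ Z.subtypeL r
    hr.nearSmooth hr0 hrz (by
      filter_upwards [hrx] with x hx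
      exact (hfib _ _).2 hx)
    (by
      filter_upwards [hrq] with q hq h
      exact hq ((hfib _ _).1 h))
  have hfin : Module.finrank ℝ Z = Module.finrank ℝ (EuclideanSpace ℝ (Fin d)) := by
    rw [finrank_euclideanSpace, Fintype.card_fin]
    omega
  exact ⟨_, by simpa using he',
    hes.transContinuousLinearEquiv (ContinuousLinearEquiv.ofFinrankEq hfin)⟩

end SmoothSpace

namespace LagrangianRep

open Filter Topology SmoothSpace Lagrangian

/-! ### Cayley charts on tuples of Lagrangian subspaces -/

section CayleyCharts

variable {n : ℕ}

theorem toReal_mul_right_cancel {a : CxOp n} (ha : IsUnit a) {x y : RealOp n}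
    (h : x * toReal a = y * toReal a) : x = y := by
  obtain ⟨v, rfl⟩ := ha
  have h1 : toReal (v : CxOp n) * toReal ((v⁻¹ : (CxOp n)ˣ) : CxOp n) = 1 := by
    rw [← toReal_mul, Units.mul_inv, toReal_one]
  calc x = x * toReal (v : CxOp n) * toReal ((v⁻¹ : (CxOp n)ˣ) : CxOp n) := by
        rw [mul_assoc, h1, mul_one]
    _ = y := by rw [h, mul_assoc, h1, mul_one]

theorem IsReflection.toReal_mul {s : RealOp n} (hs : IsReflection s) {u : CxOp n}
    (hu : u ∈ unitary (CxOp n)) (h : s * toReal u = toReal (star u) * s) :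
    IsReflection (toReal u * s) where
  mul_self := by
    rw [mul_assoc, ← mul_assoc s, h, mul_assoc, hs.mul_self, mul_one, ← LagrangianRep.toReal_mul,
      (Unitary.mem_iff.1 hu).2, toReal_one]
  anti := by
    rw [mul_assoc, hs.anti, RealOp.mul_neg, ← mul_assoc, ← scalarOp_mul_toReal, mul_assoc]
  selfAdjoint := by
    rw [star_mul, hs.selfAdjoint, ← toReal_star]
    calc s * toReal (star u) = s * (toReal (star u) * s) * s := by
          rw [mul_assoc, mul_assoc, hs.mul_self, mul_one]
      _ = toReal u * s := by rw [← h, ← mul_assoc, hs.mul_self, one_mul]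

/-- Passing R across w changes its sign, exchanging 1 + w and 1 − w; the adjoint has the same effect
on the Cayley transform. This relation is what makes the product of the transform with R a
reflection again. -/
theorem reflOp_mul_toReal_cayley {L : Lagrangian n} {w : CxOp n} (hw : w ∈ lagTangent L) :
    reflOp L * toReal (cayley w) = toReal (star (cayley w)) * reflOp L := by
  have hunit := isUnit_one_sub_skew hw.1
  have hm := cayley_mul hunit
  have hu := Unitary.mem_iff.1 (cayley_mem_unitary hw.1 hunit)
  have h1 : star (cayley w) * (1 + w) = 1 - w := by
    rw [← hm, ← mul_assoc, hu.1, one_mul]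
  have h2 : reflOp L * toReal w = -(toReal w * reflOp L) := by rw [hw.2, neg_neg]
  have h3 : reflOp L * toReal (1 + w) = toReal (1 - w) * reflOp L := by
    rw [map_add, map_sub, toReal_one, mul_add, h2, RealOp.sub_mul, one_mul, mul_one, sub_eq_add_neg]
  have h4 : reflOp L * toReal (1 - w) = toReal (1 + w) * reflOp L := by
    rw [map_add, map_sub, toReal_one, RealOp.mul_sub, h2, add_mul, one_mul, mul_one, sub_neg_eq_add]
  apply toReal_mul_right_cancel hunit
  rw [mul_assoc, ← toReal_mul, hm, h3, mul_assoc, h4, ← mul_assoc, ← toReal_mul, h1]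

theorem isReflection_cayley {L : Lagrangian n} {w : CxOp n} (hw : w ∈ lagTangent L) :
    IsReflection (toReal (cayley w) * reflOp L) :=
  (isReflection_reflOp L).toReal_mul (cayley_mem_unitary hw.1 (isUnit_one_sub_skew hw.1))
    (reflOp_mul_toReal_cayley hw)

theorem reflOp_mul_toReal_τ₂ (L' L : Lagrangian n) :
    reflOp L * toReal (τ₂ L' L : CxOp n) = toReal (star (τ₂ L' L : CxOp n)) * reflOp L := by
  rw [toReal_star, toReal_τ₂, star_mul, (isReflection_reflOp L).selfAdjoint,
    (isReflection_reflOp L').selfAdjoint, mul_assoc]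

/-- Here u = R'R satisfies R u = u* R. Replacing u by u* = u⁻¹ changes the sign of (u − 1)(u + 1)⁻¹,
which is therefore anti-commuting with R as well as skew. -/
theorem cayleyInv_mem_lagTangent {L' L : Lagrangian n}
    (h : IsUnit ((τ₂ L' L : CxOp n) + 1)) : cayleyInv (τ₂ L' L : CxOp n) ∈ lagTangent L := by
  have hu := Unitary.mem_iff.1 (τ₂ L' L).2
  have h0 := reflOp_mul_toReal_τ₂ L' L
  have hs := star_cayleyInv (τ₂ L' L).2 h
  have hm := cayleyInv_mul h
  set u := (τ₂ L' L : CxOp n)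
  set w := cayleyInv u
  refine ⟨hs, ?_⟩
  have h1 : w * (star u + 1) = 1 - star u := by
    have h2 : star u + 1 = (u + 1) * star u := by rw [add_mul, hu.2, one_mul, add_comm]
    rw [h2, ← mul_assoc, hm, CxOp.sub_mul, hu.2, one_mul]
  have h3 : reflOp L * toReal (u + 1) = toReal (star u + 1) * reflOp L := by
    rw [map_add, map_add, toReal_one, mul_add, h0, add_mul, one_mul, mul_one]
  have h4 : reflOp L * toReal (u - 1) = -(toReal (1 - star u) * reflOp L) := by
    rw [map_sub, map_sub, toReal_one, RealOp.mul_sub, h0, RealOp.sub_mul, one_mul, mul_one, neg_sub]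
  apply toReal_mul_right_cancel h
  rw [mul_assoc, h3, ← mul_assoc, ← toReal_mul, h1, RealOp.neg_mul, mul_assoc, ← toReal_mul, hm, h4,
    neg_neg]

variable {ℓ : ℕ}

variable (n ℓ) in
/-- Coordinates for the tangent spaces of `Λ(n)^ℓ`. -/
abbrev TupleTangent : Type := Fin ℓ → Fin ((n + 1).choose 2) → ℝ

variable (n ℓ) in
theorem finrank_tupleTangent :
    Module.finrank ℝ (TupleTangent n ℓ) = ℓ * (n + 1).choose 2 := by
  rw [Module.finrank_pi_fintype]
  simp

/-- Cayley coordinates around `lam`, as a function of the involutions. -/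
def cayleyCoord (lam : Fin ℓ → Lagrangian n) (X : Fin ℓ → RealOp n) : TupleTangent n ℓ :=
  fun s => tangentProj (lam s) (cayleyInv (toCx (X s * reflOp (lam s))))

/-- The tuple with given Cayley coordinates. -/
def cayleyTuple (lam : Fin ℓ → Lagrangian n) (w : TupleTangent n ℓ) : Fin ℓ → Lagrangian n :=
  fun s => ofReflection (isReflection_cayley (tangentParam_mem (lam s) (w s)))

theorem reflOps_cayleyTuple (lam : Fin ℓ → Lagrangian n) (w : TupleTangent n ℓ) (s : Fin ℓ) :
    reflOps (cayleyTuple lam w) s = toReal (cayley (tangentParam (lam s) (w s))) * reflOp (lam s) :=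
  reflOp_ofReflection _

theorem contDiff_reflOps_cayleyTuple (lam : Fin ℓ → Lagrangian n) :
    ContDiff ℝ ω (fun w : TupleTangent n ℓ => reflOps (cayleyTuple lam w)) := by
  rw [contDiff_pi]
  intro s
  simp only [reflOps_cayleyTuple]
  rw [contDiff_iff_contDiffAt]
  intro w
  refine ContDiffAt.mul ?_ contDiffAt_const
  refine (toReal (n := n)).contDiff.contDiffAt.comp w ?_
  refine ContDiffAt.comp (g := cayley) (f := fun w : TupleTangent n ℓ => (tangentParam (lam s) (w s))) w
    (contDiffAt_cayley (isUnit_one_sub_skew (tangentParam_mem (lam s) (w s)).1)) ?_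
  exact ((tangentParam (lam s)).contDiff.comp (contDiff_apply ℝ _ s)).contDiffAt

theorem contDiffAt_cayleyCoord {lam : Fin ℓ → Lagrangian n} {X : Fin ℓ → RealOp n}
    (h : ∀ s, IsUnit (toCx (X s * reflOp (lam s)) + 1)) :
    ContDiffAt ℝ ω (cayleyCoord lam) X := by
  rw [contDiffAt_pi]
  intro s
  refine (tangentProj (lam s)).contDiff.contDiffAt.comp X ?_
  refine ContDiffAt.comp (g := cayleyInv) (f := fun X : Fin ℓ → RealOp n =>
    toCx (X s * reflOp (lam s))) X (contDiffAt_cayleyInv (h s)) ?_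
  exact (toCx.contDiff.comp ((contDiff_apply ℝ _ s).mul contDiff_const)).contDiffAt

theorem toCx_reflOp_mul (L' L : Lagrangian n) : toCx (reflOp L' * reflOp L) = τ₂ L' L := by
  rw [← toReal_τ₂, toCx_toReal]

theorem cayleyCoord_reflOps {lam lam' : Fin ℓ → Lagrangian n}
    (h : ∀ s, IsUnit ((τ₂ (lam' s) (lam s) : CxOp n) + 1)) (s : Fin ℓ) :
    tangentParam (lam s) (cayleyCoord lam (reflOps lam') s) =
      cayleyInv (τ₂ (lam' s) (lam s) : CxOp n) := by
  rw [cayleyCoord, reflOps, toCx_reflOp_mul,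
    tangentParam_tangentProj (cayleyInv_mem_lagTangent (h s))]

theorem cayleyTuple_cayleyCoord {lam lam' : Fin ℓ → Lagrangian n}
    (h : ∀ s, IsUnit ((τ₂ (lam' s) (lam s) : CxOp n) + 1)) :
    cayleyTuple lam (cayleyCoord lam (reflOps lam')) = lam' := by
  apply reflOps_injective
  funext s
  rw [reflOps_cayleyTuple, cayleyCoord_reflOps h, cayley_cayleyInv (h s), toReal_τ₂, mul_assoc,
    reflOp_mul_reflOp, mul_one]
  rfl

theorem τ₂_cayleyTuple (lam : Fin ℓ → Lagrangian n) (w : TupleTangent n ℓ) (s : Fin ℓ) :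
    (τ₂ (cayleyTuple lam w s) (lam s) : CxOp n) = cayley (tangentParam (lam s) (w s)) := by
  apply toReal_injective
  have h := reflOps_cayleyTuple lam w s
  rw [reflOps] at h
  rw [toReal_τ₂, h, mul_assoc, reflOp_mul_reflOp, mul_one]

theorem isUnit_τ₂_cayleyTuple (lam : Fin ℓ → Lagrangian n) (w : TupleTangent n ℓ) (s : Fin ℓ) :
    IsUnit ((τ₂ (cayleyTuple lam w s) (lam s) : CxOp n) + 1) := by
  rw [τ₂_cayleyTuple]
  exact isUnit_cayley_add_one (isUnit_one_sub_skew (tangentParam_mem (lam s) (w s)).1)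

theorem cayleyCoord_cayleyTuple (lam : Fin ℓ → Lagrangian n) (w : TupleTangent n ℓ) :
    cayleyCoord lam (reflOps (cayleyTuple lam w)) = w := by
  funext s
  rw [← tangentProj_tangentParam (lam s) (cayleyCoord lam _ s),
    cayleyCoord_reflOps (isUnit_τ₂_cayleyTuple lam w), τ₂_cayleyTuple, cayleyInv_cayley (isUnit_one_sub_skew (tangentParam_mem (lam s) (w s)).1),
    tangentProj_tangentParam]

theorem isOpen_isUnit_τ₂ (lam : Fin ℓ → Lagrangian n) :
    IsOpen {lam' : Fin ℓ → Lagrangian n | ∀ s, IsUnit ((τ₂ (lam' s) (lam s) : CxOp n) + 1)} := by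
  have h1 : {lam' : Fin ℓ → Lagrangian n | ∀ s, IsUnit ((τ₂ (lam' s) (lam s) : CxOp n) + 1)} =
      ⋂ s, (fun lam' : Fin ℓ → Lagrangian n => toCx (reflOp (lam' s) * reflOp (lam s)) + 1) ⁻¹'
        {x | IsUnit x} := by
    ext lam'
    simp only [toCx_reflOp_mul, Set.mem_iInter]
    rfl
  rw [h1]
  refine isOpen_iInter_of_finite fun s => Units.isOpen.preimage ?_
  exact (toCx.continuous.comp ((continuous_reflOp.comp (continuous_apply s)).mul
    continuous_const)).add continuous_const

/-- The involutions of an irreducible tuple. -/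
def irrReflOps (lam : LambdaIrr ℓ n) : Fin ℓ → RealOp n := reflOps lam.1

theorem isModel_irrReflOps : IsModel (irrReflOps : LambdaIrr ℓ n → _) :=
  isModel_reflOps.subtype _

theorem continuous_cayleyTuple (lam : Fin ℓ → Lagrangian n) : Continuous (cayleyTuple lam) := by
  rw [isModel_reflOps.isInducing.continuous_iff]
  exact (contDiff_reflOps_cayleyTuple lam).continuous

open Classical in
/-- The Cayley chart of the irreducible tuples. -/
def irrChart [NeZero n] (lam : LambdaIrr ℓ n) :
    OpenPartialHomeomorph (LambdaIrr ℓ n) (TupleTangent n ℓ) where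
  toFun x := cayleyCoord lam.1 (irrReflOps x)
  -- Coordinates may lead to a reducible tuple; the default `lam` is used only there, outside the
  -- target.
  invFun w := if h : cayleyTuple lam.1 w ∈ LambdaIrr ℓ n then ⟨_, h⟩ else lam
  source := {x | ∀ s, IsUnit ((τ₂ (x.1 s) (lam.1 s) : CxOp n) + 1)}
  target := cayleyTuple lam.1 ⁻¹' (LambdaIrr ℓ n : Set (Fin ℓ → Lagrangian n))
  map_source' x hx := by
    change cayleyTuple lam.1 (cayleyCoord lam.1 (reflOps x.1)) ∈ LambdaIrr ℓ n
    rw [cayleyTuple_cayleyCoord hx]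
    exact x.2
  map_target' w hw := by
    have hw' : cayleyTuple lam.1 w ∈ LambdaIrr ℓ n := hw
    rw [dif_pos hw']
    exact isUnit_τ₂_cayleyTuple lam.1 w
  left_inv' x hx := by
    have h1 : cayleyTuple lam.1 (cayleyCoord lam.1 (irrReflOps x)) = x.1 :=
      cayleyTuple_cayleyCoord hx
    have hw' : cayleyTuple lam.1 (cayleyCoord lam.1 (irrReflOps x)) ∈ LambdaIrr ℓ n := by
      rw [h1]
      exact x.2
    rw [dif_pos hw']
    exact Subtype.ext h1
  right_inv' w hw := by
    have hw' : cayleyTuple lam.1 w ∈ LambdaIrr ℓ n := hw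
    rw [dif_pos hw']
    exact cayleyCoord_cayleyTuple lam.1 w
  open_source := (isOpen_isUnit_τ₂ lam.1).preimage continuous_subtype_val
  open_target := isOpen_lambdaIrr.preimage (continuous_cayleyTuple lam.1)
  continuousOn_toFun := fun x hx => by
    refine ContinuousAt.continuousWithinAt ?_
    have h1 : ContinuousAt (cayleyCoord lam.1) (irrReflOps x) :=
      (contDiffAt_cayleyCoord fun s => by
        rw [irrReflOps, reflOps, toCx_reflOp_mul]
        exact hx s).continuousAt
    exact ContinuousAt.comp (f := irrReflOps) h1 isModel_irrReflOps.continuous.continuousAt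
  continuousOn_invFun := by
    rw [continuousOn_iff_continuous_domRestrict, isModel_irrReflOps.isInducing.continuous_iff]
    have h1 : Continuous fun w : TupleTangent n ℓ => reflOps (cayleyTuple lam.1 w) :=
      (contDiff_reflOps_cayleyTuple lam.1).continuous
    refine (h1.comp continuous_subtype_val).congr fun w => ?_
    have hw' : cayleyTuple lam.1 w ∈ LambdaIrr ℓ n := w.2
    simp only [Function.comp_apply, Set.domRestrict_apply]
    rw [dif_pos hw']
    rfl

theorem irrReflOps_irrChart_symm [NeZero n] (lam : LambdaIrr ℓ n) {w : TupleTangent n ℓ}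
    (hw : w ∈ (irrChart lam).target) :
    irrReflOps ((irrChart lam).symm w) = reflOps (cayleyTuple lam.1 w) := by
  classical
  have hw' : cayleyTuple lam.1 w ∈ LambdaIrr ℓ n := hw
  have h1 : (irrChart lam).symm w = ⟨_, hw'⟩ := dif_pos hw'
  rw [h1]
  rfl

theorem mem_irrChart_source [NeZero n] (lam : LambdaIrr ℓ n) : lam ∈ (irrChart lam).source := by
  intro s
  rw [τ₂_self]
  have h1 : ((1 : U n) : CxOp n) + 1 = (2 : ℂ) • (1 : CxOp n) := (two_smul ℂ (1 : CxOp n)).symm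
  rw [h1]
  exact isUnit_one.smul (Units.mk0 (2 : ℂ) two_ne_zero)

theorem contDiffAt_irrChart [NeZero n] {lam x : LambdaIrr ℓ n} (hx : x ∈ (irrChart lam).source) :
    ContDiffAt ℝ ω (cayleyCoord lam.1) (irrReflOps x) :=
  contDiffAt_cayleyCoord fun s => by
    rw [irrReflOps, reflOps, toCx_reflOp_mul]
    exact hx s

theorem contDiffAt_irrChart_symm [NeZero n] (lam : LambdaIrr ℓ n) {w : TupleTangent n ℓ}
    (hw : w ∈ (irrChart lam).target) :
    ContDiffAt ℝ ω (irrReflOps ∘ (irrChart lam).symm) w := by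
  refine (contDiff_reflOps_cayleyTuple lam.1).contDiffAt.congr_of_eventuallyEq ?_
  filter_upwards [(irrChart lam).open_target.mem_nhds hw] with w' hw'
  exact irrReflOps_irrChart_symm lam hw'

theorem isSmoothChart_irrChart [NeZero n] (lam : LambdaIrr ℓ n) : IsSmoothChart (irrChart lam) :=
  isModel_irrReflOps.isSmoothChart (irrChart lam) (cayleyCoord lam.1)
    (fun _ hx => (contDiffAt_irrChart hx).nearSmooth) (fun _ _ => rfl)
    (fun _ ht => (contDiffAt_irrChart_symm lam ht).nearSmooth)

end CayleyCharts

end LagrangianRep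

/-! ### Local analytic sections of φ̃ -/

namespace LagrangianRep

open Filter Topology SmoothSpace Lagrangian

/-- The solution of an overdetermined linear system with trivial kernel depends analytically on
parameters. -/
theorem exists_contDiffAt_solution {P E F : Type*} [NormedAddCommGroup P] [NormedSpace ℝ P]
    [NormedAddCommGroup E] [NormedSpace ℝ E] [FiniteDimensional ℝ E]
    [NormedAddCommGroup F] [NormedSpace ℝ F] [FiniteDimensional ℝ F]
    {M : P → E →L[ℝ] F} {p₀ : P} (hM : ContDiffAt ℝ ω M p₀) (hinj : Function.Injective (M p₀))
    (b : F) : ∃ x : P → E, ContDiffAt ℝ ω x p₀ ∧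
      ∀ᶠ p in 𝓝 p₀, Function.Injective (M p) ∧ ∀ v, M p v = b → x p = v := by
  -- A left inverse N at the base point leaves N M(p) invertible nearby, so x(p) = (N M(p))⁻¹ N b
  -- returns any solution that exists.
  obtain ⟨g, hg⟩ := LinearMap.exists_leftInverse_of_injective (M p₀ : E →ₗ[ℝ] F)
    (LinearMap.ker_eq_bot.2 hinj)
  let N : F →L[ℝ] E := LinearMap.toContinuousLinearMap g
  have : CompleteSpace E := FiniteDimensional.complete ℝ E
  have hN : ContDiffAt ℝ ω (fun p => N.comp (M p)) p₀ := contDiffAt_const.clm_comp hM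
  have h0 : N.comp (M p₀) = 1 := by
    ext1 v
    exact DFunLike.congr_fun hg v
  have hu : IsUnit (N.comp (M p₀)) := by
    rw [h0]
    exact isUnit_one
  refine ⟨fun p => Ring.inverse (N.comp (M p)) (N b), ?_, ?_⟩
  · exact (ContDiffAt.comp (g := Ring.inverse) p₀ (contDiffAt_inverse hu) hN).clm_apply
      contDiffAt_const
  · have h1 : ∀ᶠ p in 𝓝 p₀, IsUnit (N.comp (M p)) :=
      hN.continuousAt.eventually (Units.isOpen.mem_nhds hu)
    filter_upwards [h1] with p hp
    have h2 : ∀ v, Ring.inverse (N.comp (M p)) (N (M p v)) = v := fun v =>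
      DFunLike.congr_fun (Ring.inverse_mul_cancel _ hp) v
    refine ⟨fun v v' h => ?_, fun v hv => ?_⟩
    · rw [← h2 v, h, h2]
    · rw [← hv, h2]

/-- The phase of a complex number. -/
def unitPhase (z : ℂ) : Circle := Circle.exp (Complex.arg z)

theorem norm_mul_unitPhase (z : ℂ) : (‖z‖ : ℂ) * (unitPhase z : ℂ) = z := by
  rw [unitPhase, Circle.coe_exp, Complex.norm_mul_exp_arg_mul_I]

theorem unitPhase_circle_mul (z : Circle) {w : ℂ} (hw : w ≠ 0) :
    unitPhase (z * w) = z * unitPhase w := by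
  apply Circle.ext
  have h1 := norm_mul_unitPhase ((z : ℂ) * w)
  have h2 := norm_mul_unitPhase w
  rw [norm_mul, Circle.norm_coe, one_mul] at h1
  have h3 : (‖w‖ : ℂ) ≠ 0 := by simpa using hw
  rw [Circle.coe_mul]
  apply mul_left_cancel₀ h3
  rw [h1]
  conv_lhs => rw [← h2]
  ring

theorem unitPhase_one : unitPhase 1 = 1 := by simp [unitPhase]

section Section

variable {n ℓ : ℕ}

/-- The linear system for the involutions of a tuple with given representation. -/
def reflSystem [NeZero n] [NeZero ℓ] (σ₀ : RealOp n) (A : Fin ℓ → CxOp n) :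
    (Fin ℓ → RealOp n) →L[ℝ]
      (Fin ℓ → RealOp n) × (Fin ℓ → RealOp n) × (Fin ℓ → RealOp n) × ℂ :=
  LinearMap.toContinuousLinearMap
    { toFun := fun X =>
        (fun s => X s * toReal (A s) - X (finRotate ℓ s),
          fun s => toReal (A s) * X (finRotate ℓ s) - X s,
          fun s => X s * scalarOp Complex.I + scalarOp Complex.I * X s,
          inner ℂ (unitVec n) (X 0 (σ₀ (unitVec n))))
      map_add' := fun X Y => by
        refine Prod.ext (funext fun s => ?_) (Prod.ext (funext fun s => ?_)
          (Prod.ext (funext fun s => ?_) ?_))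
        · change (X s + Y s) * _ - (X _ + Y _) = (X s * _ - X _) + (Y s * _ - Y _)
          rw [add_mul]
          abel
        · change _ * (X _ + Y _) - (X s + Y s) = (_ * X _ - X s) + (_ * Y _ - Y s)
          rw [mul_add]
          abel
        · change (X s + Y s) * _ + _ * (X s + Y s) = (X s * _ + _ * X s) + (Y s * _ + _ * Y s)
          rw [add_mul, mul_add]
          abel
        · exact inner_add_right _ _ _
      map_smul' := fun r X => by
        refine Prod.ext (funext fun s => ?_) (Prod.ext (funext fun s => ?_)
          (Prod.ext (funext fun s => ?_) ?_))
        · change (r • X s) * _ - r • X _ = r • (X s * _ - X _)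
          rw [smul_sub, smul_mul_assoc]
        · change _ * (r • X _) - r • X s = r • (_ * X _ - X s)
          rw [smul_sub, mul_smul_comm]
        · change (r • X s) * _ + _ * (r • X s) = r • (X s * _ + _ * X s)
          rw [smul_add, smul_mul_assoc, mul_smul_comm]
        · exact inner_smul_right_eq_smul (unitVec n) (X 0 (σ₀ (unitVec n))) r }

theorem reflSystem_apply [NeZero n] [NeZero ℓ] (σ₀ : RealOp n) (A : Fin ℓ → CxOp n)
    (X : Fin ℓ → RealOp n) : reflSystem σ₀ A X =
      (fun s => X s * toReal (A s) - X (finRotate ℓ s),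
        fun s => toReal (A s) * X (finRotate ℓ s) - X s,
        fun s => X s * scalarOp Complex.I + scalarOp Complex.I * X s,
        inner ℂ (unitVec n) (X 0 (σ₀ (unitVec n)))) := rfl

theorem contDiff_reflSystem [NeZero n] [NeZero ℓ] (σ₀ : RealOp n) :
    ContDiff ℝ ω (reflSystem σ₀ : (Fin ℓ → CxOp n) → _) := by
  rw [contDiff_clm_apply_iff]
  intro X
  simp only [reflSystem_apply]
  have h1 : ∀ s, ContDiff ℝ ω fun A : Fin ℓ → CxOp n => toReal (A s) := fun s =>
    toReal.contDiff.comp (contDiff_apply ℝ _ s)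
  refine ContDiff.prodMk (contDiff_pi.2 fun s => ?_) (ContDiff.prodMk (contDiff_pi.2 fun s => ?_)
    contDiff_const)
  · exact (contDiff_const.mul (h1 s)).sub contDiff_const
  · exact ((h1 s).mul contDiff_const).sub contDiff_const

/-- Anti-linearity gives X_0 = aR_0 with a complex linear, and the first family of equations
propagates this to X_s = aR_s. The second family makes a commute with the representation, so a is a
scalar, which the final normalising entry kills. -/
theorem reflSystem_injective [NeZero n] [NeZero ℓ] {lam : Fin ℓ → Lagrangian n}
    (hlam : lam ∈ LambdaIrr ℓ n) :
    Function.Injective (reflSystem (reflOp (lam 0)) (phiTilde lam).coords) := by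
  rw [injective_iff_map_eq_zero]
  intro X hX
  rw [reflSystem_apply, Prod.mk_eq_zero, Prod.mk_eq_zero, Prod.mk_eq_zero] at hX
  obtain ⟨h1, h2, h3, h4⟩ := hX
  have h1' : ∀ s, X s * (reflOp (lam s) * reflOp (lam (finRotate ℓ s))) = X (finRotate ℓ s) :=
    fun s => by
      rw [← toReal_coords_phiTilde]
      exact sub_eq_zero.1 (congrFun h1 s)
  have h2' : ∀ s, toReal ((phiTilde lam).coords s) * X (finRotate ℓ s) = X s :=
    fun s => sub_eq_zero.1 (congrFun h2 s)
  have h3' : ∀ s, X s * scalarOp Complex.I = -(scalarOp Complex.I * X s) :=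
    fun s => eq_neg_of_add_eq_zero_left (congrFun h3 s)
  have hlin : X 0 * reflOp (lam 0) * scalarOp Complex.I =
      scalarOp Complex.I * (X 0 * reflOp (lam 0)) := by
    rw [mul_assoc, (isReflection_reflOp _).anti, RealOp.mul_neg, ← mul_assoc, h3', RealOp.neg_mul,
      neg_neg, mul_assoc]
  obtain ⟨a, ha⟩ := exists_toReal_eq hlin
  have hX : ∀ s, X s = toReal a * reflOp (lam s) := fun s => by
    induction s using finRotate_induction with
    | h0 => rw [ha, mul_assoc, reflOp_mul_reflOp, mul_one]
    | h s ih => rw [← h1', ih, mul_assoc, ← mul_assoc (reflOp (lam s)), reflOp_mul_reflOp, one_mul]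
  obtain ⟨z, rfl⟩ := HomU.Irr.trivialCommutant hlam a fun s => by
    apply toReal_injective
    have h5 := h2' s
    rw [hX, hX, ← mul_assoc] at h5
    rw [toReal_mul, toReal_mul]
    have h6 := congrArg (· * reflOp (lam (finRotate ℓ s))) h5
    simp only [mul_assoc, reflOp_mul_reflOp, mul_one] at h6
    rw [h6, ← toReal_coords_phiTilde]
  have h7 : inner ℂ (unitVec n) ((toReal (z • (1 : CxOp n)))
      (reflOp (lam 0) (reflOp (lam 0) (unitVec n)))) = (0 : ℂ) := by
    rw [hX] at h4
    exact h4
  have h8 : reflOp (lam 0) (reflOp (lam 0) (unitVec n)) = unitVec n :=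
    DFunLike.congr_fun (reflOp_mul_reflOp (lam 0)) (unitVec n)
  rw [h8] at h7
  have h9 : z = 0 := (inner_unitVec (n := n) z).symm.trans h7
  funext s
  have h10 : (0 : ℂ) • (1 : CxOp n) = 0 := zero_smul ℂ (1 : CxOp n)
  rw [hX, h9, h10, map_zero, zero_mul]
  rfl

/-- The complex number by which the first involution of a tuple is compared with that of `lam`. -/
def relPhase [NeZero n] [NeZero ℓ] (lam lam' : Fin ℓ → Lagrangian n) : ℂ :=
  inner ℂ (unitVec n) (reflOp (lam' 0) (reflOp (lam 0) (unitVec n)))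

theorem relPhase_self [NeZero n] [NeZero ℓ] (lam : Fin ℓ → Lagrangian n) :
    relPhase lam lam = 1 := by
  have h8 : reflOp (lam 0) (reflOp (lam 0) (unitVec n)) = (1 : ℂ) • unitVec n :=
    (DFunLike.congr_fun (reflOp_mul_reflOp (lam 0)) (unitVec n)).trans (one_smul ℂ _).symm
  rw [relPhase, h8, inner_unitVec]

theorem relPhase_circle_smul [NeZero n] [NeZero ℓ] (lam lam' : Fin ℓ → Lagrangian n) (z : Circle) :
    relPhase lam (z • lam') = z * relPhase lam lam' := by
  rw [relPhase, Pi.smul_apply, reflOp_circle_smul]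
  exact inner_smul_right _ _ _

/-- This exhibits the line of solutions belonging to a given representation; dividing by the
relative phase picks the normalised one. -/
theorem reflSystem_scalarOp_mul_reflOps [NeZero n] [NeZero ℓ] (lam lam' : Fin ℓ → Lagrangian n)
    (z : ℂ) : reflSystem (reflOp (lam 0)) (phiTilde lam').coords
      (fun s => scalarOp z * reflOps lam' s) = (0, 0, 0, z * relPhase lam lam') := by
  rw [reflSystem_apply]
  refine Prod.ext (funext fun s => ?_) (Prod.ext (funext fun s => ?_)
    (Prod.ext (funext fun s => ?_) ?_))
  · change scalarOp z * reflOp (lam' s) * _ - scalarOp z * reflOp (lam' (finRotate ℓ s)) = 0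
    rw [toReal_coords_phiTilde, mul_assoc, ← mul_assoc (reflOp _), reflOp_mul_reflOp, one_mul,
      sub_self]
  · change _ * (scalarOp z * reflOp (lam' (finRotate ℓ s))) - scalarOp z * reflOp (lam' s) = 0
    rw [← mul_assoc, ← scalarOp_mul_toReal, toReal_coords_phiTilde, mul_assoc, mul_assoc,
      reflOp_mul_reflOp, mul_one, sub_self]
  · change scalarOp z * reflOp (lam' s) * _ + _ * (scalarOp z * reflOp (lam' s)) = 0
    rw [mul_assoc, (isReflection_reflOp _).anti, RealOp.mul_neg, ← mul_assoc, ← mul_assoc,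
      ← scalarOp_mul, ← scalarOp_mul, mul_comm z, neg_add_cancel]
  · exact inner_smul_right _ _ _

/-- A local analytic section of `φ̃` on the representations of irreducible tuples, normalised by
the relative phase. -/
theorem exists_section [NeZero n] [NeZero ℓ] {lam : Fin ℓ → Lagrangian n}
    (hlam : lam ∈ LambdaIrr ℓ n) :
    ∃ S : (Fin ℓ → CxOp n) → Fin ℓ → RealOp n, ContDiffAt ℝ ω S (phiTilde lam).coords ∧
      ∀ᶠ A in 𝓝 (phiTilde lam).coords, ∀ lam', (phiTilde lam').coords = A →
        relPhase lam lam' ≠ 0 ∧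
        S A = reflOps ((unitPhase (relPhase lam lam'))⁻¹ • lam') := by
  have hfin : Module.Finite ℝ (Fin ℓ → RealOp n) := inferInstance
  have hfin' : Module.Finite ℝ ((Fin ℓ → RealOp n) × ℂ) := Module.Finite.prod
  have hfin'' : Module.Finite ℝ ((Fin ℓ → RealOp n) × (Fin ℓ → RealOp n) × ℂ) :=
    Module.Finite.prod
  have hfin''' : Module.Finite ℝ
      ((Fin ℓ → RealOp n) × (Fin ℓ → RealOp n) × (Fin ℓ → RealOp n) × ℂ) := Module.Finite.prod
  obtain ⟨X, hX, hev⟩ := exists_contDiffAt_solution (contDiff_reflSystem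
    (reflOp (lam 0))).contDiffAt (reflSystem_injective hlam) (0, 0, 0, 1)
  have key : ∀ᶠ A in 𝓝 (phiTilde lam).coords, ∀ lam', (phiTilde lam').coords = A →
      relPhase lam lam' ≠ 0 ∧
      X A = fun s => scalarOp (relPhase lam lam')⁻¹ * reflOps lam' s := by
    filter_upwards [hev] with A hA lam' h'
    subst h'
    -- Were it zero, the reflections themselves would lie in the kernel of an injective system.
    have h0 : relPhase lam lam' ≠ 0 := by
      intro h0
      have h1 := reflSystem_scalarOp_mul_reflOps lam lam' 1
      rw [h0, mul_zero] at h1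
      have h2 := hA.1 (h1.trans (map_zero _).symm)
      have h3 : reflOp (lam' 0) = 0 := by
        have := congrFun h2 0
        rwa [scalarOp_one, one_mul] at this
      have h4 := reflOp_mul_reflOp (lam' 0)
      rw [h3, zero_mul] at h4
      have h5 : unitVec n = 0 := (DFunLike.congr_fun h4 (unitVec n)).symm
      have h6 := inner_unitVec (n := n) 1
      rw [h5, smul_zero, inner_zero_left] at h6
      exact zero_ne_one h6
    refine ⟨h0, hA.2 _ ?_⟩
    rw [reflSystem_scalarOp_mul_reflOps, inv_mul_cancel₀ h0]
  -- The normalised solution is τ⁻¹R', whose square is the scalar |τ|⁻². Reading this scalar off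
  -- analytically permits division by its square root, leaving |τ|τ⁻¹R', a genuine reflection.
  let q : (Fin ℓ → RealOp n) → ℝ := fun Y =>
    (inner ℂ (unitVec n) ((Y 0) (Y 0 (unitVec n)))).re
  have hqv : ∀ lam', relPhase lam lam' ≠ 0 →
      q (fun s => scalarOp (relPhase lam lam')⁻¹ * reflOps lam' s) =
        (‖relPhase lam lam'‖⁻¹) ^ 2 := fun lam' h0 => by
    set τ := relPhase lam lam'
    have h1 : (scalarOp τ⁻¹ * reflOp (lam' 0)) * (scalarOp τ⁻¹ * reflOp (lam' 0)) =
        scalarOp (((‖τ‖⁻¹) ^ 2 : ℝ) : ℂ) := by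
      rw [mul_assoc, ← mul_assoc (reflOp _), (isReflection_reflOp _).mul_scalarOp, mul_assoc,
        reflOp_mul_reflOp, mul_one, ← scalarOp_mul, Complex.mul_conj, Complex.normSq_eq_norm_sq,
        norm_inv]
    have h2 : q (fun s => scalarOp τ⁻¹ * reflOps lam' s) =
        (inner ℂ (unitVec n) ((((‖τ‖⁻¹) ^ 2 : ℝ) : ℂ) • unitVec n)).re :=
      congrArg (fun v => (inner ℂ (unitVec n) v).re) (DFunLike.congr_fun h1 (unitVec n))
    rw [h2, inner_unitVec, Complex.ofReal_re]
  have hself := key.self_of_nhds lam rfl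
  have hq : ContDiff ℝ ω q := by
    have h1 : ContDiff ℝ ω fun Y : Fin ℓ → RealOp n => Y 0 := contDiff_apply ℝ _ 0
    have h2 : ContDiff ℝ ω fun Y : Fin ℓ → RealOp n => (Y 0) (Y 0 (unitVec n)) :=
      h1.clm_apply (h1.clm_apply contDiff_const)
    have h3 : ContDiff ℝ ω fun v : Cn n => (inner ℂ (unitVec n) v).re := by
      simp only [← re_inner_eq]
      exact contDiff_const.inner ℝ contDiff_id
    exact h3.comp h2
  refine ⟨fun A s => (Real.sqrt (q (X A)))⁻¹ • X A s, ?_, ?_⟩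
  · have hne : q (X (phiTilde lam).coords) ≠ 0 := by
      rw [hself.2, hqv lam hself.1]
      exact pow_ne_zero _ (inv_ne_zero (norm_ne_zero_iff.2 hself.1))
    have h1 : ContDiffAt ℝ ω (fun A => q (X A)) (phiTilde lam).coords :=
      hq.contDiffAt.comp _ hX
    refine contDiffAt_pi.2 fun s => ContDiffAt.smul (ContDiffAt.inv (h1.sqrt hne) ?_)
      (contDiffAt_pi.1 hX s)
    rw [hself.2, hqv lam hself.1, Real.sqrt_sq (by positivity)]
    exact inv_ne_zero (norm_ne_zero_iff.2 hself.1)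
  · filter_upwards [key] with A hA lam' h'
    obtain ⟨h0, h1⟩ := hA lam' h'
    refine ⟨h0, ?_⟩
    funext s
    rw [h1, hqv lam' h0, Real.sqrt_sq (by positivity), inv_inv]
    change ‖relPhase lam lam'‖ • (scalarOp _ * reflOp (lam' s)) =
      reflOp ((unitPhase (relPhase lam lam'))⁻¹ • lam' s)
    rw [reflOp_circle_smul, ← smul_mul_assoc]
    congr 1
    set τ := relPhase lam lam'
    have h2 : ‖τ‖ • (scalarOp τ⁻¹ : RealOp n) = scalarOp (‖τ‖ : ℂ) * scalarOp τ⁻¹ := by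
      rw [scalarOp_ofReal, smul_mul_assoc, one_mul]
    rw [h2, ← scalarOp_mul]
    congr 1
    have h3 := norm_mul_unitPhase τ
    have h4 : (unitPhase τ : ℂ) ≠ 0 := Circle.coe_ne_zero _
    rw [Circle.coe_inv]
    apply mul_right_cancel₀ (mul_ne_zero h4 h0)
    calc (‖τ‖ : ℂ) * τ⁻¹ * ((unitPhase τ : ℂ) * τ) = (‖τ‖ * (unitPhase τ : ℂ)) * (τ⁻¹ * τ) := by ring
      _ = (unitPhase τ : ℂ)⁻¹ * ((unitPhase τ : ℂ) * τ) := by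
        rw [h3, inv_mul_cancel₀ h0, ← mul_assoc, inv_mul_cancel₀ h4, one_mul, mul_one]

end Section

end LagrangianRep

namespace LagrangianRep

open Filter Topology SmoothSpace Lagrangian

/-! ### The circle bundle and the manifold of irreducible Lagrangian representations -/

section CircleBundle

variable {n ℓ : ℕ}

instance : SMul Circle (LambdaIrr ℓ n) where
  smul z x := ⟨z • x.1, by
    change (phiTilde (z • x.1)).Irr
    rw [phiTilde_circle_smul]
    exact x.2⟩

theorem coe_circle_smul (z : Circle) (x : LambdaIrr ℓ n) :
    ((z • x : LambdaIrr ℓ n) : Fin ℓ → Lagrangian n) = z • x.1 := rfl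

instance : MulAction Circle (LambdaIrr ℓ n) where
  one_smul x := Subtype.ext (one_smul Circle x.1)
  mul_smul z w x := Subtype.ext (mul_smul z w x.1)

instance : ContinuousSMul Circle (LambdaIrr ℓ n) where
  continuous_smul :=
    (continuous_fst.smul (continuous_subtype_val.comp continuous_snd)).subtype_mk _

theorem phiTildeIrr_circle_smul (z : Circle) (x : LambdaIrr ℓ n) :
    phiTildeIrr (z • x) = phiTildeIrr x := Subtype.ext (phiTilde_circle_smul z x.1)

theorem irrReflOps_circle_smul (z : Circle) (x : LambdaIrr ℓ n) :
    irrReflOps (z • x) = fun s => scalarOp (z : ℂ) * irrReflOps x s :=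
  funext fun s => reflOp_circle_smul z (x.1 s)

theorem phiTildeIrr_eq_iff [NeZero ℓ] [NeZero n] (x x' : LambdaIrr ℓ n) :
    phiTildeIrr x = phiTildeIrr x' ↔ ∃ z : Circle, z • x = x' := by
  constructor
  · intro h
    obtain ⟨z, hz⟩ := exists_circle_smul_eq x.2 (congrArg Subtype.val h)
    exact ⟨z, Subtype.ext hz⟩
  · rintro ⟨z, rfl⟩
    rw [phiTildeIrr_circle_smul]

theorem eq_one_of_circle_smul_eq [NeZero ℓ] [NeZero n] {z : Circle} {x : LambdaIrr ℓ n}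
    (h : z • x = x) : z = 1 := by
  have h1 := congrFun (congrArg irrReflOps h) 0
  rw [irrReflOps_circle_smul] at h1
  have h2 : (scalarOp (z : ℂ) : RealOp n) = scalarOp 1 := by
    have h3 := congrArg (· * reflOp (x.1 0)) h1
    simp only [irrReflOps, reflOps, mul_assoc, reflOp_mul_reflOp, mul_one] at h3
    rw [h3, scalarOp_one]
  exact Circle.ext (scalarOp_injective h2)

/-- The images of the generators of an irreducible Lagrangian representation. -/
def irrCoords (ρ : LHomIrr ℓ n) : Fin ℓ → CxOp n := ρ.1.coords

theorem isModel_irrCoords : IsModel (irrCoords : LHomIrr ℓ n → _) := isModel_coords.subtype _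

/-- The images of the generators, as a function of the involutions. -/
def opsToCoords (X : Fin ℓ → RealOp n) (s : Fin ℓ) : CxOp n := toCx (X s * X (finRotate ℓ s))

theorem opsToCoords_reflOps (lam : Fin ℓ → Lagrangian n) :
    opsToCoords (reflOps lam) = (phiTilde lam).coords := by
  funext s
  rw [opsToCoords, reflOps, reflOps, ← toReal_coords_phiTilde, toCx_toReal]

theorem contDiff_opsToCoords : ContDiff ℝ ω (opsToCoords : (Fin ℓ → RealOp n) → _) :=
  contDiff_pi.2 fun s => toCx.contDiff.comp ((contDiff_apply ℝ _ s).mul (contDiff_apply ℝ _ _))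

theorem isSmoothMap_phiTildeIrr :
    IsSmoothMap (phiTildeIrr : LambdaIrr ℓ n → LHomIrr ℓ n) :=
  isModel_irrReflOps.isSmoothMap isModel_irrCoords fun x =>
    ⟨opsToCoords, contDiff_opsToCoords.nearSmooth (irrReflOps x), .of_forall fun x' =>
      (opsToCoords_reflOps x'.1).symm⟩

theorem exists_phiTildeIrr_eq (ρ : LHomIrr ℓ n) : ∃ x : LambdaIrr ℓ n, phiTildeIrr x = ρ := by
  obtain ⟨ρ, ⟨lam, rfl⟩, h⟩ := ρ
  exact ⟨⟨lam, h⟩, rfl⟩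

/-- The section of `φ̃` normalised by the phase relative to `x`. -/
def phaseSection [NeZero ℓ] [NeZero n] (x : LambdaIrr ℓ n) (ρ : LHomIrr ℓ n) : LambdaIrr ℓ n :=
  (unitPhase (relPhase x.1 (exists_phiTildeIrr_eq ρ).choose.1))⁻¹ •
    (exists_phiTildeIrr_eq ρ).choose

theorem phiTildeIrr_phaseSection [NeZero ℓ] [NeZero n] (x : LambdaIrr ℓ n) (ρ : LHomIrr ℓ n) :
    phiTildeIrr (phaseSection x ρ) = ρ := by
  rw [phaseSection, phiTildeIrr_circle_smul]
  exact (exists_phiTildeIrr_eq ρ).choose_spec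

/-- Another preimage differs by some z in the circle, which multiplies the relative phase by z; the
two factors cancel, so the choice of preimage is immaterial where the relative phase is non-zero. -/
theorem phaseSection_phiTildeIrr [NeZero ℓ] [NeZero n] {x x' : LambdaIrr ℓ n}
    (h : relPhase x.1 x'.1 ≠ 0) :
    phaseSection x (phiTildeIrr x') = (unitPhase (relPhase x.1 x'.1))⁻¹ • x' := by
  rw [phaseSection]
  have h1 := (exists_phiTildeIrr_eq (phiTildeIrr x')).choose_spec
  set y := (exists_phiTildeIrr_eq (phiTildeIrr x')).choose
  obtain ⟨z, hz⟩ := (phiTildeIrr_eq_iff x' y).1 h1.symm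
  rw [← hz, coe_circle_smul, relPhase_circle_smul, unitPhase_circle_mul z h, mul_inv_rev, smul_smul,
    mul_assoc, inv_mul_cancel, mul_one]

theorem phaseSection_self [NeZero ℓ] [NeZero n] (x : LambdaIrr ℓ n) :
    phaseSection x (phiTildeIrr x) = x := by
  rw [phaseSection_phiTildeIrr (by rw [relPhase_self]; exact one_ne_zero), relPhase_self,
    unitPhase_one, inv_one, one_smul]

theorem exists_phaseSection_eq [NeZero ℓ] [NeZero n] (x : LambdaIrr ℓ n) :
    ∃ S : (Fin ℓ → CxOp n) → Fin ℓ → RealOp n, ContDiffAt ℝ ω S (irrCoords (phiTildeIrr x)) ∧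
      ∀ᶠ A in 𝓝 (irrCoords (phiTildeIrr x)), ∀ x' : LambdaIrr ℓ n, irrCoords (phiTildeIrr x') = A →
        relPhase x.1 x'.1 ≠ 0 ∧ S A = irrReflOps (phaseSection x (phiTildeIrr x')) := by
  obtain ⟨S, hS, hev⟩ := exists_section x.2
  refine ⟨S, hS, ?_⟩
  filter_upwards [hev] with A hA x' h'
  obtain ⟨h0, h1⟩ := hA x'.1 h'
  exact ⟨h0, by rw [h1, phaseSection_phiTildeIrr h0]; rfl⟩

/-- Collects what has to hold on the open set of a local trivialisation: a smooth section, and a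
well-defined phase on the whole fibre. -/
theorem eventually_phaseSection [NeZero ℓ] [NeZero n] (x : LambdaIrr ℓ n) :
    ∀ᶠ ρ in 𝓝 (phiTildeIrr x),
      (∃ F : (Fin ℓ → CxOp n) → Fin ℓ → RealOp n, NearSmooth F (irrCoords ρ) ∧
        irrReflOps ∘ phaseSection x =ᶠ[𝓝 ρ] F ∘ irrCoords) ∧
      ∀ x', phiTildeIrr x' = ρ → relPhase x.1 x'.1 ≠ 0 := by
  obtain ⟨S, hS, hev⟩ := exists_phaseSection_eq x
  have hc : Tendsto irrCoords (𝓝 (phiTildeIrr x)) (𝓝 (irrCoords (phiTildeIrr x))) :=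
    isModel_irrCoords.continuous.continuousAt
  have h1 := (hc.eventually hev).eventually_nhds
  filter_upwards [h1, hc.eventually hS.nearSmooth.eventually] with ρ h2 h3
  refine ⟨⟨S, h3, ?_⟩, fun x' hx' => (h2.self_of_nhds x' (by rw [hx'])).1⟩
  filter_upwards [h2] with ρ' h4
  obtain ⟨x', rfl⟩ := exists_phiTildeIrr_eq ρ'
  exact (h4 x' rfl).2.symm

theorem continuousAt_phaseSection [NeZero ℓ] [NeZero n] (x : LambdaIrr ℓ n) :
    ContinuousAt (phaseSection x) (phiTildeIrr x) :=
  (isModel_irrCoords.smoothAt_comp isModel_irrReflOps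
    (eventually_phaseSection x).self_of_nhds.1).1

/-- Through every irreducible tuple passes a section that is continuous at its image. -/
theorem isOpenMap_phiTildeIrr [NeZero ℓ] [NeZero n] :
    IsOpenMap (phiTildeIrr : LambdaIrr ℓ n → LHomIrr ℓ n) :=
  IsOpenMap.of_sections fun x => ⟨phaseSection x, continuousAt_phaseSection x, phaseSection_self x,
    phiTildeIrr_phaseSection x⟩

/-- Pulling back along a local smooth section undoes pulling back along the projection. Thus the
structure induced on the image agrees with the quotient structure. -/
theorem smoothAt_phiTildeIrr_iff [NeZero ℓ] [NeZero n] (f : LHomIrr ℓ n → ℝ) (x : LambdaIrr ℓ n) :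
    SmoothAt f (phiTildeIrr x) ↔ SmoothAt (f ∘ phiTildeIrr) x := by
  refine ⟨isSmoothMap_phiTildeIrr.2 x f, fun h => ?_⟩
  have h1 := (isModel_irrCoords.smoothAt_comp isModel_irrReflOps
    (eventually_phaseSection x).self_of_nhds.1).2 (f ∘ phiTildeIrr)
  rw [phaseSection_self] at h1
  have h2 : (f ∘ phiTildeIrr) ∘ phaseSection x = f := by
    funext ρ
    simp only [Function.comp_apply, phiTildeIrr_phaseSection]
  rw [← h2]
  exact h1 h

variable (n) in
/-- Multiplication by complex numbers, as a linear map. -/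
def scalarOpL : ℂ →L[ℝ] RealOp n :=
  LinearMap.toContinuousLinearMap
    { toFun := scalarOp
      map_add' := fun z w => by
        ext1 v
        exact add_smul z w v
      map_smul' := fun r z => by
        ext1 v
        exact smul_assoc r z v }

theorem contDiff_scalarOp : ContDiff ℝ ω (scalarOp : ℂ → RealOp n) := (scalarOpL n).contDiff

theorem hasDerivAt_scalarOp_exp :
    HasDerivAt (fun t : ℝ => (scalarOp (Circle.exp t : ℂ) : RealOp n)) (scalarOp Complex.I) 0 := by
  have h1 : HasDerivAt (fun t : ℝ => (Circle.exp t : ℂ)) Complex.I 0 := by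
    have h2 := ((Complex.ofRealCLM.hasDerivAt (x := 0)).mul_const Complex.I).cexp
    simpa using h2
  exact (scalarOpL n).hasFDerivAt.comp_hasDerivAt 0 h1

theorem nearSmooth_scalarOp_mul {V : Type*} [NormedAddCommGroup V] [NormedSpace ℝ V] {v : V}
    {g : V → ℂ} {F : V → Fin ℓ → RealOp n} (hg : NearSmooth g v) (hF : NearSmooth F v) :
    NearSmooth (fun v s => scalarOp (g v) * F v s) v := by
  filter_upwards [hg, hF] with y h1 h2
  exact contDiffAt_pi.2 fun s =>
    ContDiffAt.mul ((scalarOpL n).contDiff.contDiffAt.comp y h1) (contDiffAt_pi.1 h2 s)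

/-- The circle is parametrised by t ↦ exp(it). Freeness reduces the stabilizer condition to
continuity of the argument at 1, and the generator of the action has the non-zero entries iR_s. -/
theorem exists_chart_LHomIrr [NeZero ℓ] [NeZero n] (x : LambdaIrr ℓ n) {d : ℕ}
    (hd : d + 1 = ℓ * (n + 1).choose 2) :
    ∃ e' : OpenPartialHomeomorph (LHomIrr ℓ n) (EuclideanSpace ℝ (Fin d)),
      phiTildeIrr x ∈ e'.source ∧ IsSmoothChart e' := by
  have hfin : FiniteDimensional ℝ (TupleTangent n ℓ) := inferInstance
  refine exists_quotient_chart (K := Circle) (W := ℝ) (isSmoothChart_irrChart x)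
    (mem_irrChart_source x) irrReflOps (cayleyCoord x.1)
    (contDiffAt_irrChart (mem_irrChart_source x)) (fun _ _ => rfl)
    (contDiffAt_irrChart_symm x ((irrChart x).map_source (mem_irrChart_source x)))
    (fun t => Circle.exp t) Circle.exp_zero Circle.exp.continuous.continuousAt ?_
    (fun q : ℝ × (Fin ℓ → RealOp n) => fun s => scalarOp (Circle.exp q.1 : ℂ) * q.2 s) ?_
    (fun t x => irrReflOps_circle_smul _ x)
    (ContinuousLinearMap.toSpanSingleton ℝ (fun s => scalarOp Complex.I * irrReflOps x s)) ?_ ?_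
    isOpenMap_phiTildeIrr isSmoothMap_phiTildeIrr.1 smoothAt_phiTildeIrr_iff phiTildeIrr_eq_iff ?_
  · intro g hg S hS
    rw [eq_one_of_circle_smul_eq hg]
    have h1 : ContinuousAt (fun h : Circle => Complex.arg (h : ℂ)) 1 := by
      refine ContinuousAt.comp (g := Complex.arg) (Complex.continuousAt_arg ?_)
        isModel_circle.continuous.continuousAt
      rw [Circle.coe_one]
      exact Complex.one_mem_slitPlane
    have h2 : ∀ᶠ h : Circle in 𝓝 1, Complex.arg (h : ℂ) ∈ S := h1.eventually_mem (by
      rw [Circle.coe_one, Complex.arg_one]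
      exact hS)
    filter_upwards [h2] with h hh
    exact ⟨_, hh, fun x => by rw [Circle.exp_arg]⟩
  · refine contDiffAt_pi.2 fun s => ContDiffAt.mul ?_ ?_
    · refine (contDiff_scalarOp.comp ?_).contDiffAt
      simp only [Circle.coe_exp]
      exact Complex.contDiff_exp.comp
        ((Complex.ofRealCLM.contDiff.comp contDiff_fst).mul contDiff_const)
    · exact ((contDiff_apply ℝ _ s).comp contDiff_snd).contDiffAt
  · rw [hasFDerivAt_pi']
    intro s
    have h1 := ((hasDerivAt_scalarOp_exp (n := n)).mul_const (irrReflOps x s)).hasFDerivAt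
    exact h1
  · rw [injective_iff_map_eq_zero]
    intro t ht
    have h1 := DFunLike.congr_fun (congrFun ht 0) (reflOp (x.1 0) (unitVec n))
    have h2 : t • (Complex.I • reflOp (x.1 0) (reflOp (x.1 0) (unitVec n))) = 0 := h1
    have h3 : reflOp (x.1 0) (reflOp (x.1 0) (unitVec n)) = unitVec n :=
      DFunLike.congr_fun (reflOp_mul_reflOp (x.1 0)) (unitVec n)
    rw [h3] at h2
    refine (smul_eq_zero.1 h2).resolve_right fun h4 => ?_
    have h5 := inner_unitVec (n := n) Complex.I
    rw [h4, inner_zero_right] at h5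
    exact Complex.I_ne_zero h5.symm
  · rw [finrank_tupleTangent, Module.finrank_self, hd]

theorem isSmoothManifold_LHomIrr [NeZero ℓ] [NeZero n] {d : ℕ}
    (hd : d + 1 = ℓ * (n + 1).choose 2) : IsEmbeddedSubmanifold (LHomIrr ℓ n) d := by
  refine isSmoothManifold_of_charts fun ρ => ?_
  obtain ⟨x, rfl⟩ := exists_phiTildeIrr_eq ρ
  exact exists_chart_LHomIrr x hd

theorem unitPhase_eq_div {z : ℂ} (hz : z ≠ 0) : (unitPhase z : ℂ) = (‖z‖⁻¹ : ℝ) * z := by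
  have h1 := norm_mul_unitPhase z
  have h2 : (‖z‖ : ℂ) ≠ 0 := by simpa using hz
  rw [Complex.ofReal_inv, eq_inv_mul_iff_mul_eq₀ h2, h1]

theorem contDiffAt_unitPhase {z : ℂ} (hz : z ≠ 0) :
    ContDiffAt ℝ ω (fun w => (unitPhase w : ℂ)) z := by
  have h1 : ContDiffAt ℝ ω (fun w : ℂ => ((‖w‖⁻¹ : ℝ) : ℂ) * w) z :=
    (Complex.ofRealCLM.contDiff.contDiffAt.comp z
      ((contDiffAt_norm ℝ hz).inv (norm_ne_zero_iff.2 hz))).mul contDiffAt_id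
  refine h1.congr_of_eventuallyEq ?_
  filter_upwards [isOpen_ne.mem_nhds hz] with w hw
  exact unitPhase_eq_div hw

/-- The trivialisation sends (ρ, z) to z times the section at ρ; its inverse records the
representation together with the relative phase, which is smooth away from zero. -/
theorem isCircleBundle_phiTildeIrr [NeZero ℓ] [NeZero n] :
    IsCircleBundle (phiTildeIrr : LambdaIrr ℓ n → LHomIrr ℓ n) := by
  refine ⟨isSmoothMap_phiTildeIrr, fun ρ => ?_⟩
  obtain ⟨x, rfl⟩ := exists_phiTildeIrr_eq ρ
  obtain ⟨U, hU, hUo, hxU⟩ := eventually_nhds_iff.1 (eventually_phaseSection x)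
  have hmU : IsModel (fun ρ : U => irrCoords ρ.1) := isModel_irrCoords.subtype _
  have hmP : IsModel (fun y : (phiTildeIrr : LambdaIrr ℓ n → _) ⁻¹' U => irrReflOps y.1) :=
    isModel_irrReflOps.subtype _
  have hm := hmU.prod isModel_circle
  let Ψ : U × Circle → (phiTildeIrr : LambdaIrr ℓ n → _) ⁻¹' U := fun q =>
    ⟨q.2 • phaseSection x q.1.1, by
      rw [Set.mem_preimage, phiTildeIrr_circle_smul, phiTildeIrr_phaseSection]
      exact q.1.2⟩
  let Φ : (phiTildeIrr : LambdaIrr ℓ n → _) ⁻¹' U → U × Circle := fun y =>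
    (⟨phiTildeIrr y.1, y.2⟩, unitPhase (relPhase x.1 y.1.1))
  refine ⟨U, hUo, hxU, Ψ, ⟨?_, Φ, ?_, ?_, ?_⟩, fun q => ?_⟩
  · refine hm.isSmoothMap hmP fun q => ?_
    obtain ⟨F, hF, he⟩ := (hU q.1.1 q.1.2).1
    refine ⟨fun p => fun s => scalarOp p.2 * F p.1 s, ?_, ?_⟩
    · exact nearSmooth_scalarOp_mul (contDiff_snd.nearSmooth _)
        (NearSmooth.comp (g := F) (f := Prod.fst) _ hF (contDiff_fst.nearSmooth _))
    · have h1 : Tendsto (fun q : U × Circle => q.1.1) (𝓝 q) (𝓝 q.1.1) :=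
        (continuous_subtype_val.comp continuous_fst).continuousAt
      filter_upwards [h1.eventually he] with q' hq'
      funext s
      have h2 := congrFun (irrReflOps_circle_smul q'.2 (phaseSection x q'.1.1)) s
      refine h2.trans ?_
      exact congrArg (fun Y => scalarOp (q'.2 : ℂ) * Y) (congrFun hq' s)
  · refine hmP.isSmoothMap hm fun y => ?_
    have h0 : relPhase x.1 y.1.1 ≠ 0 := (hU _ y.2).2 y.1 rfl
    let τ : (Fin ℓ → RealOp n) → ℂ := fun X =>
      inner ℂ (unitVec n) (X 0 (reflOp (x.1 0) (unitVec n)))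
    have hτ : ContDiff ℝ ω τ := by
      have h1 : ContDiff ℝ ω fun X : Fin ℓ → RealOp n => X 0 (reflOp (x.1 0) (unitVec n)) :=
        (contDiff_apply ℝ _ (0 : Fin ℓ)).clm_apply contDiff_const
      exact contDiff_const.inner ℂ h1
    refine ⟨fun X => (opsToCoords X, (unitPhase (τ X) : ℂ)), ?_, .of_forall fun y' => ?_⟩
    · refine (contDiff_opsToCoords.contDiffAt.prodMk ?_).nearSmooth
      exact ContDiffAt.comp (g := fun w => (unitPhase w : ℂ)) (irrReflOps y.1)
        (contDiffAt_unitPhase h0) hτ.contDiffAt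
    · exact Prod.ext (opsToCoords_reflOps y'.1.1).symm rfl
  · rintro ⟨ρ, z⟩
    obtain ⟨x', hx'⟩ := exists_phiTildeIrr_eq ρ.1
    have h0 := (hU ρ.1 ρ.2).2 x' hx'
    refine Prod.ext (Subtype.ext ?_) ?_
    · change phiTildeIrr (z • phaseSection x ρ.1) = ρ.1
      rw [phiTildeIrr_circle_smul, phiTildeIrr_phaseSection]
    · change unitPhase (relPhase x.1 (z • phaseSection x ρ.1 : LambdaIrr ℓ n).1) = z
      rw [← hx', phaseSection_phiTildeIrr h0, coe_circle_smul, coe_circle_smul, smul_smul,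
        relPhase_circle_smul, unitPhase_circle_mul _ h0, inv_mul_cancel_right]
  · intro y
    have h0 : relPhase x.1 y.1.1 ≠ 0 := (hU _ y.2).2 y.1 rfl
    apply Subtype.ext
    change unitPhase (relPhase x.1 y.1.1) • phaseSection x (phiTildeIrr y.1) = y.1
    rw [phaseSection_phiTildeIrr h0, smul_inv_smul]
  · change phiTildeIrr (q.2 • phaseSection x q.1.1) = q.1.1
    rw [phiTildeIrr_circle_smul, phiTildeIrr_phaseSection]

end CircleBundle

end LagrangianRep

/-! ### Proper actions and derivatives of conjugations -/

namespace SmoothSpace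

open Filter Topology

/-- The map (k, x) ↦ (k, k • x, x) is a closed embedding, and forgetting the compact factor is
proper. It is used to make the moduli space Hausdorff. -/
theorem properSMul_of_compactSpace {K X : Type*} [Group K] [TopologicalSpace K] [CompactSpace K]
    [T2Space K] [TopologicalSpace X] [T2Space X] [MulAction K X] [ContinuousSMul K X] :
    ProperSMul K X where
  isProperMap_smul_pair := by
    have h1 : IsProperMap (Prod.snd : K × (X × X) → X × X) := isProperMap_snd_of_compactSpace
    have h2 : IsClosedEmbedding fun p : K × X => (p.1, (p.1 • p.2, p.2)) :=
      Function.LeftInverse.isClosedEmbedding (f := fun q : K × (X × X) => (q.1, q.2.2))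
        (fun _ => rfl) (by fun_prop) (by fun_prop)
    exact h1.comp h2.isProperMap

theorem exists_hasFDerivAt_mul_mul {W A : Type*} [NormedAddCommGroup W] [NormedSpace ℝ W]
    [NormedRing A] [NormedAlgebra ℝ A] {u v : W → A} {u' v' : W →L[ℝ] A} {x : W}
    (hu : HasFDerivAt u u' x) (hv : HasFDerivAt v v' x) (hu1 : u x = 1) (hv1 : v x = 1) (y : A) :
    ∃ B : W →L[ℝ] A, (∀ w, B w = u' w * y + y * v' w) ∧
      HasFDerivAt (fun w => u w * y * v w) B x := by
  have h := (hu.mul_const' y).mul' hv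
  refine ⟨_, fun w => ?_, h⟩
  simp [hu1, hv1, add_comm]

theorem hasFDerivAt_star_comp {W A : Type*} [NormedAddCommGroup W] [NormedSpace ℝ W]
    [CStarAlgebra A] {u : W → A} {u' : W →L[ℝ] A} {x : W} (hu : HasFDerivAt u u' x) :
    HasFDerivAt (fun w => star (u w)) (((starL' ℝ : A ≃L[ℝ] A) : A →L[ℝ] A).comp u') x :=
  hu.star

theorem contDiff_star_of_cstar {A : Type*} [CStarAlgebra A] : ContDiff ℝ ω (star : A → A) :=
  (starL' ℝ : A ≃L[ℝ] A).contDiff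

end SmoothSpace

namespace LagrangianRep

open Filter Topology SmoothSpace Lagrangian

/-! ### The quotient of irreducible tuples by U(n) -/

section UnitaryQuotient

variable {n ℓ : ℕ}

theorem hasFDerivAt_cayley_comp {k : ℕ} (T : (Fin k → ℝ) →L[ℝ] CxOp n) :
    HasFDerivAt (fun w => cayley (T w)) ((2 : ℝ) • T) 0 := by
  have h1 : HasFDerivAt (cayley : CxOp n → CxOp n) ((2 : ℝ) • ContinuousLinearMap.id ℝ (CxOp n))
      (T 0) := by
    rw [map_zero]
    exact hasFDerivAt_cayley_zero (A := CxOp n)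
  have h2 := h1.comp (0 : Fin k → ℝ) T.hasFDerivAt
  exact h2

theorem isUnit_one_add_one : IsUnit ((1 : CxOp n) + 1) := by
  have h1 : (1 : CxOp n) + 1 = (2 : ℂ) • (1 : CxOp n) := (two_smul ℂ (1 : CxOp n)).symm
  rw [h1]
  exact isUnit_one.smul (Units.mk0 (2 : ℂ) two_ne_zero)

/-- Where h + 1 is invertible, the inverse Cayley transform supplies the parameter, and it tends to
0 as h tends to 1. -/
theorem eventually_cayleyU {S : Set (Fin (n ^ 2) → ℝ)} (hS : S ∈ 𝓝 0) :
    ∀ᶠ h : U n in 𝓝 1, ∃ w ∈ S, cayleyU w = h := by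
  have hc := continuous_unitary_coe (n := n)
  have h1 : ∀ᶠ h : U n in 𝓝 1, IsUnit ((h : CxOp n) + 1) :=
    (hc.add continuous_const).continuousAt.eventually (Units.isOpen.mem_nhds isUnit_one_add_one)
  have h2 : ContinuousAt (fun h : U n => skewProj n (cayleyInv (h : CxOp n))) 1 := by
    refine (skewProj n).continuous.continuousAt.comp ?_
    exact ContinuousAt.comp (g := cayleyInv) (f := fun h : U n => (h : CxOp n))
      (contDiffAt_cayleyInv isUnit_one_add_one).continuousAt hc.continuousAt
  have h3 : ∀ᶠ h : U n in 𝓝 1, skewProj n (cayleyInv (h : CxOp n)) ∈ S := by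
    refine h2.eventually_mem ?_
    have h4 : skewProj n (cayleyInv ((1 : U n) : CxOp n)) = 0 := by
      have h5 : cayleyInv ((1 : U n) : CxOp n) = 0 := cayleyInv_one
      rw [h5, map_zero]
    rw [h4]
    exact hS
  filter_upwards [h1, h3] with h hu hm
  refine ⟨_, hm, Subtype.ext ?_⟩
  rw [coe_cayleyU, skewParam_skewProj (star_cayleyInv h.2 hu), cayley_cayleyInv hu]

instance (priority := 2000) : SMul (U n) (LambdaIrr ℓ n) :=
  (inferInstance : MulAction (U n) (LambdaIrr ℓ n)).toSMul

instance : ContinuousSMul (U n) (LambdaIrr ℓ n) where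
  continuous_smul :=
    (continuous_fst.smul (continuous_subtype_val.comp continuous_snd)).subtype_mk _

theorem irrReflOps_smul (g : U n) (x : LambdaIrr ℓ n) :
    irrReflOps (g • x) =
      fun s => toReal (g : CxOp n) * irrReflOps x s * toReal (star (g : CxOp n)) :=
  funext fun s => reflOp_smul g (x.1 s)

theorem smul_irr_eq_self_iff [NeZero ℓ] [NeZero n] (x : LambdaIrr ℓ n) (g : U n) :
    g • x = x ↔ g = 1 ∨ g = -1 := by
  rw [← smul_eq_self_iff x.2]
  exact Subtype.ext_iff

theorem neg_smul_irr (g : U n) (x : LambdaIrr ℓ n) : (-g) • x = g • x := by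
  have h1 : -g = g * (-1) := Subtype.ext (by
    change -(g : CxOp n) = (g : CxOp n) * -1
    rw [CxOp.mul_neg, mul_one])
  rw [h1, mul_smul]
  congr 1
  exact Subtype.ext (neg_one_smul_eq x.1)

theorem continuous_neg_unitary : Continuous fun g : U n => -g := by
  have h1 : Continuous fun g : U n => -(g : CxOp n) := continuous_unitary_coe.neg
  exact Topology.IsInducing.subtypeVal.continuous_iff.2 h1

theorem isSmoothMap_smul_lambdaIrr (g : U n) : IsSmoothMap fun x : LambdaIrr ℓ n => g • x := by
  refine isModel_irrReflOps.isSmoothMap isModel_irrReflOps fun x => ?_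
  refine ⟨fun X s => toReal (g : CxOp n) * X s * toReal (star (g : CxOp n)), ?_,
    .of_forall fun x' => irrReflOps_smul g x'⟩
  exact (contDiff_pi.2 fun s => (contDiff_const.mul (contDiff_apply ℝ _ s)).mul
    contDiff_const).nearSmooth _

/-- Infinitesimal form of the finiteness of stabilizers: Schur makes the operator a scalar,
anti-linearity of a reflection makes it real, and skewness makes it imaginary. -/
theorem eq_zero_of_skew_of_commute [NeZero ℓ] [NeZero n] (x : LambdaIrr ℓ n) {a : CxOp n}
    (ha : star a = -a)
    (h : ∀ s, toReal a * irrReflOps x s = irrReflOps x s * toReal a) : a = 0 := by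
  obtain ⟨z, rfl⟩ := exists_scalar_of_commute x.2 h
  have h1 : (scalarOp (starRingEnd ℂ z) : RealOp n) = scalarOp (-z) := by
    rw [← star_scalarOp, scalarOp, ← toReal_star, ha, scalarOp]
    exact congrArg toReal (neg_smul z (1 : CxOp n)).symm
  have h2 : scalarOp z * reflOp (x.1 0) = scalarOp (starRingEnd ℂ z) * reflOp (x.1 0) :=
    (h 0).trans ((isReflection_reflOp (x.1 0)).mul_scalarOp z)
  have h3 := congrArg (fun X => X * reflOp (x.1 0)) h2
  simp only [mul_assoc, reflOp_mul_reflOp, mul_one] at h3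
  have h4 := scalarOp_injective (h3.trans h1)
  have h5 : z = 0 := self_eq_neg.1 h4
  rw [h5]
  exact zero_smul ℂ (1 : CxOp n)

/-- Charts for the orbit space of the unitary group on the irreducible tuples. -/
theorem exists_chart_unitary_quotient [NeZero ℓ] [NeZero n] {Y : Type*} [TopologicalSpace Y]
    [SmoothSpace Y] {p : LambdaIrr ℓ n → Y} (hpo : IsOpenMap p) (hpc : Continuous p)
    (hp : ∀ (f : Y → ℝ) (x : LambdaIrr ℓ n), SmoothAt f (p x) ↔ SmoothAt (f ∘ p) x)
    (hfib : ∀ x x', p x = p x' ↔ ∃ g : U n, g • x = x') (x : LambdaIrr ℓ n) {d : ℕ}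
    (hd : d + n ^ 2 = ℓ * (n + 1).choose 2) :
    ∃ e' : OpenPartialHomeomorph Y (EuclideanSpace ℝ (Fin d)),
      p x ∈ e'.source ∧ IsSmoothChart e' := by
  have hfin : FiniteDimensional ℝ (TupleTangent n ℓ) := inferInstance
  let u : (Fin (n ^ 2) → ℝ) → CxOp n := fun w => cayley (skewParam n w)
  have hu0 : u 0 = 1 := by
    change cayley (skewParam n 0) = 1
    rw [map_zero, cayley_zero]
  have hud : HasFDerivAt u ((2 : ℝ) • skewParam n) 0 := hasFDerivAt_cayley_comp (skewParam n)
  have huc : ∀ w, ContDiffAt ℝ ω u w := fun w =>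
    ContDiffAt.comp (g := cayley) w
      (contDiffAt_cayley (isUnit_one_sub_skew (star_skewParam w))) (skewParam n).contDiff.contDiffAt
  have husd : HasFDerivAt (fun w => star (u w))
      (((starL' ℝ : CxOp n ≃L[ℝ] CxOp n) : CxOp n →L[ℝ] CxOp n).comp ((2 : ℝ) • skewParam n)) 0 :=
    hasFDerivAt_star_comp hud
  have hB : ∀ s, ∃ B : (Fin (n ^ 2) → ℝ) →L[ℝ] RealOp n,
      (∀ w, B w = toReal ((2 : ℝ) • skewParam n w) * irrReflOps x s +
        irrReflOps x s * toReal (star ((2 : ℝ) • skewParam n w))) ∧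
      HasFDerivAt (fun w => toReal (u w) * irrReflOps x s * toReal (star (u w))) B 0 := fun s =>
    exists_hasFDerivAt_mul_mul (A := RealOp n)
      ((toReal (n := n)).hasFDerivAt.comp (0 : Fin (n ^ 2) → ℝ) hud)
      ((toReal (n := n)).hasFDerivAt.comp (0 : Fin (n ^ 2) → ℝ) husd)
      (by simp only [Function.comp_apply]; rw [hu0, toReal_one])
      (by simp only [Function.comp_apply]; rw [hu0, star_one, toReal_one]) _
  choose B hBw hBd using hB
  refine exists_quotient_chart (K := U n) (W := Fin (n ^ 2) → ℝ) (isSmoothChart_irrChart x)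
    (mem_irrChart_source x) irrReflOps (cayleyCoord x.1)
    (contDiffAt_irrChart (mem_irrChart_source x)) (fun _ _ => rfl)
    (contDiffAt_irrChart_symm x ((irrChart x).map_source (mem_irrChart_source x)))
    cayleyU (Subtype.ext hu0) ?_ ?_
    (fun q : (Fin (n ^ 2) → ℝ) × (Fin ℓ → RealOp n) =>
      fun s => toReal (u q.1) * q.2 s * toReal (star (u q.1))) ?_
    (fun w x => irrReflOps_smul _ x)
    (ContinuousLinearMap.pi B) ?_ ?_
    hpo hpc hp hfib ?_
  · exact Topology.IsInducing.subtypeVal.continuousAt_iff.2 (huc 0).continuousAt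
  · intro g hg S hS
    rcases (smul_irr_eq_self_iff x g).1 hg with rfl | rfl
    · filter_upwards [eventually_cayleyU hS] with h hh
      obtain ⟨w, hw, rfl⟩ := hh
      exact ⟨w, hw, fun _ => rfl⟩
    -- Near −1 the parameter of −h is used, which is harmless because h and −h act alike.
    · have h1 : Tendsto (fun g : U n => -g) (𝓝 (-1)) (𝓝 1) := by
        have := (continuous_neg_unitary (n := n)).tendsto (-1)
        have h2 : -(-1 : U n) = 1 := neg_neg (1 : U n)
        rwa [h2] at this
      filter_upwards [h1.eventually (eventually_cayleyU hS)] with h hh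
      obtain ⟨w, hw, e⟩ := hh
      exact ⟨w, hw, fun y => by rw [e, neg_smul_irr]⟩
  · have h1 : ContDiffAt ℝ ω (fun q : (Fin (n ^ 2) → ℝ) × (Fin ℓ → RealOp n) => u q.1)
        (0, irrReflOps x) := ContDiffAt.comp (g := u) (f := Prod.fst) _ (huc 0) contDiffAt_fst
    have h2 : ContDiffAt ℝ ω (fun q : (Fin (n ^ 2) → ℝ) × (Fin ℓ → RealOp n) => star (u q.1))
        (0, irrReflOps x) := (contDiff_star_of_cstar (A := CxOp n)).contDiffAt.comp _ h1
    exact contDiffAt_pi.2 fun s => (((toReal (n := n)).contDiff.contDiffAt.comp _ h1).mul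
      ((contDiff_apply ℝ _ s).comp contDiff_snd).contDiffAt).mul
      ((toReal (n := n)).contDiff.contDiffAt.comp _ h2)
  · exact hasFDerivAt_pi.2 hBd
  -- The derivative of conjugation by a Cayley transform is the commutator with 2w, so its kernel
  -- consists of skew operators commuting with all the reflections.
  · rw [injective_iff_map_eq_zero]
    intro w hw
    have h1 : skewParam n w = 0 := by
      have h2 : ∀ s, toReal (skewParam n ((2 : ℝ) • w)) * irrReflOps x s =
          irrReflOps x s * toReal (skewParam n ((2 : ℝ) • w)) := fun s => by
        have h3 : B s w = 0 := congrFun hw s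
        rw [hBw, ← map_smul, star_skewParam, map_neg, RealOp.mul_neg, ← sub_eq_add_neg] at h3
        exact sub_eq_zero.1 h3
      have h4 := eq_zero_of_skew_of_commute x (star_skewParam _) h2
      have h5 : (2 : ℝ) • w = 0 := by
        rw [← skewProj_skewParam ((2 : ℝ) • w), h4, map_zero]
      rw [(smul_eq_zero.1 h5).resolve_left two_ne_zero, map_zero]
    rw [← skewProj_skewParam w, h1, map_zero]
  · rw [finrank_tupleTangent, Module.finrank_fintype_fun_eq_card, Fintype.card_fin, hd]

end UnitaryQuotient

end LagrangianRep

namespace LagrangianRep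

open Filter Topology SmoothSpace Lagrangian

/-! ### Slices for the conjugation of matrix tuples -/

section ConjugationSlice

variable {n ℓ : ℕ}

variable (n) in
/-- The skew-adjoint operators whose first matrix entry vanishes, a complement of the scalars. -/
def normSkew [NeZero n] : Submodule ℝ (CxOp n) where
  carrier := {w | star w = -w ∧ (inner ℂ (unitVec n) (w (unitVec n))).im = 0}
  add_mem' {a b} ha hb := by
    refine ⟨(skewOp n).add_mem ha.1 hb.1, ?_⟩
    change (inner ℂ (unitVec n) (a (unitVec n) + b (unitVec n))).im = 0
    rw [inner_add_right, Complex.add_im, ha.2, hb.2, add_zero]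
  zero_mem' := by
    refine ⟨(skewOp n).zero_mem, ?_⟩
    change (inner ℂ (unitVec n) (0 : Cn n)).im = 0
    rw [inner_zero_right, Complex.zero_im]
  smul_mem' r a ha := by
    refine ⟨(skewOp n).smul_mem r ha.1, ?_⟩
    change (inner ℂ (unitVec n) (r • a (unitVec n))).im = 0
    rw [inner_smul_right_eq_smul (unitVec n) (a (unitVec n)) r, Complex.smul_im, ha.2, smul_zero]

variable (n) in
/-- The dimension of `normSkew n`. -/
def normSkewDim [NeZero n] : ℕ := Module.finrank ℝ (normSkew n)

variable (n) in
/-- Coordinates on `normSkew n`. -/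
def normSkewParam [NeZero n] : (Fin (normSkewDim n) → ℝ) →L[ℝ] CxOp n :=
  (exists_param (normSkew n) rfl).choose

variable (n) in
/-- A left inverse of `normSkewParam n`. -/
def normSkewProj [NeZero n] : CxOp n →L[ℝ] (Fin (normSkewDim n) → ℝ) :=
  (exists_param (normSkew n) rfl).choose_spec.choose

theorem normSkewProj_normSkewParam [NeZero n] (w : Fin (normSkewDim n) → ℝ) :
    normSkewProj n (normSkewParam n w) = w :=
  (exists_param (normSkew n) rfl).choose_spec.choose_spec.1 w

theorem mem_normSkew_iff [NeZero n] {a : CxOp n} :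
    a ∈ normSkew n ↔ ∃ w, normSkewParam n w = a :=
  (exists_param (normSkew n) rfl).choose_spec.choose_spec.2 a

theorem normSkewParam_mem [NeZero n] (w : Fin (normSkewDim n) → ℝ) :
    normSkewParam n w ∈ normSkew n :=
  mem_normSkew_iff.2 ⟨w, rfl⟩

theorem normSkewParam_normSkewProj [NeZero n] {a : CxOp n} (ha : a ∈ normSkew n) :
    normSkewParam n (normSkewProj n a) = a := by
  obtain ⟨w, rfl⟩ := mem_normSkew_iff.1 ha
  rw [normSkewProj_normSkewParam]

/-- The Cayley transform on `normSkew n`. -/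
def normCayley [NeZero n] (w : Fin (normSkewDim n) → ℝ) : U n :=
  ⟨cayley (normSkewParam n w), cayley_mem_unitary (normSkewParam_mem w).1
    (isUnit_one_sub_skew (normSkewParam_mem w).1)⟩

/-- The first entry of the Cayley transform of a scalar. -/
theorem im_inner_cayleyInv_scalar [NeZero n] (t : ℝ)
    (h : IsUnit (((scalarUnitary (Circle.exp t) : U n) : CxOp n) + 1)) :
    (inner ℂ (unitVec n) (cayleyInv ((scalarUnitary (Circle.exp t) : U n) : CxOp n)
      (unitVec n))).im * (Real.cos t + 1) = Real.sin t := by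
  have hs := star_cayleyInv (scalarUnitary (Circle.exp t) : U n).2 h
  have hm := cayleyInv_mul h
  set y := cayleyInv ((scalarUnitary (Circle.exp t) : U n) : CxOp n)
  set z : ℂ := (Circle.exp t : ℂ) with hz
  have h1 : y (z • unitVec n + unitVec n) = z • unitVec n - unitVec n :=
    DFunLike.congr_fun hm (unitVec n)
  have h2 : z * inner ℂ (unitVec n) (y (unitVec n)) + inner ℂ (unitVec n) (y (unitVec n)) =
      z - 1 := by
    have h3 := congrArg (fun v => inner ℂ (unitVec n) v) h1
    simp only [map_add, map_smul, inner_add_right, inner_smul_right, inner_sub_right] at h3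
    have h4 : inner ℂ (unitVec n) (unitVec n) = (1 : ℂ) := by
      have := inner_unitVec (n := n) 1
      rwa [one_smul] at this
    rw [h3, h4, mul_one]
  have hre := re_inner_skew hs (unitVec n)
  set c := inner ℂ (unitVec n) (y (unitVec n))
  have h5 := congrArg Complex.im h2
  have hzr : z.re = Real.cos t := by rw [hz, Circle.coe_exp, Complex.exp_ofReal_mul_I_re]
  have hzi : z.im = Real.sin t := by rw [hz, Circle.coe_exp, Complex.exp_ofReal_mul_I_im]
  simp only [Complex.add_im, Complex.mul_im, Complex.sub_im, Complex.one_im, hre, hzr, hzi] at h5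
  linarith

theorem continuous_scalarUnitary : Continuous fun z : Circle => (scalarUnitary z : U n) :=
  Topology.IsInducing.subtypeVal.continuous_iff.2
    (isModel_circle.continuous.smul continuous_const)

theorem scalarUnitary_mul (z w : Circle) :
    (scalarUnitary (z * w) : U n) = scalarUnitary z * scalarUnitary w := by
  apply Subtype.ext
  change ((z : ℂ) * w) • (1 : CxOp n) = ((z : ℂ) • 1) * ((w : ℂ) • 1)
  rw [smul_mul_smul_comm, mul_one]

theorem scalarUnitary_one : (scalarUnitary 1 : U n) = 1 :=
  Subtype.ext (one_smul ℂ (1 : CxOp n))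

/-- Every unitary operator close to the identity is a scalar times the Cayley transform of a small
element of `normSkew n`. -/
theorem eventually_normCayley [NeZero n] {S : Set (Fin (normSkewDim n) → ℝ)} (hS : S ∈ 𝓝 0) :
    ∀ᶠ h : U n in 𝓝 1, ∃ w ∈ S, ∃ z : Circle, h = scalarUnitary z * normCayley w := by
  let T : ℝ × U n → CxOp n := fun q => ((scalarUnitary (Circle.exp q.1) * q.2 : U n) : CxOp n)
  have hTc : Continuous T := continuous_unitary_coe.comp
    ((continuous_scalarUnitary.comp (Circle.exp.continuous.comp continuous_fst)).mul continuous_snd)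
  have hT0 : T (0, 1) = 1 := by
    change ((scalarUnitary (Circle.exp 0) * 1 : U n) : CxOp n) = 1
    rw [Circle.exp_zero, scalarUnitary_one, mul_one]
    rfl
  have hU1 : IsUnit (T (0, 1) + 1) := by
    rw [hT0]
    exact isUnit_one_add_one
  have h1 : ∀ᶠ q in 𝓝 ((0 : ℝ), (1 : U n)), IsUnit (T q + 1) :=
    (hTc.add continuous_const).continuousAt.eventually (Units.isOpen.mem_nhds hU1)
  have hGc : ∀ q, IsUnit (T q + 1) → ContinuousAt (fun q => cayleyInv (T q)) q := fun q hq =>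
    ContinuousAt.comp (g := cayleyInv) (contDiffAt_cayleyInv hq).continuousAt hTc.continuousAt
  have h2 : ∀ᶠ q in 𝓝 ((0 : ℝ), (1 : U n)), normSkewProj n (cayleyInv (T q)) ∈ S := by
    have h3 : ContinuousAt (fun q => normSkewProj n (cayleyInv (T q))) ((0 : ℝ), (1 : U n)) :=
      (normSkewProj n).continuous.continuousAt.comp (hGc _ hU1)
    refine h3.eventually_mem ?_
    rw [hT0, cayleyInv_one, map_zero]
    exact hS
  have h12 := h1.and h2
  rw [nhds_prod_eq, eventually_prod_iff] at h12
  obtain ⟨pa, hpa, pb, hpb, hab⟩ := h12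
  obtain ⟨ε, hε, hball⟩ := Metric.eventually_nhds_iff_ball.1 hpa
  -- The bound ε / 2 keeps [−δ, δ] inside the ball where everything is defined; the bound 1 makes
  -- sin δ and cos δ + 1 positive.
  let δ := min (ε / 2) 1
  have hδ0 : 0 < δ := lt_min (by linarith) one_pos
  have hδ1 : δ ≤ 1 := min_le_right _ _
  have hpaδ : ∀ t ∈ Set.Icc (-δ) δ, pa t := fun t ht => by
    apply hball
    rw [mem_ball_zero_iff, Real.norm_eq_abs]
    have h3 : |t| ≤ δ := abs_le.2 ht
    have h4 : δ ≤ ε / 2 := min_le_left _ _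
    linarith
  -- At h = 1 this function of t is tan(t/2), with opposite signs at ±δ. The signs persist for h
  -- near 1, so the intermediate value theorem finds t for which the inverse Cayley transform of
  -- exp(it)h lies in `normSkew n`; the factor exp(−it) is the required scalar.
  let φ : ℝ × U n → ℝ := fun q => (inner ℂ (unitVec n) (cayleyInv (T q) (unitVec n))).im
  have hφc : ∀ q, IsUnit (T q + 1) → ContinuousAt φ q := fun q hq => by
    have h3 : ContinuousAt (fun q => cayleyInv (T q) (unitVec n)) q :=
      (hGc q hq).clm_apply continuousAt_const
    exact Complex.continuous_im.continuousAt.comp (continuousAt_const.inner h3)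
  have hpb1 : pb 1 := hpb.self_of_nhds
  have hT1 : ∀ t, T (t, 1) = ((scalarUnitary (Circle.exp t) : U n) : CxOp n) := fun t => by
    change ((scalarUnitary (Circle.exp t) * 1 : U n) : CxOp n) = _
    rw [mul_one]
  have hsgn : ∀ t ∈ Set.Icc (-δ) δ, φ (t, 1) * (Real.cos t + 1) = Real.sin t := fun t ht => by
    have h3 := (hab (hpaδ t ht) hpb1).1
    rw [hT1] at h3
    have h4 := im_inner_cayleyInv_scalar t h3
    rw [← hT1] at h4
    exact h4
  have hmδ : δ ∈ Set.Icc (-δ) δ := ⟨by linarith, le_rfl⟩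
  have hmδ' : -δ ∈ Set.Icc (-δ) δ := ⟨le_rfl, by linarith⟩
  have hpi := Real.pi_gt_three
  have hcos : 0 < Real.cos δ + 1 := by
    have := Real.cos_pos_of_mem_Ioo (x := δ) ⟨by linarith, by linarith⟩
    linarith
  have hsin : 0 < Real.sin δ := Real.sin_pos_of_pos_of_lt_pi hδ0 (by linarith)
  have hpos : 0 < φ (δ, 1) := by
    have h3 := hsgn δ hmδ
    by_contra hcon
    have := mul_nonpos_of_nonpos_of_nonneg (not_lt.1 hcon) hcos.le
    linarith
  have hneg : φ (-δ, 1) < 0 := by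
    have h3 := hsgn (-δ) hmδ'
    rw [Real.cos_neg, Real.sin_neg] at h3
    by_contra hcon
    have := mul_nonneg (not_lt.1 hcon) hcos.le
    linarith
  have hslice : ∀ t : ℝ, Tendsto (fun h : U n => (t, h)) (𝓝 1) (𝓝 (t, 1)) := fun t =>
    (Continuous.prodMk_right t).tendsto 1
  have h5 : ∀ᶠ h : U n in 𝓝 1, 0 < φ (δ, h) :=
    (hslice δ).eventually ((hφc _ (hab (hpaδ δ hmδ) hpb1).1).eventually (lt_mem_nhds hpos))
  have h6 : ∀ᶠ h : U n in 𝓝 1, φ (-δ, h) < 0 :=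
    (hslice (-δ)).eventually ((hφc _ (hab (hpaδ (-δ) hmδ') hpb1).1).eventually (gt_mem_nhds hneg))
  filter_upwards [hpb, h5, h6] with h hh h7 h8
  have hcont : ContinuousOn (fun t => φ (t, h)) (Set.Icc (-δ) δ) := fun t ht =>
    (ContinuousAt.comp (g := φ) (f := fun t : ℝ => (t, h)) (hφc _ (hab (hpaδ t ht) hh).1)
      (Continuous.prodMk_left h).continuousAt).continuousWithinAt
  obtain ⟨t, ht, ht0⟩ := intermediate_value_Icc (by linarith) hcont ⟨h8.le, h7.le⟩
  obtain ⟨hu, hm⟩ := hab (hpaδ t ht) hh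
  have hmem : cayleyInv (T (t, h)) ∈ normSkew n :=
    ⟨star_cayleyInv (scalarUnitary (Circle.exp t) * h : U n).2 hu, ht0⟩
  refine ⟨_, hm, Circle.exp (-t), ?_⟩
  have h9 : normCayley (normSkewProj n (cayleyInv (T (t, h)))) =
      scalarUnitary (Circle.exp t) * h := by
    apply Subtype.ext
    change cayley (normSkewParam n (normSkewProj n (cayleyInv (T (t, h))))) = T (t, h)
    rw [normSkewParam_normSkewProj hmem, cayley_cayleyInv hu]
  rw [h9, ← mul_assoc, ← scalarUnitary_mul, ← Circle.exp_add, neg_add_cancel, Circle.exp_zero,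
    scalarUnitary_one, one_mul]

/-- Tuples of operators, with the conjugation action of the unitary group. -/
def ConjTuple (ℓ n : ℕ) : Type := Fin ℓ → CxOp n

instance : TopologicalSpace (ConjTuple ℓ n) := inferInstanceAs (TopologicalSpace (Fin ℓ → CxOp n))

instance : T2Space (ConjTuple ℓ n) := inferInstanceAs (T2Space (Fin ℓ → CxOp n))

/-- The identity as a chart. -/
def conjChart : OpenPartialHomeomorph (ConjTuple ℓ n) (Fin ℓ → CxOp n) :=
  OpenPartialHomeomorph.refl (Fin ℓ → CxOp n)

/-- Conjugation of a tuple of operators. -/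
def conjTuple (g : U n) (A : Fin ℓ → CxOp n) (s : Fin ℓ) : CxOp n :=
  (g : CxOp n) * A s * star (g : CxOp n)

instance : MulAction (U n) (ConjTuple ℓ n) where
  smul g A := conjTuple g A
  one_smul A := funext fun s => by
    change (1 : CxOp n) * A s * star (1 : CxOp n) = A s
    rw [star_one, mul_one, one_mul]
  mul_smul g h A := funext fun s => by
    change ((g : CxOp n) * h) * A s * star ((g : CxOp n) * h) =
      (g : CxOp n) * ((h : CxOp n) * A s * star (h : CxOp n)) * star (g : CxOp n)
    rw [star_mul]
    simp only [mul_assoc]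

instance : ContinuousSMul (U n) (ConjTuple ℓ n) where
  continuous_smul := by
    have h1 : Continuous fun p : U n × (Fin ℓ → CxOp n) => (p.1 : CxOp n) :=
      continuous_unitary_coe.comp continuous_fst
    exact continuous_pi fun s =>
      (h1.mul ((continuous_apply s).comp continuous_snd)).mul h1.star

theorem scalarUnitary_smul_conjTuple (z : Circle) (A : ConjTuple ℓ n) :
    (scalarUnitary z : U n) • A = A := funext fun s => by
  change ((z : ℂ) • (1 : CxOp n)) * A s * star ((z : ℂ) • (1 : CxOp n)) = A s
  rw [star_smul, star_one, smul_mul_assoc, one_mul, mul_smul_comm, mul_one, smul_smul]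
  have h : star (z : ℂ) * (z : ℂ) = 1 := circle_conj_mul z
  rw [h, one_smul]

theorem contDiffAt_add_coe {E F : Type*} [NormedAddCommGroup E] [NormedSpace ℝ E]
    [NormedAddCommGroup F] [NormedSpace ℝ F] (Z : Submodule ℝ E) {r : F → Z} {x : F}
    (hr : ContDiffAt ℝ ω r x) (a : E) : ContDiffAt ℝ ω (fun y => a + (r y : E)) x :=
  contDiffAt_const.add (Z.subtypeL.contDiff.contDiffAt.comp x hr)

/-- Local slices for the conjugation action at the generators of an irreducible representation. -/
theorem exists_conj_slice [NeZero n] {A₀ : Fin ℓ → CxOp n} (hA₀ : TrivialCommutant A₀) :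
    ∃ R : (Fin ℓ → CxOp n) → Fin ℓ → CxOp n, ContDiffAt ℝ ω R A₀ ∧ R A₀ = A₀ ∧
      (∀ᶠ A in 𝓝 A₀, ∃ g : U n, conjTuple g A = R A) ∧
      ∀ᶠ q in 𝓝 (A₀, A₀), (∃ g : U n, conjTuple g q.1 = q.2) → R q.1 = R q.2 := by
  let u : (Fin (normSkewDim n) → ℝ) → CxOp n := fun w => cayley (normSkewParam n w)
  have hu0 : u 0 = 1 := by
    change cayley (normSkewParam n 0) = 1
    rw [map_zero, cayley_zero]
  have hud : HasFDerivAt u ((2 : ℝ) • normSkewParam n) 0 := hasFDerivAt_cayley_comp _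
  have huc : ∀ w, ContDiffAt ℝ ω u w := fun w =>
    ContDiffAt.comp (g := cayley) w
      (contDiffAt_cayley (isUnit_one_sub_skew (normSkewParam_mem w).1))
      (normSkewParam n).contDiff.contDiffAt
  have husd : HasFDerivAt (fun w => star (u w))
      (((starL' ℝ : CxOp n ≃L[ℝ] CxOp n) : CxOp n →L[ℝ] CxOp n).comp
        ((2 : ℝ) • normSkewParam n)) 0 := hasFDerivAt_star_comp hud
  have hB : ∀ s, ∃ B : (Fin (normSkewDim n) → ℝ) →L[ℝ] CxOp n,
      (∀ w, B w = ((2 : ℝ) • normSkewParam n w) * A₀ s +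
        A₀ s * star ((2 : ℝ) • normSkewParam n w)) ∧
      HasFDerivAt (fun w => u w * A₀ s * star (u w)) B 0 := fun s =>
    exists_hasFDerivAt_mul_mul (A := CxOp n) hud husd hu0
      (by rw [hu0, star_one]) _
  choose B hBw hBd using hB
  have hfin : FiniteDimensional ℝ (Fin ℓ → CxOp n) := inferInstance
  obtain ⟨Z, r, -, hr, hr0, -, hrx, hrq⟩ := exists_slice (K := U n) (X := ConjTuple ℓ n)
    (E := Fin ℓ → CxOp n) (V := Fin ℓ → CxOp n) (W := Fin (normSkewDim n) → ℝ)
    conjChart (x₀ := A₀) (Set.mem_univ _)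
    normCayley (Subtype.ext hu0)
    (Topology.IsInducing.subtypeVal.continuousAt_iff.2 (huc 0).continuousAt)
    (by
      -- By Schur the stabilizer of A₀ consists of scalars, which act trivially on every tuple. So h
      -- near g acts as hg⁻¹ near 1, and the latter is a scalar times a small Cayley transform.
      intro g hg S hS
      have hcomm : ∀ s, (g : CxOp n) * A₀ s = A₀ s * (g : CxOp n) := fun s => by
        have h1 : (g : CxOp n) * A₀ s * star (g : CxOp n) = A₀ s := congrFun hg s
        conv_rhs => rw [← h1]
        rw [mul_assoc, (Unitary.mem_iff.1 g.2).1, mul_one]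
      obtain ⟨z, hz⟩ := hA₀ _ hcomm
      have htriv : ∀ A : ConjTuple ℓ n, g • A = A := fun A => funext fun s => by
        change (g : CxOp n) * A s * star (g : CxOp n) = A s
        have h1 : (g : CxOp n) * A s = A s * (g : CxOp n) := by
          rw [hz, smul_mul_assoc, mul_smul_comm, one_mul, mul_one]
        rw [h1, mul_assoc, (Unitary.mem_iff.1 g.2).2, mul_one]
      have h1 : Tendsto (fun h : U n => h * g⁻¹) (𝓝 g) (𝓝 1) := by
        have := (continuous_mul_const g⁻¹).tendsto g
        rwa [mul_inv_cancel] at this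
      filter_upwards [h1.eventually (eventually_normCayley hS)] with h hh
      obtain ⟨w, hw, z', e⟩ := hh
      refine ⟨w, hw, fun A => ?_⟩
      have h2 : h • A = (h * g⁻¹) • (g • A) := by rw [smul_smul, inv_mul_cancel_right]
      rw [h2, htriv, e, mul_smul, scalarUnitary_smul_conjTuple])
    (by
      have h1 : ContDiffAt ℝ ω (fun q : (Fin (normSkewDim n) → ℝ) × (Fin ℓ → CxOp n) => u q.1)
          (0, A₀) := ContDiffAt.comp (g := u) (f := Prod.fst) _ (huc 0) contDiffAt_fst
      have h2 : ContDiffAt ℝ ω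
          (fun q : (Fin (normSkewDim n) → ℝ) × (Fin ℓ → CxOp n) => star (u q.1)) (0, A₀) :=
        (contDiff_star_of_cstar (A := CxOp n)).contDiffAt.comp _ h1
      exact contDiffAt_pi.2 fun s =>
        (h1.mul ((contDiff_apply ℝ _ s).comp contDiff_snd).contDiffAt).mul h2)
    (fun A => A) differentiableAt_id (ContinuousLinearMap.pi B) (hasFDerivAt_pi.2 hBd)
    (by
      -- A kernel element is a scalar by Schur; skewness kills its real part and the normalisation
      -- of the first entry its imaginary part.
      rw [injective_iff_map_eq_zero]
      intro w hw
      have h2 : ∀ s, normSkewParam n ((2 : ℝ) • w) * A₀ s =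
          A₀ s * normSkewParam n ((2 : ℝ) • w) := fun s => by
        have h3 : B s w = 0 := congrFun hw s
        rw [hBw, ← map_smul, (normSkewParam_mem _).1, CxOp.mul_neg, ← sub_eq_add_neg] at h3
        exact sub_eq_zero.1 h3
      obtain ⟨z, hz⟩ := hA₀ _ h2
      have h4 := normSkewParam_mem ((2 : ℝ) • w)
      have h5 := re_inner_skew h4.1 (unitVec n)
      have h6 := h4.2
      rw [hz] at h5 h6
      have h7 : inner ℂ (unitVec n) ((z • (1 : CxOp n)) (unitVec n)) = z := inner_unitVec z
      rw [h7] at h5 h6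
      have h8 : z = 0 := Complex.ext h5 h6
      have h9 : (2 : ℝ) • w = 0 := by
        rw [← normSkewProj_normSkewParam ((2 : ℝ) • w), hz, h8]
        exact (congrArg _ (zero_smul ℂ (1 : CxOp n))).trans (map_zero _)
      exact (smul_eq_zero.1 h9).resolve_left two_ne_zero)
  -- The chart is the identity, so moving to the slice is translation of `r` by the base point.
  refine ⟨fun A => A₀ + r A, ?_, ?_, ?_, ?_⟩
  · exact contDiffAt_add_coe Z hr A₀
  · have h1 : r A₀ = 0 := hr0
    simp [h1]
  · exact hrx
  · filter_upwards [hrq] with q hq h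
    have h1 : r q.1 = r q.2 := hq h
    simp only [h1]

end ConjugationSlice

end LagrangianRep

/-! ### Smooth functions on orbit spaces -/

namespace SmoothSpace

open Filter Topology

theorem smoothAt_orbit_iff {K X : Type*} [Group K] [TopologicalSpace X] [SmoothSpace X]
    [MulAction K X]
    (hgerm : ∀ (f : X → ℝ) x, SmoothAt f x → ∀ᶠ x' in 𝓝 x, SmoothAt f x')
    (hact : ∀ g : K, IsSmoothMap (fun x : X => g • x))
    (f : Quotient (MulAction.orbitRel K X) → ℝ) (x : X) :
    SmoothAt f (Quotient.mk (MulAction.orbitRel K X) x) ↔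
      SmoothAt (f ∘ Quotient.mk (MulAction.orbitRel K X)) x := by
  have hcs : ContinuousConstSMul K X := ⟨fun g => (hact g).1⟩
  exact smoothAt_quotient_iff (p := Quotient.mk (MulAction.orbitRel K X))
    isOpenMap_quotient_mk'_mul
    (fun x x' h => by
      obtain ⟨g, hg⟩ := MulAction.orbitRel_apply.1 (Quotient.exact h)
      exact ⟨g⁻¹, by rw [← hg, inv_smul_smul]⟩)
    (fun g x => Quotient.sound (MulAction.orbitRel_apply.2 ⟨g, rfl⟩))
    (fun _ _ => Iff.rfl) hgerm hact f x

end SmoothSpace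

namespace LagrangianRep

open Filter Topology SmoothSpace Lagrangian

/-! ### The embedding of orbit spaces -/

section Embedding

variable {n ℓ : ℕ}

instance (priority := 2000) : SMul (U n) (HomIrr ℓ n) :=
  (inferInstance : MulAction (U n) (HomIrr ℓ n)).toSMul

instance : ContinuousSMul (U n) (HomIrr ℓ n) where
  continuous_smul :=
    (continuous_fst.smul (continuous_subtype_val.comp continuous_snd)).subtype_mk _

instance : T2Space (HomIrr ℓ n) := inferInstanceAs (T2Space {ρ : HomU ℓ n // ρ ∈ HomIrr ℓ n})

/-- The images of the generators of an irreducible representation. -/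
def homCoords (ρ : HomIrr ℓ n) : Fin ℓ → CxOp n := ρ.1.coords

theorem isModel_homCoords : IsModel (homCoords : HomIrr ℓ n → _) := isModel_coords.subtype _

instance : SecondCountableTopology (HomIrr ℓ n) :=
  isModel_homCoords.isInducing.secondCountableTopology

theorem homCoords_smul (g : U n) (ρ : HomIrr ℓ n) :
    homCoords (g • ρ) = conjTuple g (homCoords ρ) := rfl

theorem isSmoothMap_smul_homIrr (g : U n) : IsSmoothMap fun ρ : HomIrr ℓ n => g • ρ := by
  refine isModel_homCoords.isSmoothMap isModel_homCoords fun ρ => ?_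
  refine ⟨conjTuple g, ?_, .of_forall fun ρ' => homCoords_smul g ρ'⟩
  exact (contDiff_pi.2 fun s => (contDiff_const.mul (contDiff_apply ℝ _ s)).mul
    contDiff_const).nearSmooth _

/-- The class of an irreducible representation. -/
def repMk (ρ : HomIrr ℓ n) : RepIrr ℓ n := Quotient.mk _ ρ

/-- The class of an irreducible tuple. -/
def lamMk (x : LambdaIrr ℓ n) : LambdaIrrQuot ℓ n := Quotient.mk _ x

theorem smoothAt_repMk_iff (f : RepIrr ℓ n → ℝ) (ρ : HomIrr ℓ n) :
    SmoothAt f (repMk ρ) ↔ SmoothAt (f ∘ repMk) ρ :=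
  smoothAt_orbit_iff (fun _ _ h => isModel_homCoords.eventually h) isSmoothMap_smul_homIrr f ρ

theorem smoothAt_lamMk_iff (f : LambdaIrrQuot ℓ n → ℝ) (x : LambdaIrr ℓ n) :
    SmoothAt f (lamMk x) ↔ SmoothAt (f ∘ lamMk) x :=
  smoothAt_orbit_iff (fun _ _ h => isModel_irrReflOps.eventually h) isSmoothMap_smul_lambdaIrr f x

theorem isOpenMap_repMk : IsOpenMap (repMk : HomIrr ℓ n → RepIrr ℓ n) :=
  isOpenMap_quotient_mk'_mul

theorem isOpenMap_lamMk : IsOpenMap (lamMk : LambdaIrr ℓ n → LambdaIrrQuot ℓ n) :=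
  isOpenMap_quotient_mk'_mul

theorem continuous_repMk : Continuous (repMk : HomIrr ℓ n → RepIrr ℓ n) := continuous_quotient_mk'

theorem continuous_lamMk : Continuous (lamMk : LambdaIrr ℓ n → LambdaIrrQuot ℓ n) :=
  continuous_quotient_mk'

theorem repMk_eq_iff (ρ ρ' : HomIrr ℓ n) : repMk ρ = repMk ρ' ↔ ∃ g : U n, g • ρ = ρ' := by
  constructor
  · intro h
    obtain ⟨g, hg⟩ := MulAction.orbitRel_apply.1 (Quotient.exact h)
    exact ⟨g⁻¹, by rw [← hg, inv_smul_smul]⟩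
  · rintro ⟨g, rfl⟩
    exact (Quotient.sound (MulAction.orbitRel_apply.2 ⟨g, rfl⟩)).symm

theorem lamMk_eq_iff (x x' : LambdaIrr ℓ n) : lamMk x = lamMk x' ↔ ∃ g : U n, g • x = x' := by
  constructor
  · intro h
    obtain ⟨g, hg⟩ := MulAction.orbitRel_apply.1 (Quotient.exact h)
    exact ⟨g⁻¹, by rw [← hg, inv_smul_smul]⟩
  · rintro ⟨g, rfl⟩
    exact (Quotient.sound (MulAction.orbitRel_apply.2 ⟨g, rfl⟩)).symm

/-- Every point of the circle is a square w², and w² acts on tuples as the unitary scalar w. -/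
theorem lamMk_circle_smul (z : Circle) (x : LambdaIrr ℓ n) : lamMk (z • x) = lamMk x := by
  obtain ⟨w, rfl⟩ := exists_mul_self_circle z
  rw [eq_comm, lamMk_eq_iff]
  exact ⟨scalarUnitary w, Subtype.ext (funext fun s => scalarUnitary_smul w (x.1 s))⟩

theorem exists_lamMk_eq (y : LambdaIrrQuot ℓ n) : ∃ x, lamMk x = y := Quotient.exists_rep y

/-- The irreducible representation of an irreducible tuple. -/
def lamHom (x : LambdaIrr ℓ n) : HomIrr ℓ n := ⟨phiTilde x.1, x.2⟩

theorem phiIrr_lamMk (x : LambdaIrr ℓ n) : phiIrr (lamMk x) = repMk (lamHom x) := rfl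

theorem lamHom_smul (g : U n) (x : LambdaIrr ℓ n) : lamHom (g • x) = g • lamHom x :=
  Subtype.ext (phiTilde_smul g x.1)

theorem phiTildeIrr_eq_of_lamHom_eq {x x' : LambdaIrr ℓ n} (h : lamHom x = lamHom x') :
    phiTildeIrr x = phiTildeIrr x' :=
  Subtype.ext (congrArg (fun ρ : HomIrr ℓ n => ρ.1) h)

theorem isSmoothMap_lamHom : IsSmoothMap (lamHom : LambdaIrr ℓ n → HomIrr ℓ n) :=
  isModel_irrReflOps.isSmoothMap isModel_homCoords fun x =>
    ⟨opsToCoords, contDiff_opsToCoords.nearSmooth (irrReflOps x), .of_forall fun x' =>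
      (opsToCoords_reflOps x'.1).symm⟩

theorem continuous_phiIrr : Continuous (phiIrr : LambdaIrrQuot ℓ n → RepIrr ℓ n) :=
  isQuotientMap_quotient_mk'.continuous_iff.2 (continuous_repMk.comp isSmoothMap_lamHom.1)

/-- Conjugate representations become equal after moving one tuple by g; the tuples then differ by
the circle, which the U(n)-orbits absorb. -/
theorem phiIrr_injective [NeZero ℓ] [NeZero n] :
    Function.Injective (phiIrr : LambdaIrrQuot ℓ n → RepIrr ℓ n) := by
  intro y y' h
  obtain ⟨x, rfl⟩ := exists_lamMk_eq y
  obtain ⟨x', rfl⟩ := exists_lamMk_eq y'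
  rw [phiIrr_lamMk, phiIrr_lamMk, repMk_eq_iff] at h
  obtain ⟨g, hg⟩ := h
  rw [← lamHom_smul] at hg
  obtain ⟨z, hz⟩ := (phiTildeIrr_eq_iff _ _).1 (phiTildeIrr_eq_of_lamHom_eq hg)
  rw [← hz, lamMk_circle_smul, lamMk_eq_iff]
  exact ⟨g, rfl⟩

/-- Openness of φ̃ onto its image gives an open N in Hom whose trace on the Lagrangian irreducibles
is the image of the given open set. The classes of N form a neighbourhood pulling back into that
set, since equal representations have tuples in one U(n)-orbit. -/
theorem isEmbedding_phiIrr [NeZero ℓ] [NeZero n] :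
    IsEmbedding (phiIrr : LambdaIrrQuot ℓ n → RepIrr ℓ n) := by
  refine ⟨isInducing_iff_nhds.2 fun y => ?_, phiIrr_injective⟩
  refine le_antisymm (continuous_phiIrr.tendsto y).le_comap ?_
  obtain ⟨x, rfl⟩ := exists_lamMk_eq y
  intro O hO
  obtain ⟨O', hO'O, hO'o, hxO'⟩ := mem_nhds_iff.1 (continuous_lamMk.continuousAt hO)
  obtain ⟨N, hNo, hN⟩ := isOpen_induced_iff.1 (isOpenMap_phiTildeIrr O' hO'o)
  have hxN : (phiTildeIrr x).1 ∈ N := by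
    have h1 : phiTildeIrr x ∈ Subtype.val ⁻¹' N := by
      rw [hN]
      exact ⟨x, hxO', rfl⟩
    exact h1
  refine ⟨repMk '' (Subtype.val ⁻¹' N), ?_, ?_⟩
  · exact (isOpenMap_repMk _ (hNo.preimage continuous_subtype_val)).mem_nhds ⟨lamHom x, hxN, rfl⟩
  · intro y hy
    obtain ⟨x', rfl⟩ := exists_lamMk_eq y
    obtain ⟨ρ, hρ, e⟩ := hy
    rw [phiIrr_lamMk, eq_comm, repMk_eq_iff] at e
    obtain ⟨g, rfl⟩ := e
    rw [← lamHom_smul] at hρ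
    have h1 : phiTildeIrr (g • x') ∈ Subtype.val ⁻¹' N := hρ
    rw [hN] at h1
    obtain ⟨x'', hx'', e⟩ := h1
    obtain ⟨z, hz⟩ := (phiTildeIrr_eq_iff _ _).1 e.symm
    have h2 : lamMk x'' ∈ O := hO'O hx''
    rwa [← hz, lamMk_circle_smul, ← (lamMk_eq_iff x' (g • x')).2 ⟨g, rfl⟩] at h2

/-- Invariant functions near an irreducible tuple are pull-backs of invariant functions. -/
theorem exists_smoothAt_repMk [NeZero ℓ] [NeZero n] (x₀ : LambdaIrr ℓ n)
    {f : LambdaIrrQuot ℓ n → ℝ} (hf : SmoothAt f (lamMk x₀)) :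
    ∃ h : RepIrr ℓ n → ℝ, SmoothAt h (phiIrr (lamMk x₀)) ∧ f =ᶠ[𝓝 (lamMk x₀)] h ∘ phiIrr := by
  obtain ⟨G, hG, hfG⟩ := (isModel_irrReflOps.smoothAt_iff _ _).1 ((smoothAt_lamMk_iff f x₀).1 hf)
  obtain ⟨S, hS, hev⟩ := exists_phaseSection_eq x₀
  obtain ⟨R, hR, hR0, hRg, hRq⟩ := exists_conj_slice
    (HomU.Irr.trivialCommutant (ρ := phiTilde x₀.1) x₀.2)
  set A₀ := (phiTilde x₀.1).coords with hA₀
  have hS0 : S A₀ = irrReflOps x₀ := by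
    have h1 := (hev.self_of_nhds x₀ rfl).2
    rwa [phaseSection_self] at h1
  -- The extension: move A into the conjugation slice by R, lift by the section S, then evaluate G.
  -- As R is constant on orbits near A₀, H descends to classes.
  let H : (Fin ℓ → CxOp n) → ℝ := fun A => G (S (R A))
  have hH : NearSmooth H A₀ := by
    have h1 : NearSmooth (fun A => S (R A)) A₀ := by
      refine NearSmooth.comp (g := S) (f := R) A₀ ?_ hR.nearSmooth
      rw [hR0]
      exact hS.nearSmooth
    refine NearSmooth.comp (g := G) (f := fun A => S (R A)) A₀ ?_ h1
    simp only [hR0, hS0]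
    exact hG
  rw [nhds_prod_eq] at hRq
  obtain ⟨N₁, hN₁, hinv⟩ := (eventually_prod_self_iff (r := fun A A' =>
    (∃ g : U n, conjTuple g A = A') → R A = R A')).1 hRq
  have hcH : Tendsto homCoords (𝓝 (lamHom x₀)) (𝓝 A₀) :=
    isModel_homCoords.continuous.continuousAt
  obtain ⟨N, hNN₁, hNo, hxN⟩ := mem_nhds_iff.1 (hcH hN₁)
  classical
  -- The value 0 is assigned only to classes not meeting N, which play no role for the germ.
  let h : RepIrr ℓ n → ℝ := fun y =>
    if hy : ∃ ρ ∈ N, repMk ρ = y then H (homCoords hy.choose) else 0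
  have hh : ∀ ρ ∈ N, h (repMk ρ) = H (homCoords ρ) := fun ρ hρ => by
    have hy : ∃ ρ' ∈ N, repMk ρ' = repMk ρ := ⟨ρ, hρ, rfl⟩
    have h1 : h (repMk ρ) = H (homCoords hy.choose) := dif_pos hy
    obtain ⟨h2, h3⟩ := hy.choose_spec
    rw [h1]
    obtain ⟨g, hg⟩ := (repMk_eq_iff _ _).1 h3
    have h4 : R (homCoords hy.choose) = R (homCoords ρ) :=
      hinv _ (hNN₁ h2) _ (hNN₁ hρ) ⟨g, by rw [← homCoords_smul, hg]⟩
    simp only [H, h4]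
  refine ⟨h, ?_, ?_⟩
  · rw [phiIrr_lamMk, smoothAt_repMk_iff, isModel_homCoords.smoothAt_iff]
    refine ⟨H, hH, ?_⟩
    filter_upwards [hNo.mem_nhds hxN] with ρ hρ
    exact hh ρ hρ
  · have hcoord : Tendsto (fun x => homCoords (lamHom x)) (𝓝 x₀) (𝓝 A₀) :=
      hcH.comp isSmoothMap_lamHom.1.continuousAt
    have hRc : Tendsto R (𝓝 A₀) (𝓝 A₀) := by
      have h1 := hR.continuousAt
      rwa [ContinuousAt, hR0] at h1
    obtain ⟨M, hM, hMG⟩ : ∃ M ∈ 𝓝 (irrReflOps x₀), ∀ x, irrReflOps x ∈ M →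
        f (lamMk x) = G (irrReflOps x) := by
      have h1 := hfG
      rw [EventuallyEq, isModel_irrReflOps.isInducing.nhds_eq_comap, eventually_comap] at h1
      exact ⟨_, h1, fun x hx => hx x rfl⟩
    have hSM : ∀ᶠ A in 𝓝 A₀, S A ∈ M := by
      refine hS.continuousAt.eventually_mem ?_
      have h1 : S (irrCoords (phiTildeIrr x₀)) = irrReflOps x₀ := hS0
      rw [h1]
      exact hM
    have h1 : ∀ᶠ x in 𝓝 x₀, f (lamMk x) = h (phiIrr (lamMk x)) := by
      filter_upwards [isSmoothMap_lamHom.1.continuousAt.eventually (hNo.mem_nhds hxN),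
        hcoord.eventually hRg, (hRc.comp hcoord).eventually hev,
        (hRc.comp hcoord).eventually hSM] with x h1 h2 h3 h4
      -- The slice point is conjugate to the representation of x, hence is itself the representation
      -- of g • x. So S returns actual reflections there, those of a circle multiple of g • x, where
      -- G computes f.
      obtain ⟨g, hg⟩ := h2
      have h5 : irrCoords (phiTildeIrr (g • x)) = R (homCoords (lamHom x)) := by
        rw [← hg, ← homCoords_smul, ← lamHom_smul]
        rfl
      have h6 := (h3 (g • x) h5).2
      simp only [Function.comp_apply] at h6 h4
      rw [phiIrr_lamMk, hh _ h1]
      simp only [H]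
      rw [h6] at h4 ⊢
      rw [← hMG _ h4]
      obtain ⟨z, hz⟩ := (phiTildeIrr_eq_iff _ _).1
        (phiTildeIrr_phaseSection x₀ (phiTildeIrr (g • x))).symm
      rw [← hz, lamMk_circle_smul, ← (lamMk_eq_iff x (g • x)).2 ⟨g, rfl⟩]
    exact isOpenMap_lamMk.nhds_le x₀ h1

theorem isSmoothEmbedding_phiIrr [NeZero ℓ] [NeZero n] :
    IsSmoothEmbedding (phiIrr : LambdaIrrQuot ℓ n → RepIrr ℓ n) := by
  refine ⟨isEmbedding_phiIrr, fun y f => ?_⟩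
  obtain ⟨x, rfl⟩ := exists_lamMk_eq y
  refine ⟨exists_smoothAt_repMk x, ?_⟩
  rintro ⟨h, hh, e⟩
  rw [smoothAt_lamMk_iff]
  rw [phiIrr_lamMk, smoothAt_repMk_iff] at hh
  refine isModel_irrReflOps.congr (isSmoothMap_lamHom.2 x _ hh) ?_
  filter_upwards [continuous_lamMk.continuousAt.eventually e] with x' hx'
  exact hx'

theorem range_phiIrr : Set.range (phiIrr : LambdaIrrQuot ℓ n → RepIrr ℓ n) = LRepIrr ℓ n := by
  ext y
  constructor
  · rintro ⟨y, rfl⟩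
    obtain ⟨x, rfl⟩ := exists_lamMk_eq y
    exact ⟨lamHom x, ⟨x.1, rfl⟩, rfl⟩
  · rintro ⟨⟨ρ, hρ⟩, ⟨lam, rfl⟩, rfl⟩
    exact ⟨lamMk ⟨lam, hρ⟩, rfl⟩

instance : T2Space (RepIrr ℓ n) := by
  have := properSMul_of_compactSpace (K := U n) (X := HomIrr ℓ n)
  exact t2Space_quotient_mulAction_of_properSMul

instance : SecondCountableTopology (RepIrr ℓ n) :=
  ContinuousConstSMul.secondCountableTopology

/-- The class of the representation of an irreducible tuple. -/
def lamRep (x : LambdaIrr ℓ n) : LRepIrr ℓ n :=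
  ⟨phiIrr (lamMk x), by
    rw [← range_phiIrr]
    exact ⟨_, rfl⟩⟩

theorem isOpenMap_lamRep [NeZero ℓ] [NeZero n] :
    IsOpenMap (lamRep : LambdaIrr ℓ n → LRepIrr ℓ n) := by
  intro O hO
  obtain ⟨N, hNo, hN⟩ := isEmbedding_phiIrr.isInducing.isOpen_iff.1 (isOpenMap_lamMk O hO)
  refine isOpen_induced_iff.2 ⟨N, hNo, ?_⟩
  ext y
  obtain ⟨y, hy⟩ := y
  rw [← range_phiIrr] at hy
  obtain ⟨q, rfl⟩ := hy
  have h1 : phiIrr q ∈ N ↔ q ∈ lamMk '' O := by rw [← hN]; rfl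
  refine h1.trans ⟨?_, ?_⟩
  · rintro ⟨x, hx, rfl⟩
    exact ⟨x, hx, rfl⟩
  · rintro ⟨x, hx, e⟩
    exact ⟨x, hx, phiIrr_injective (congrArg Subtype.val e)⟩

theorem continuous_lamRep : Continuous (lamRep : LambdaIrr ℓ n → LRepIrr ℓ n) :=
  (continuous_phiIrr.comp continuous_lamMk).subtype_mk _

/-- The smooth embedding identifies restrictions of smooth functions on Rep^irr with smooth
functions on the orbit space, so the image carries the quotient structure. -/
theorem smoothAt_lamRep_iff [NeZero ℓ] [NeZero n] (f : LRepIrr ℓ n → ℝ) (x : LambdaIrr ℓ n) :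
    SmoothAt f (lamRep x) ↔ SmoothAt (f ∘ lamRep) x := by
  let c : LambdaIrrQuot ℓ n → LRepIrr ℓ n := fun q =>
    ⟨phiIrr q, by
      rw [← range_phiIrr]
      exact ⟨_, rfl⟩⟩
  have h1 : SmoothAt (f ∘ lamRep) x ↔ SmoothAt (f ∘ c) (lamMk x) :=
    (smoothAt_lamMk_iff (f ∘ c) x).symm
  rw [h1, isSmoothEmbedding_phiIrr.2]
  constructor
  · rintro ⟨h, hh, e⟩
    refine ⟨h, hh, ?_⟩
    have hc : Continuous c := continuous_phiIrr.subtype_mk _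
    filter_upwards [(hc.tendsto (lamMk x)).eventually e] with q hq
    exact hq
  · rintro ⟨h, hh, e⟩
    refine ⟨h, hh, ?_⟩
    have h2 : ∀ᶠ x' in 𝓝 x, f (lamRep x') = h (lamRep x').1 :=
      continuous_lamMk.continuousAt.eventually e
    exact isOpenMap_lamRep.nhds_le x h2

theorem lamRep_eq_iff [NeZero ℓ] [NeZero n] (x x' : LambdaIrr ℓ n) :
    lamRep x = lamRep x' ↔ ∃ g : U n, g • x = x' := by
  rw [← lamMk_eq_iff, ← phiIrr_injective.eq_iff]
  exact Subtype.ext_iff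

theorem isSmoothManifold_LRepIrr [NeZero ℓ] [NeZero n] {d : ℕ}
    (hd : d + n ^ 2 = ℓ * (n + 1).choose 2) : IsEmbeddedSubmanifold (LRepIrr ℓ n) d := by
  refine isSmoothManifold_of_charts fun y => ?_
  obtain ⟨x, rfl⟩ : ∃ x, lamRep x = y := by
    obtain ⟨y, hy⟩ := y
    have hy' := hy
    rw [← range_phiIrr] at hy'
    obtain ⟨q, rfl⟩ := hy'
    obtain ⟨x, rfl⟩ := exists_lamMk_eq q
    exact ⟨x, rfl⟩
  exact exists_chart_unitary_quotient isOpenMap_lamRep continuous_lamRep smoothAt_lamRep_iff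
    lamRep_eq_iff x hd

end Embedding

end LagrangianRep

/-! ### Analytic square roots near the identity -/

namespace SmoothSpace

open Filter Topology

/-- Square roots near the identity depend analytically on the operator. -/
theorem exists_contDiffAt_sqrt (A : Type*) [NormedRing A] [NormedAlgebra ℝ A] [CompleteSpace A] :
    ∃ r : A → A, ContDiffAt ℝ ω r 1 ∧ ∀ᶠ g in 𝓝 (1 : A), r (g * g) = g := by
  have hc : ContDiffAt ℝ ω (fun g : A => g * g) 1 := contDiffAt_id.mul contDiffAt_id
  -- Squaring has derivative 2 at the identity, so the inverse function theorem applies there.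
  let T : A ≃L[ℝ] A := ContinuousLinearEquiv.smulLeft (Units.mk0 (2 : ℝ) two_ne_zero)
  have hd : HasFDerivAt (fun g : A => g * g) (T : A →L[ℝ] A) 1 := by
    have h := (hasFDerivAt_id (𝕜 := ℝ) (1 : A)).mul' (hasFDerivAt_id (𝕜 := ℝ) (1 : A))
    refine HasFDerivAt.congr_fderiv h ?_
    ext w
    simp [T, two_smul, Units.smul_def]
  refine ⟨hc.localInverse hd (by simp), ?_, ?_⟩
  · have h := hc.to_localInverse hd (by simp)
    simpa using h
  · have hs := hc.hasStrictFDerivAt' hd (by simp)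
    exact hs.eventually_left_inverse

end SmoothSpace

namespace LagrangianRep

open Filter Topology SmoothSpace Lagrangian

/-! ### Fibres of φ̃ as homogeneous spaces -/

section Fibre

variable {n ℓ : ℕ}

theorem stabilizer_le_stabilizer_phiTilde (lam : Fin ℓ → Lagrangian n) :
    MulAction.stabilizer (U n) lam ≤ MulAction.stabilizer (U n) (phiTilde lam) := fun g hg => by
  rw [MulAction.mem_stabilizer_iff] at hg ⊢
  rw [← phiTilde_smul, hg]

/-- The fibre of `φ̃` through `lam`. -/
abbrev Fibre (lam : Fin ℓ → Lagrangian n) : Type :=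
  {lam' : Fin ℓ → Lagrangian n // phiTilde lam' = phiTilde lam}

/-- The stabilizer of a tuple, as a subgroup of the stabilizer of its representation. -/
abbrev relStabilizer (lam : Fin ℓ → Lagrangian n) :
    Subgroup (MulAction.stabilizer (U n) (phiTilde lam)) :=
  (MulAction.stabilizer (U n) lam).subgroupOf (MulAction.stabilizer (U n) (phiTilde lam))

/-- The orbit map of the stabilizer of the representation. -/
def fibreOrbit (lam : Fin ℓ → Lagrangian n) (g : MulAction.stabilizer (U n) (phiTilde lam)) :
    Fibre lam :=
  ⟨(g : U n) • lam, by rw [phiTilde_smul]; exact g.2⟩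

theorem isModel_stabilizer (lam : Fin ℓ → Lagrangian n) :
    IsModel fun g : MulAction.stabilizer (U n) (phiTilde lam) => ((g : U n) : CxOp n) :=
  isModel_unitary.subtype _

theorem isModel_fibre (lam : Fin ℓ → Lagrangian n) :
    IsModel fun lam' : Fibre lam => reflOps lam'.1 :=
  isModel_reflOps.subtype _

theorem isSmoothMap_fibreOrbit (lam : Fin ℓ → Lagrangian n) : IsSmoothMap (fibreOrbit lam) := by
  refine (isModel_stabilizer lam).isSmoothMap (isModel_fibre lam) fun g => ?_
  refine ⟨fun a s => toReal a * reflOps lam s * toReal (star a), ?_, .of_forall fun g' =>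
    funext fun s => reflOp_smul (g' : U n) (lam s)⟩
  refine ContDiff.nearSmooth (contDiff_pi.2 fun s => ?_) _
  exact (toReal.contDiff.mul contDiff_const).mul
    (toReal.contDiff.comp (contDiff_star_of_cstar (A := CxOp n)))

/-- Left cosets are the orbits of right multiplication, so the group acting on the stabilizer is the
opposite of the subgroup. -/
theorem smoothAt_coset_iff (lam : Fin ℓ → Lagrangian n)
    (f : MulAction.stabilizer (U n) (phiTilde lam) ⧸ relStabilizer lam → ℝ)
    (g : MulAction.stabilizer (U n) (phiTilde lam)) :
    SmoothAt f (QuotientGroup.mk g) ↔ SmoothAt (f ∘ QuotientGroup.mk) g := by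
  refine smoothAt_quotient_iff (K := (relStabilizer lam).op) QuotientGroup.isOpenMap_coe
    (fun x x' h => ?_) (fun k x => ?_) (fun _ _ => Iff.rfl)
    (fun _ _ h => (isModel_stabilizer lam).eventually h) (fun k => ?_) f g
  · exact ⟨⟨MulOpposite.op (x⁻¹ * x'), QuotientGroup.eq.1 h⟩, mul_inv_cancel_left x x'⟩
  · refine QuotientGroup.eq.2 ?_
    change (x * MulOpposite.unop k.1)⁻¹ * x ∈ relStabilizer lam
    rw [mul_inv_rev, inv_mul_cancel_right]
    exact inv_mem k.2
  · refine (isModel_stabilizer lam).isSmoothMap (isModel_stabilizer lam) fun x => ?_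
    refine ⟨fun a => a * ((MulOpposite.unop k.1).1 : CxOp n), ?_, .of_forall fun _ => rfl⟩
    exact (contDiff_id.mul contDiff_const).nearSmooth _

theorem fibreOrbit_eq_iff (lam : Fin ℓ → Lagrangian n)
    (g g' : MulAction.stabilizer (U n) (phiTilde lam)) :
    fibreOrbit lam g = fibreOrbit lam g' ↔
      (QuotientGroup.mk g : _ ⧸ relStabilizer lam) = QuotientGroup.mk g' := by
  rw [QuotientGroup.eq, Subgroup.mem_subgroupOf, MulAction.mem_stabilizer_iff, Subtype.ext_iff]
  change (g : U n) • lam = (g' : U n) • lam ↔ ((g : U n)⁻¹ * (g' : U n)) • lam = lam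
  rw [mul_smul, inv_smul_eq_iff, eq_comm]

/-- The orbit map on cosets. -/
def cosetOrbit (lam : Fin ℓ → Lagrangian n)
    (q : MulAction.stabilizer (U n) (phiTilde lam) ⧸ relStabilizer lam) : Fibre lam :=
  fibreOrbit lam q.out

theorem cosetOrbit_mk (lam : Fin ℓ → Lagrangian n)
    (g : MulAction.stabilizer (U n) (phiTilde lam)) :
    cosetOrbit lam (QuotientGroup.mk g) = fibreOrbit lam g := by
  rw [cosetOrbit, fibreOrbit_eq_iff]
  exact QuotientGroup.out_eq' _

theorem isSmoothMap_cosetOrbit (lam : Fin ℓ → Lagrangian n) : IsSmoothMap (cosetOrbit lam) := by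
  have h1 : cosetOrbit lam ∘ QuotientGroup.mk = fibreOrbit lam := funext (cosetOrbit_mk lam)
  refine ⟨?_, fun q f hf => ?_⟩
  · rw [(QuotientGroup.isQuotientMap_mk (N := relStabilizer lam)).continuous_iff, h1]
    exact (isSmoothMap_fibreOrbit lam).1
  · obtain ⟨g, rfl⟩ := QuotientGroup.mk_surjective q
    rw [smoothAt_coset_iff, Function.comp_assoc, h1]
    rw [cosetOrbit_mk] at hf
    exact (isSmoothMap_fibreOrbit lam).2 g f hf

/-- The orbit map has local sections: the elements of the fibre close to `g lam` are obtained from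
it by the principal square roots of the operators comparing the first entries. -/
theorem exists_fibre_section [NeZero ℓ] (lam : Fin ℓ → Lagrangian n) (y : Fibre lam) :
    ∃ t : Fibre lam → MulAction.stabilizer (U n) (phiTilde lam),
      (∀ y', fibreOrbit lam (t y') = y') ∧ ContinuousAt t y ∧
        ∀ f : MulAction.stabilizer (U n) (phiTilde lam) → ℝ,
          SmoothAt f (t y) → SmoothAt (f ∘ t) y := by
  obtain ⟨g₀, hg₀, -, -⟩ := exists_smul_eq_of_phiTilde_eq y.2.symm
  have hex : ∀ y' : Fibre lam, ∃ g : U n, g • y.1 = y'.1 ∧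
      (g : CxOp n) * g = (τ₂ (y'.1 0) (y.1 0) : CxOp n) ∧
      ‖(g : CxOp n) - 1‖ ≤ ‖(τ₂ (y'.1 0) (y.1 0) : CxOp n) - 1‖ := fun y' =>
    exists_smul_eq_of_phiTilde_eq (y.2.trans y'.2.symm)
  choose k hk hkk hkn using hex
  -- First g₀ carries `lam` to the base point y, then the chosen square root k(y') carries y to y'.
  let t : Fibre lam → MulAction.stabilizer (U n) (phiTilde lam) := fun y' =>
    ⟨k y' * g₀, by
      rw [MulAction.mem_stabilizer_iff, ← phiTilde_smul, mul_smul, hg₀, hk, y'.2]⟩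
  have ht : ∀ y', fibreOrbit lam (t y') = y' := fun y' => Subtype.ext (by
    change (k y' * g₀) • lam = y'.1
    rw [mul_smul, hg₀, hk])
  obtain ⟨r, hr, hev⟩ := exists_contDiffAt_sqrt (CxOp n)
  let v : (Fin ℓ → RealOp n) → CxOp n := fun X => toCx (X 0 * reflOp (y.1 0))
  have hv : ContDiff ℝ ω v := toCx.contDiff.comp ((contDiff_apply ℝ _ 0).mul contDiff_const)
  have hvt : ∀ y' : Fibre lam, v (reflOps y'.1) = (τ₂ (y'.1 0) (y.1 0) : CxOp n) := fun y' =>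
    toCx_reflOp_mul _ _
  have hvy : v (reflOps y.1) = 1 := by
    rw [hvt, τ₂_self]
    rfl
  -- The norm bound on the roots forces k(y') → 1. Near 1 there is only one square root, the
  -- analytic one, so the arbitrary choice k is smooth at y.
  have hkt : Tendsto (fun y' => (k y' : CxOp n)) (𝓝 y) (𝓝 1) := by
    rw [tendsto_iff_norm_sub_tendsto_zero]
    have h1 : Tendsto (fun y' : Fibre lam => ‖v (reflOps y'.1) - 1‖) (𝓝 y) (𝓝 0) := by
      have h2 : Continuous fun y' : Fibre lam => ‖v (reflOps y'.1) - 1‖ :=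
        ((hv.continuous.comp (isModel_fibre lam).continuous).sub continuous_const).norm
      have h3 := h2.tendsto y
      rwa [hvy, sub_self, norm_zero] at h3
    refine squeeze_zero (fun _ => norm_nonneg _) (fun y' => ?_) h1
    rw [hvt]
    exact hkn y'
  have hmain := (isModel_fibre lam).smoothAt_comp (isModel_stabilizer lam) (f := t) (x := y)
    ⟨fun X => r (v X) * (g₀ : CxOp n), by
      refine (ContDiffAt.mul ?_ contDiffAt_const).nearSmooth
      refine ContDiffAt.comp (g := r) (f := v) (reflOps y.1) ?_ hv.contDiffAt
      rw [hvy]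
      exact hr, by
      filter_upwards [hkt.eventually hev] with y' hy'
      change (k y' : CxOp n) * (g₀ : CxOp n) = r (v (reflOps y'.1)) * (g₀ : CxOp n)
      rw [hvt, ← hkk, hy']⟩
  exact ⟨t, ht, hmain.1, hmain.2⟩

/-- All sections of the orbit map induce the same map into cosets. The inverse is therefore global,
while its smoothness at each point is tested with a section adapted to that point. -/
theorem isDiffeo_cosetOrbit [NeZero ℓ] (lam : Fin ℓ → Lagrangian n) : IsDiffeo (cosetOrbit lam) := by
  obtain ⟨t₀, ht₀, -⟩ := exists_fibre_section lam ⟨lam, rfl⟩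
  let f : Fibre lam → MulAction.stabilizer (U n) (phiTilde lam) ⧸ relStabilizer lam :=
    fun y => QuotientGroup.mk (t₀ y)
  have hf : ∀ t : Fibre lam → MulAction.stabilizer (U n) (phiTilde lam),
      (∀ y', fibreOrbit lam (t y') = y') → f = QuotientGroup.mk ∘ t := fun t ht => funext fun y' => by
    refine (fibreOrbit_eq_iff lam _ _).1 ?_
    rw [ht₀, ht]
  refine ⟨isSmoothMap_cosetOrbit lam, f, ⟨continuous_iff_continuousAt.2 fun y => ?_,
    fun y h hh => ?_⟩, fun q => ?_, fun y => ?_⟩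
  · obtain ⟨t, ht, htc, -⟩ := exists_fibre_section lam y
    rw [hf t ht]
    exact ContinuousAt.comp QuotientGroup.continuous_mk.continuousAt htc
  · obtain ⟨t, ht, -, hts⟩ := exists_fibre_section lam y
    rw [hf t ht] at hh ⊢
    rw [Function.comp_apply, smoothAt_coset_iff] at hh
    exact hts _ hh
  · obtain ⟨g, rfl⟩ := QuotientGroup.mk_surjective q
    refine (fibreOrbit_eq_iff lam _ _).1 ?_
    rw [ht₀, cosetOrbit_mk]
  · change cosetOrbit lam (QuotientGroup.mk (t₀ y)) = y
    rw [cosetOrbit_mk, ht₀]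

end Fibre

end LagrangianRep

end

/-! ### The main theorem -/

open SmoothSpace LagrangianRep in
theorem propositionP (n ℓ : ℕ) (hn : 1 ≤ n) (hℓ : 3 ≤ ℓ) :
    (∀ lam : Fin ℓ → Lagrangian n,
      MulAction.stabilizer (U n) lam ≤ MulAction.stabilizer (U n) (phiTilde lam) ∧
      ∃ e : (MulAction.stabilizer (U n) (phiTilde lam) ⧸
            (MulAction.stabilizer (U n) lam).subgroupOf
              (MulAction.stabilizer (U n) (phiTilde lam))) →
          {lam' : Fin ℓ → Lagrangian n // phiTilde lam' = phiTilde lam},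
        IsDiffeo e ∧
        ∀ g : MulAction.stabilizer (U n) (phiTilde lam),
          (e (QuotientGroup.mk g) : Fin ℓ → Lagrangian n) = (g : U n) • lam) ∧
    (∃ d : ℕ, (d : ℝ) = (ℓ : ℝ) / 2 * (n : ℝ) ^ 2 + (ℓ : ℝ) / 2 * n - 1 ∧
      IsEmbeddedSubmanifold (LHomIrr ℓ n) d) ∧
    IsCircleBundle (phiTildeIrr : LambdaIrr ℓ n → LHomIrr ℓ n) ∧
    (∀ lam ∈ LambdaIrr ℓ n, ∀ g : U n, g • lam = lam ↔ g = 1 ∨ g = -1) ∧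
    IsSmoothEmbedding (phiIrr : LambdaIrrQuot ℓ n → RepIrr ℓ n) ∧
    Set.range (phiIrr : LambdaIrrQuot ℓ n → RepIrr ℓ n) = LRepIrr ℓ n ∧
    (∃ d : ℕ, (d : ℝ) = ((ℓ : ℝ) - 2) / 2 * (n : ℝ) ^ 2 + (ℓ : ℝ) / 2 * n ∧
      IsEmbeddedSubmanifold (LRepIrr ℓ n) d) := by
  have hn0 : NeZero n := ⟨by omega⟩
  have hℓ0 : NeZero ℓ := ⟨by omega⟩
  have hch : ((n + 1).choose 2) * 2 = (n + 1) * n := by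
    rw [Nat.choose_two_right, Nat.add_sub_cancel]
    exact Nat.div_mul_cancel (Nat.even_mul_pred_self (n + 1)).two_dvd
  have hchR : (((n + 1).choose 2 : ℕ) : ℝ) = ((n : ℝ) + 1) * n / 2 := by
    rw [eq_div_iff two_ne_zero]
    exact_mod_cast hch
  -- With ℓ ≥ 3 the right side is at least 3n(n+1)/2. This makes both subtractions of natural
  -- numbers below genuine.
  have hle : n ^ 2 ≤ ℓ * (n + 1).choose 2 := by
    nlinarith [Nat.mul_le_mul_right ((n + 1).choose 2) hℓ]
  have hpos : 1 ≤ ℓ * (n + 1).choose 2 := le_trans (Nat.one_le_pow _ _ hn) hle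
  refine ⟨fun lam => ⟨stabilizer_le_stabilizer_phiTilde lam, cosetOrbit lam,
    isDiffeo_cosetOrbit lam, fun g => congrArg Subtype.val (cosetOrbit_mk lam g)⟩,
    ⟨ℓ * (n + 1).choose 2 - 1, ?_, isSmoothManifold_LHomIrr (Nat.sub_add_cancel hpos)⟩,
    isCircleBundle_phiTildeIrr, fun lam hlam g => smul_eq_self_iff hlam g,
    isSmoothEmbedding_phiIrr, range_phiIrr,
    ⟨ℓ * (n + 1).choose 2 - n ^ 2, ?_, isSmoothManifold_LRepIrr (Nat.sub_add_cancel hle)⟩⟩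
  · rw [Nat.cast_sub hpos, Nat.cast_mul, hchR, Nat.cast_one]
    ring
  · rw [Nat.cast_sub hle, Nat.cast_mul, hchR, Nat.cast_pow]
    ring
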